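/- Let $\lambda\in(0,1)$, $c\in\mathbb R$, $T>0$, $k\in\{0,1,2,\dots\}$, $Q_T=\mathbb R\times(0,T)$, and let $g=-(-\partial_x^2)^{\lambda/2}$ be the operator with Fourier symbol $-|\xi|^\lambda$. Let $u\in H^{k+1}(Q_T)$ solve $u_t+cu_x=g[u]$ in $Q_T$, $u(\cdot,0)=u_0$, where $u(\cdot,t)$, $t\in[0,T]$, denotes the values of the representative of $u$ in $C([0,T];L^2(\mathbb R))$. For $\Delta x>0$ put $x_i=i\Delta x$, $I_i=(x_i,x_{i+1})$, $i\in\mathbb Z$, and let $\varphi_{p,i}$ be the Legendre polynomial of degree $p$ on $I_i$, extended by zero to $\mathbb R$ and normalized by $\varphi_{p,i}(x_{i+1}^-)=1$, $\varphi_{p,i}(x_i^+)=(-1)^p$. Let $F(a,b)=\frac c2(a+b)-\frac{|c|}2(b-a)$ be the upwind flux. The semidiscrete discontinuous Galerkin method with $P^k$ elements seeks $\tilde u(x,t)=\sum_{i\in\mathbb Z}\sum_{p=0}^kU_{p,i}(t)\varphi_{p,i}(x)$ such that, for all $q=0,\dots,k$, $i\in\mathbb Z$ and $t\in[0,T]$,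 $$\frac{\Delta x}{2q+1}\frac{d}{dt}U_{q,i}=\int_{I_i}c\,\tilde u\,\frac{d}{dx}\varphi_{q,i}\,dx+(-1)^qF(\tilde u_i)-F(\tilde u_{i+1})+\int_{I_i}g[\tilde u]\varphi_{q,i}\,dx,\qquad U_{q,i}(0)=\frac{2q+1}{\Delta x}\int_{I_i}u_0\varphi_{q,i}\,dx,$$ where $F(\tilde u_i)=F(\tilde u(x_i^-),\tilde u(x_i^+))$ and $\int_{I_i}g[\tilde u]\varphi_{q,i}$ is the pairing of $g[\tilde u(\cdot,t)]\in H^{-\lambda/2}(\mathbb R)$ with $\varphi_{q,i}\in H^{\lambda/2}(\mathbb R)$. Then there is a constant $c_{k,T}>0$, which may depend on $k,T,\lambda,c,u$ but not on $\Delta x$ or $\tilde u$, such that for every $\Delta x>0$ every solution $\tilde u\in C^1([0,T];H^{\lambda/2}(\mathbb R))$ of the method satisfies $$\|u(\cdot,T)-\tilde u(\cdot,T)\|_{L^2(\mathbb R)}\le c_{k,T}\,\Delta x^{k+1/2}.$$ -/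

import Mathlib

open MeasureTheory Filter Topology Set
open scoped ENNReal ContDiff FourierTransform

noncomputable section

namespace FractalDG

/-! ### The fractional Laplacian `g = -(-∂ₓ²)^{lam/2}` -/

/-- The `L²(ℝ)` Fourier transform (Plancherel) of a real function, with kernel `exp (-2πixξ)`;
the value is `0` if the function is not in `L²(ℝ)`. -/
def l2Fourier (v : ℝ → ℝ) : ℝ → ℂ :=
  open scoped Classical in
  if h : MemLp (fun x => (v x : ℂ)) 2 (volume : Measure ℝ) then
    ((𝓕 (h.toLp (fun x => (v x : ℂ))) : Lp ℂ 2 (volume : Measure ℝ)) : ℝ → ℂ)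
  else 0

/-- The Fourier symbol `-|2πξ|^lam` of `g`; the factor `2π` comes from the normalization
`exp (-2πixξ)` of the Fourier transform. -/
def symbolG (lam : ℝ) (ξ : ℝ) : ℝ := -|2 * Real.pi * ξ| ^ lam

/-- `g[v] = h` in `L²(ℝ)`, with `g` defined by its Fourier symbol. -/
def IsFracLaplacian (lam : ℝ) (v h : ℝ → ℝ) : Prop :=
  MemLp v 2 volume ∧ MemLp h 2 volume ∧
    ∀ᵐ ξ : ℝ, l2Fourier h ξ = (symbolG lam ξ : ℂ) * l2Fourier v ξ

/-- The pairing `⟨g[v], w⟩` between `H^{-lam/2}(ℝ)` and `H^{lam/2}(ℝ)`, for real functions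
`v, w ∈ H^{lam/2}(ℝ)`: the integral over the frequencies of the Fourier transform of `g[v]`
times the conjugate of the Fourier transform of `w`. The integral is real, so its real part is
taken under the integral sign. -/
def pairingG (lam : ℝ) (v w : ℝ → ℝ) : ℝ :=
  ∫ ξ : ℝ, symbolG lam ξ * (l2Fourier v ξ * (starRingEnd ℂ) (l2Fourier w ξ)).re

/-! ### The fractional Sobolev space `H^{lam/2}(ℝ)` -/

/-- The norm of `H^{lam/2}(ℝ)`, with values in `[0, ∞]`. -/
def fracSobolevNorm (lam : ℝ) (v : ℝ → ℝ) : ℝ≥0∞ :=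
  (eLpNorm v 2 volume ^ 2 +
    ∫⁻ x : ℝ, ∫⁻ z : ℝ, ENNReal.ofReal ((v z - v x) ^ 2 / |z - x| ^ (1 + lam))) ^ (1 / 2 : ℝ)

/-- Membership in `H^{lam/2}(ℝ)`. -/
def MemFracSobolev (lam : ℝ) (v : ℝ → ℝ) : Prop :=
  AEStronglyMeasurable v volume ∧ fracSobolevNorm lam v < ⊤

/-- The function `v (x, t)`, written `v x t`, belongs to `C¹([0,T]; H^{lam/2}(ℝ))`: there is a
continuous `w : [0,T] → H^{lam/2}(ℝ)` which is the derivative in `H^{lam/2}(ℝ)` (one-sided at the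
end points) of `t ↦ v(·,t)`. -/
def IsC1FracSobolev (lam T : ℝ) (v : ℝ → ℝ → ℝ) : Prop :=
  (∀ t ∈ Icc 0 T, MemFracSobolev lam (fun x => v x t)) ∧
  ∃ w : ℝ → ℝ → ℝ,
    (∀ t ∈ Icc 0 T, MemFracSobolev lam (fun x => w x t)) ∧
    (∀ t ∈ Icc 0 T, Tendsto (fun s => fracSobolevNorm lam (fun x => w x s - w x t))
      (𝓝[Icc 0 T] t) (𝓝 0)) ∧
    (∀ t ∈ Icc 0 T, Tendsto
      (fun s => fracSobolevNorm lam (fun x => (v x s - v x t) / (s - t) - w x t))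
      (𝓝[Icc 0 T \ {t}] t) (𝓝 0))

/-! ### The Sobolev space `H^m(Q_T)` -/

/-- The space-time strip `Q_T = ℝ × (0,T)`; points are `(x, t)`. -/
def strip (T : ℝ) : Set (ℝ × ℝ) := univ ×ˢ Ioo 0 T

/-- The classical partial derivative `∂ₓ^a ∂ₜ^b φ`. -/
def partialDeriv (a b : ℕ) (φ : ℝ × ℝ → ℝ) (p : ℝ × ℝ) : ℝ :=
  iteratedDeriv a (fun x => iteratedDeriv b (fun t => φ (x, t)) p.2) p.1

/-- `v ∈ L²(Q_T)`. -/
def MemL2Strip (T : ℝ) (v : ℝ → ℝ → ℝ) : Prop :=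
  MemLp (fun p : ℝ × ℝ => v p.1 p.2) 2 (volume.restrict (strip T))

/-- `v` is the weak derivative `∂ₓ^a ∂ₜ^b u` in `Q_T`, and belongs to `L²(Q_T)`. -/
def HasWeakDerivL2 (T : ℝ) (a b : ℕ) (u v : ℝ → ℝ → ℝ) : Prop :=
  MemL2Strip T v ∧
  ∀ φ : ℝ × ℝ → ℝ, ContDiff ℝ ∞ φ → HasCompactSupport φ → tsupport φ ⊆ strip T →
    ∫ p in strip T, u p.1 p.2 * partialDeriv a b φ p =
      (-1) ^ (a + b) * ∫ p in strip T, v p.1 p.2 * φ p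

/-- `u ∈ H^m(Q_T)`: all weak derivatives of order at most `m` exist and are in `L²(Q_T)`. -/
def MemSobolevStrip (T : ℝ) (m : ℕ) (u : ℝ → ℝ → ℝ) : Prop :=
  MemL2Strip T u ∧ ∀ a b : ℕ, a + b ≤ m → ∃ v : ℝ → ℝ → ℝ, HasWeakDerivL2 T a b u v

/-! ### The linear equation -/

/-- `t ↦ u(·,t)` is continuous from `[0,T]` to `L²(ℝ)`. -/
def IsContinuousL2 (T : ℝ) (u : ℝ → ℝ → ℝ) : Prop :=
  ∀ t ∈ Icc 0 T, MemLp (fun x => u x t) 2 volume ∧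
    Tendsto (fun s => eLpNorm (fun x => u x s - u x t) 2 volume) (𝓝[Icc 0 T] t) (𝓝 0)

/-- `u` is a solution in `Q_T` of `u_t + c u_x = g[u]`, `u(·,0) = u0`, with weak derivatives
`u_t, u_x ∈ L²(Q_T)`. The values of `u` at the single times `t ∈ [0,T]` are those of the
representative which is continuous in time with values in `L²(ℝ)`. -/
def IsLinearSolution (lam c T : ℝ) (u0 : ℝ → ℝ) (u : ℝ → ℝ → ℝ) : Prop :=
  MemL2Strip T u ∧ IsContinuousL2 T u ∧ (∀ᵐ x : ℝ, u x 0 = u0 x) ∧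
  ∃ ut ux : ℝ → ℝ → ℝ, HasWeakDerivL2 T 0 1 u ut ∧ HasWeakDerivL2 T 1 0 u ux ∧
    ∀ᵐ t ∂(volume.restrict (Ioo 0 T)),
      IsFracLaplacian lam (fun x => u x t) (fun x => ut x t + c * ux x t)

/-! ### The semidiscrete discontinuous Galerkin method -/

/-- The cell `I_i = (i Δx, (i+1) Δx)`. -/
def cell (dx : ℝ) (i : ℤ) : Set ℝ := Ioo (i * dx) ((i + 1) * dx)

/-- The Legendre polynomial `φ_{p,i}` of degree `p` on the cell `I_i`, extended by zero, with the
normalization `φ_{p,i}(x_{i+1}⁻) = 1`, `φ_{p,i}(x_i⁺) = (-1)^p`. (Mathlib's shifted Legendre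
polynomial is `y ↦ P_p(1 - 2y)` on `[0,1]`.) -/
def legendreCell (dx : ℝ) (p : ℕ) (i : ℤ) : ℝ → ℝ :=
  (cell dx i).indicator
    (fun x => Polynomial.aeval (((i + 1) * dx - x) / dx) (Polynomial.shiftedLegendre p))

/-- The piecewise polynomial function `∑_i ∑_{p ≤ k} U_{p,i}(t) φ_{p,i}(x)`. -/
def dgFunction (dx : ℝ) (k : ℕ) (U : ℕ → ℤ → ℝ → ℝ) (x t : ℝ) : ℝ :=
  ∑' i : ℤ, ∑ p ∈ Finset.range (k + 1), U p i t * legendreCell dx p i x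

/-- The numerical flux `F(ũ_i) = F(ũ(x_i⁻), ũ(x_i⁺))` at the grid point `x_i`. -/
def fluxAt (F : ℝ → ℝ → ℝ) (k : ℕ) (U : ℕ → ℤ → ℝ → ℝ) (i : ℤ) (t : ℝ) : ℝ :=
  F (∑ p ∈ Finset.range (k + 1), U p (i - 1) t)
    (∑ p ∈ Finset.range (k + 1), U p i t * (-1) ^ p)

/-- The coefficients `U` solve, on `[0,T]`, the semidiscrete method with elements `P^k`, mesh size
`dx`, flux function `f`, numerical flux `F` and initial datum `u0`. The integral of
`g[ũ] φ_{q,i}` over the cell is the duality pairing of `g[ũ(·,t)]` with `φ_{q,i}`. -/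
structure IsSemidiscreteSolution (lam T dx : ℝ) (k : ℕ) (f : ℝ → ℝ) (F : ℝ → ℝ → ℝ)
    (u0 : ℝ → ℝ) (U : ℕ → ℤ → ℝ → ℝ) : Prop where
  init : ∀ q ≤ k, ∀ i : ℤ,
    U q i 0 = (2 * q + 1) / dx * ∫ x in cell dx i, u0 x * legendreCell dx q i x
  evol : ∀ q ≤ k, ∀ i : ℤ, ∀ t ∈ Icc 0 T, ∃ d : ℝ, HasDerivWithinAt (U q i) d (Icc 0 T) t ∧
    dx / (2 * q + 1) * d =
      (∫ x in cell dx i, f (dgFunction dx k U x t) * deriv (legendreCell dx q i) x)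
        + (-1) ^ q * fluxAt F k U i t - fluxAt F k U (i + 1) t
        + pairingG lam (fun x => dgFunction dx k U x t) (legendreCell dx q i)

/-- The upwind flux for `f(u) = c u`. -/
def upwindFlux (c a b : ℝ) : ℝ := c / 2 * (a + b) - |c| / 2 * (b - a)

end FractalDG

end

/-!
The proof compares the discrete solution `ũ` with the cellwise `L²` projection `Pu` of the exact
solution. Write `u - ũ = ρ - θ` with the projection error `ρ = u - Pu` and the discrete error
`θ = ũ - Pu`, which is again a piecewise polynomial of degree `k`, hence an admissible test
function. Let `V_i` denote the `L²` norm of `∂ₓ^{k+1} u(·,t)` on the cell `I_i`.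

*The discrete error.* Testing the method and the equation for `u` with `θ` gives
`½ d/dt ‖θ‖² = T + N`, where `T` comes from the transport term and `N = ⟨g[θ - ρ], θ⟩`. Inside the
cells `ρ` does not contribute to `T`, because it is orthogonal to polynomials; what remains are
the traces at the grid points. The upwind flux dissipates `|c|/2` times the squares of the jumps of
`θ`, and this absorbs the traces of `ρ` up to `|c|/2` times the sum of their squares
(`exists_hasSum_flux_le`). In the same way, by the Cauchy-Schwarz inequality for the energy,
`N ≤ -⟨g[ρ], ρ⟩`. Taylor's formula and the fact that `P` reproduces polynomials
(`exists_projection_error_le`) bound `ρ²` on the closed cell `I_i` by a multiple of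
`Δx^{2k+1} V_i²`, and also bound the Hölder seminorm of exponent `1/2` on that cell. The first
bound controls the traces. Both together bound the energy `-⟨g[ρ], ρ⟩` by a multiple of
`Δx^{1-lam} Δx^{2k+1} ∑ V_i²`: the energy is an integral over `h` of `h^{-1-lam}` times the squared
`L²` norm of the increments `ρ(· + h) - ρ`, which is of the order of `min h Δx` even across the
jumps, and `0 < lam < 1` (`exists_fracEnergy_le`). This is `exists_energy_rate_le`; it is
integrated in time in `exists_energy_le`. The coefficients of `θ` are absolutely continuous, but
`θ` has infinitely many of them, so that the integration is done for finitely many cells and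
followed by dominated convergence.

*The projection error at time `T`.* For almost every `t`, the approximation property gives
`‖ρ(t)‖ ≤ C Δx^{k+1} ‖∂ₓ^{k+1} u(·,t)‖`, but `∂ₓ^{k+1} u(·,T)` need not exist at the single time
`T`. Since `∂ₓ^k ∂ₜ u ∈ L²(Q_T)`, the increment satisfies
`‖ρ(T) - ρ(s)‖² ≤ C (T - s) Δx^{2k}`, and averaging over `s ∈ (T - TΔx, T)` gives
`‖ρ(T)‖² ≤ C Δx^{2k+1}` for `Δx ≤ 1` (`exists_final_projection_error_le`).

*Large meshes.* For `Δx ≥ 1` the power `Δx^{1-lam}` is not bounded, but there the estimate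
follows from stability, `‖ũ(T)‖ ≤ ‖u0‖`, which is the energy estimate for the exact solution `0`.
-/

noncomputable section

namespace FractalDG

/-! ### Legendre polynomials on the unit interval -/

open Polynomial in
/-- The shifted Legendre polynomial with real coefficients. It takes the value `1` at `0` and
`(-1) ^ n` at `1`: the orientation is opposite to that of the cells. -/
def realLegendre (n : ℕ) : ℝ[X] := (shiftedLegendre n).map (Int.castRingHom ℝ)

section Legendre
open Polynomial

lemma aeval_shiftedLegendre (n : ℕ) (y : ℝ) :
    aeval y (shiftedLegendre n) = (realLegendre n).eval y := by
  rw [realLegendre, eval_map, aeval_def]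
  rfl

lemma natDegree_realLegendre (n : ℕ) : (realLegendre n).natDegree = n := by
  rw [realLegendre, natDegree_map_eq_of_injective Int.cast_injective, natDegree_shiftedLegendre]

lemma coeff_realLegendre_self (n : ℕ) :
    (realLegendre n).coeff n = (-1) ^ n * ((n + n).choose n : ℝ) := by
  simp [realLegendre, coeff_map, coeff_shiftedLegendre]

lemma realLegendre_eval_zero (n : ℕ) : (realLegendre n).eval 0 = 1 := by
  rw [← coeff_zero_eq_eval_zero]
  simp [realLegendre, coeff_map, coeff_shiftedLegendre]

lemma realLegendre_eval_one (n : ℕ) : (realLegendre n).eval 1 = (-1) ^ n := by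
  have h := shiftedLegendre_eval_symm n (1 : ℝ)
  rw [aeval_shiftedLegendre, aeval_shiftedLegendre] at h
  simpa [realLegendre_eval_zero] using h

lemma integral_eval_derivative (p : ℝ[X]) (a b : ℝ) :
    ∫ y in a..b, (derivative p).eval y = p.eval b - p.eval a :=
  intervalIntegral.integral_eq_sub_of_hasDerivAt (fun x _ => p.hasDerivAt x)
    ((derivative p).continuous.intervalIntegrable _ _)

lemma integral_derivative_mul (p q : ℝ[X]) (a b : ℝ) :
    ∫ y in a..b, (derivative p).eval y * q.eval y =
      p.eval b * q.eval b - p.eval a * q.eval a -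
        ∫ y in a..b, p.eval y * (derivative q).eval y := by
  have h := integral_eval_derivative (p * q) a b
  simp only [derivative_mul, eval_add, eval_mul] at h
  rw [intervalIntegral.integral_add] at h
  · linarith
  · exact (((derivative p).continuous.mul q.continuous).intervalIntegrable _ _)
  · exact ((p.continuous.mul (derivative q).continuous).intervalIntegrable _ _)

/-- Repeated integration by parts moves `m` derivatives off `(y (1 - y)) ^ n`; no boundary terms
appear as long as `m ≤ n`. -/
lemma integral_iterate_derivative_mul (n m : ℕ) (hm : m ≤ n) (q : ℝ[X]) :
    ∫ y in (0 : ℝ)..1, (derivative^[m] (X ^ n * (1 - X) ^ n : ℝ[X])).eval y * q.eval y =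
      (-1) ^ m * ∫ y in (0 : ℝ)..1, (X ^ n * (1 - X) ^ n : ℝ[X]).eval y *
        (derivative^[m] q).eval y := by
  induction m generalizing q with
  | zero => simp
  | succ m ih =>
    have hr : ∀ r : ℝ[X], ∀ z : ℝ, r.eval z = 0 → r ^ n ∣ (X ^ n * (1 - X) ^ n : ℝ[X]) →
        (derivative^[m] (X ^ n * (1 - X) ^ n : ℝ[X])).eval z = 0 := by
      intro r z hz hd
      obtain ⟨s, hs⟩ := pow_sub_dvd_iterate_derivative_of_pow_dvd m hd
      rw [hs, eval_mul, eval_pow, hz, zero_pow (by omega), zero_mul]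
    rw [Function.iterate_succ_apply', integral_derivative_mul,
      hr X 0 (by simp) (dvd_mul_right _ _), hr (1 - X) 1 (by simp) (dvd_mul_left _ _),
      ih (by omega), Function.iterate_succ_apply, pow_succ]
    ring

/-- Euler's beta integral at integer arguments, by induction on the second exponent. -/
lemma integral_pow_mul_one_sub_pow (m n : ℕ) :
    ∫ y in (0 : ℝ)..1, y ^ m * (1 - y) ^ n =
      (m.factorial * n.factorial : ℝ) / (m + n + 1).factorial := by
  induction n generalizing m with
  | zero =>
    have : (m.factorial : ℝ) ≠ 0 := by positivity
    simp [Nat.factorial_succ]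
    field_simp
  | succ n ih =>
    have h := integral_derivative_mul (X ^ (m + 1) : ℝ[X]) ((1 - X) ^ (n + 1)) 0 1
    simp only [derivative_pow, derivative_sub, derivative_X, derivative_one, eval_mul, eval_pow,
      eval_X, eval_sub, eval_one, eval_C, sub_self, zero_pow (Nat.succ_ne_zero _), mul_zero,
      zero_mul, zero_sub, mul_one, Nat.add_sub_cancel, eval_neg, mul_neg] at h
    have e1 : ∀ y : ℝ, ((m + 1 : ℕ) : ℝ) * y ^ m * (1 - y) ^ (n + 1) =
      ((m + 1 : ℕ) : ℝ) * (y ^ m * (1 - y) ^ (n + 1)) := fun y => by ring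
    have e2 : ∀ y : ℝ, - (y ^ (m + 1) * (((n + 1 : ℕ) : ℝ) * (1 - y) ^ n)) =
      (- ((n + 1 : ℕ) : ℝ)) * (y ^ (m + 1) * (1 - y) ^ n) := fun y => by ring
    simp only [e1, e2, intervalIntegral.integral_const_mul, ih] at h
    have h1 : ((m + 1 : ℕ) : ℝ) ≠ 0 := by positivity
    have h2 : ((m + 1 + n + 1).factorial : ℝ) ≠ 0 := by positivity
    rw [← mul_right_inj' h1, h, show m + (n + 1) + 1 = m + 1 + n + 1 by ring,
      Nat.factorial_succ m, Nat.factorial_succ n]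
    push_cast
    field_simp

/-- Rodrigues' formula. -/
lemma factorial_mul_realLegendre (n : ℕ) :
    (n.factorial : ℝ[X]) * realLegendre n = derivative^[n] (X ^ n * (1 - X) ^ n : ℝ[X]) := by
  have h := congrArg (Polynomial.map (Int.castRingHom ℝ)) (factorial_mul_shiftedLegendre_eq n)
  rw [← Polynomial.iterate_derivative_map] at h
  simpa [realLegendre] using h

lemma factorial_mul_integral_realLegendre_mul (n : ℕ) (q : ℝ[X]) :
    (n.factorial : ℝ) * ∫ y in (0 : ℝ)..1, (realLegendre n).eval y * q.eval y =
      (-1) ^ n * ∫ y in (0 : ℝ)..1, (y ^ n * (1 - y) ^ n) * (derivative^[n] q).eval y := by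
  have h := integral_iterate_derivative_mul n n le_rfl q
  rw [← factorial_mul_realLegendre] at h
  simp only [eval_mul, eval_natCast, eval_pow, eval_X, eval_sub, eval_one] at h
  rw [← h, ← intervalIntegral.integral_const_mul]
  simp only [mul_assoc]

lemma integral_realLegendre_mul_of_natDegree_lt {n : ℕ} {q : ℝ[X]} (h : q.natDegree < n) :
    ∫ y in (0 : ℝ)..1, (realLegendre n).eval y * q.eval y = 0 := by
  have h1 := factorial_mul_integral_realLegendre_mul n q
  rw [iterate_derivative_eq_zero h] at h1
  have : (n.factorial : ℝ) ≠ 0 := by positivity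
  simpa [this] using h1

lemma integral_realLegendre_mul_of_ne {m n : ℕ} (h : m ≠ n) :
    ∫ y in (0 : ℝ)..1, (realLegendre m).eval y * (realLegendre n).eval y = 0 := by
  rcases lt_or_gt_of_ne h with h | h
  · simp_rw [mul_comm (eval _ (realLegendre m))]
    exact integral_realLegendre_mul_of_natDegree_lt (by rwa [natDegree_realLegendre])
  · exact integral_realLegendre_mul_of_natDegree_lt (by rwa [natDegree_realLegendre])

lemma integral_realLegendre_sq (n : ℕ) :
    ∫ y in (0 : ℝ)..1, (realLegendre n).eval y * (realLegendre n).eval y = 1 / (2 * n + 1) := by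
  have h1 := factorial_mul_integral_realLegendre_mul n (realLegendre n)
  have h2 : derivative^[n] (realLegendre n) =
      C ((n.factorial : ℝ) * ((-1) ^ n * ((n + n).choose n : ℝ))) := by
    have h3 : (derivative^[n] (realLegendre n)).natDegree = 0 := by
      have := natDegree_iterate_derivative (realLegendre n) n
      rw [natDegree_realLegendre] at this
      omega
    rw [eq_C_of_natDegree_eq_zero h3, coeff_iterate_derivative, zero_add,
      coeff_realLegendre_self, Nat.descFactorial_self, nsmul_eq_mul]
  rw [h2] at h1
  simp only [eval_C, intervalIntegral.integral_mul_const, integral_pow_mul_one_sub_pow] at h1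
  have h4 : ((n + n).choose n : ℝ) * (n.factorial * n.factorial) = (n + n).factorial := by
    have := Nat.add_choose_mul_factorial_mul_factorial n n
    rw [← this]; push_cast; ring
  have h5 : ((n + n + 1).factorial : ℝ) = (2 * n + 1) * (n + n).factorial := by
    rw [Nat.factorial_succ]; push_cast; ring
  have h6 : ((n + n).factorial : ℝ) ≠ 0 := by positivity
  have h7 : (n.factorial : ℝ) ≠ 0 := by positivity
  have h8 : ((-1 : ℝ) ^ n) * (-1) ^ n = 1 := by rw [← mul_pow]; simp
  rw [← mul_right_inj' h7, h1, h5]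
  have h9 : (2 * (n : ℝ) + 1) ≠ 0 := by positivity
  field_simp
  calc ((-1 : ℝ) ^ n) ^ 2 * (n.factorial : ℝ) ^ 2 * ((n + n).choose n)
      = ((-1 : ℝ) ^ n * (-1) ^ n) * (((n + n).choose n) * (n.factorial * n.factorial)) := by ring
    _ = _ := by rw [h8, h4, one_mul]

lemma exists_eq_sum_realLegendre (k : ℕ) (q : ℝ[X]) (hq : q.natDegree ≤ k) :
    ∃ a : ℕ → ℝ, q = ∑ p ∈ Finset.range (k + 1), C (a p) * realLegendre p := by
  induction k generalizing q with
  | zero =>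
    refine ⟨fun _ => q.coeff 0, ?_⟩
    have h0 : realLegendre 0 = 1 := by
      rw [eq_C_of_natDegree_eq_zero (natDegree_realLegendre 0), coeff_realLegendre_self]
      simp
    rw [eq_C_of_natDegree_le_zero hq]
    simp [h0]
  | succ k ih =>
    have hc : (realLegendre (k + 1)).coeff (k + 1) ≠ 0 := by
      rw [coeff_realLegendre_self]
      have : 0 < ((k + 1) + (k + 1)).choose (k + 1) := Nat.choose_pos (by omega)
      positivity
    set b := q.coeff (k + 1) / (realLegendre (k + 1)).coeff (k + 1)
    obtain ⟨a, ha⟩ := ih (q - C b * realLegendre (k + 1)) (by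
      have h1 : (q - C b * realLegendre (k + 1)).natDegree ≤ k + 1 := by
        refine (natDegree_sub_le _ _).trans (max_le hq ?_)
        exact (natDegree_C_mul_le _ _).trans (natDegree_realLegendre _).le
      have h2 : (q - C b * realLegendre (k + 1)).coeff (k + 1) = 0 := by
        rw [coeff_sub, coeff_C_mul, div_mul_cancel₀ _ hc, sub_self]
      refine Nat.le_of_lt_succ (lt_of_le_of_ne h1 fun h => ?_)
      have h3 : ∀ r : ℝ[X], r.natDegree = k + 1 → r.coeff (k + 1) ≠ 0 := fun r hr => by
        rw [← hr, coeff_natDegree, leadingCoeff_ne_zero]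
        rintro rfl
        simp at hr
      exact h3 _ h h2)
    refine ⟨Function.update a (k + 1) b, ?_⟩
    rw [Finset.sum_range_succ, Function.update_self]
    rw [sub_eq_iff_eq_add] at ha
    rw [ha]
    congr 1
    refine Finset.sum_congr rfl fun p hp => ?_
    rw [Function.update_of_ne (by rw [Finset.mem_range] at hp; omega)]

lemma integral_sum_realLegendre_mul (k : ℕ) (a : ℕ → ℝ) {q : ℕ} (hq : q ∈ Finset.range (k + 1)) :
    ∫ y in (0 : ℝ)..1, (∑ p ∈ Finset.range (k + 1), a p * (realLegendre p).eval y) *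
      (realLegendre q).eval y = a q / (2 * q + 1) := by
  simp_rw [Finset.sum_mul, mul_assoc]
  rw [intervalIntegral.integral_finsetSum]
  · simp_rw [intervalIntegral.integral_const_mul]
    rw [Finset.sum_eq_single q]
    · rw [integral_realLegendre_sq]; ring
    · intro p _ hp
      rw [integral_realLegendre_mul_of_ne hp, mul_zero]
    · exact fun h => absurd hq h
  · intro p _
    exact (continuous_const.mul
      ((realLegendre p).continuous.mul (realLegendre q).continuous)).intervalIntegrable _ _

/-- On `[0, 1]` the Legendre polynomials of degree at most `k` have a common bound and a common
Lipschitz constant. -/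
lemma exists_bound_realLegendre (k : ℕ) : ∃ B : ℝ, 1 ≤ B ∧ ∀ p ≤ k,
    (∀ y ∈ Icc (0 : ℝ) 1, |(realLegendre p).eval y| ≤ B) ∧
    ∀ y ∈ Icc (0 : ℝ) 1, ∀ z ∈ Icc (0 : ℝ) 1,
      |(realLegendre p).eval y - (realLegendre p).eval z| ≤ B * |y - z| := by
  have h : ∀ p : ℕ, ∃ B : ℝ, 1 ≤ B ∧ (∀ y ∈ Icc (0 : ℝ) 1, |(realLegendre p).eval y| ≤ B) ∧
      ∀ y ∈ Icc (0 : ℝ) 1, ∀ z ∈ Icc (0 : ℝ) 1,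
        |(realLegendre p).eval y - (realLegendre p).eval z| ≤ B * |y - z| := by
    intro p
    obtain ⟨B, hB⟩ := isCompact_Icc.exists_bound_of_continuousOn
      (s := Icc (0 : ℝ) 1) (realLegendre p).continuous.continuousOn
    obtain ⟨D, hD⟩ := isCompact_Icc.exists_bound_of_continuousOn
      (s := Icc (0 : ℝ) 1) (derivative (realLegendre p)).continuous.continuousOn
    refine ⟨max 1 (max B D), le_max_left _ _, fun y hy => (hB y hy).trans (by simp),
      fun y hy z hz => ?_⟩
    have := (convex_Icc (0 : ℝ) 1).norm_image_sub_le_of_norm_hasDerivWithin_le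
      (f := fun y => (realLegendre p).eval y)
      (fun x _ => ((realLegendre p).hasDerivAt x).hasDerivWithinAt) hD hz hy
    refine this.trans ?_
    rw [Real.norm_eq_abs]
    gcongr
    simp
  choose B hB using h
  refine ⟨∑ p ∈ Finset.range (k + 1), B p, ?_, fun p hp => ?_⟩
  · exact (hB 0).1.trans (Finset.single_le_sum (f := B)
      (fun p _ => by linarith [(hB p).1]) (by simp))
  · have h1 : B p ≤ ∑ p ∈ Finset.range (k + 1), B p := Finset.single_le_sum (f := B)
      (fun p _ => by linarith [(hB p).1]) (by simp; omega)
    exact ⟨fun y hy => ((hB p).2.1 y hy).trans h1, fun y hy z hz =>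
      ((hB p).2.2 y hy z hz).trans (by gcongr)⟩

end Legendre

/-! ### Legendre polynomials on the cells -/

/-- The Legendre polynomial `φ_{p,i}` on the cell `I_i`, not truncated outside the cell. -/
def cellLegendre (dx : ℝ) (i : ℤ) (p : ℕ) (x : ℝ) : ℝ :=
  (realLegendre p).eval (((i + 1) * dx - x) / dx)

lemma legendreCell_eq (dx : ℝ) (p : ℕ) (i : ℤ) :
    legendreCell dx p i = (cell dx i).indicator (cellLegendre dx i p) := by
  rw [legendreCell]
  congr 1
  funext x
  rw [aeval_shiftedLegendre, cellLegendre]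

lemma continuous_cellLegendre (dx : ℝ) (i : ℤ) (p : ℕ) : Continuous (cellLegendre dx i p) :=
  (realLegendre p).continuous.comp (by fun_prop)

lemma cellLegendre_right (dx : ℝ) (i : ℤ) (p : ℕ) : cellLegendre dx i p ((i + 1) * dx) = 1 := by
  simp [cellLegendre, realLegendre_eval_zero]

lemma cellLegendre_left {dx : ℝ} (hdx : 0 < dx) (i : ℤ) (p : ℕ) :
    cellLegendre dx i p (i * dx) = (-1) ^ p := by
  rw [cellLegendre, show ((i + 1) * dx - i * dx) / dx = 1 by field_simp; ring,
    realLegendre_eval_one]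

lemma hasDerivAt_cellLegendre (dx : ℝ) (i : ℤ) (p : ℕ) (x : ℝ) :
    HasDerivAt (cellLegendre dx i p)
      ((Polynomial.derivative (realLegendre p)).eval (((i + 1) * dx - x) / dx) * (-1 / dx)) x := by
  have h : HasDerivAt (fun x : ℝ => ((i + 1) * dx - x) / dx) (-1 / dx) x :=
    ((hasDerivAt_id x).const_sub _).div_const dx
  exact ((realLegendre p).hasDerivAt _).comp x h

lemma deriv_legendreCell {dx : ℝ} (p : ℕ) (i : ℤ) {x : ℝ} (hx : x ∈ cell dx i) :
    deriv (legendreCell dx p i) x = deriv (cellLegendre dx i p) x := by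
  apply Filter.EventuallyEq.deriv_eq
  filter_upwards [isOpen_Ioo.mem_nhds hx] with y hy
  rw [legendreCell_eq, indicator_of_mem]
  exact hy

lemma cell_le {dx : ℝ} (hdx : 0 < dx) (i : ℤ) : (i : ℝ) * dx ≤ (i + 1) * dx := by nlinarith

lemma setIntegral_cell {dx : ℝ} (hdx : 0 < dx) (i : ℤ) (f : ℝ → ℝ) :
    ∫ x in cell dx i, f x = ∫ x in (i * dx)..((i + 1) * dx), f x := by
  rw [intervalIntegral.integral_of_le (cell_le hdx i), cell, integral_Ioc_eq_integral_Ioo]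

lemma intervalIntegral_cell_comp {dx : ℝ} (hdx : 0 < dx) (i : ℤ) (f : ℝ → ℝ) :
    ∫ x in (i * dx)..((i + 1) * dx), f (((i + 1) * dx - x) / dx) =
      dx * ∫ y in (0 : ℝ)..1, f y := by
  have h := intervalIntegral.integral_comp_sub_div (a := i * dx) (b := (i + 1) * dx) f hdx.ne'
    ((i : ℝ) + 1)
  simp_rw [sub_div, mul_div_cancel_right₀ _ hdx.ne'] at h ⊢
  rw [h]
  simp

/-- The element of the discontinuous Galerkin space on the cell `I_i` with given coefficients, as
a polynomial on the whole line. -/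
def cellSum (dx : ℝ) (k : ℕ) (i : ℤ) (a : ℕ → ℝ) (x : ℝ) : ℝ :=
  ∑ p ∈ Finset.range (k + 1), a p * cellLegendre dx i p x

lemma continuous_cellSum (dx : ℝ) (k : ℕ) (i : ℤ) (a : ℕ → ℝ) : Continuous (cellSum dx k i a) :=
  continuous_finsetSum _ fun p _ => continuous_const.mul (continuous_cellLegendre dx i p)

lemma cellSum_right (dx : ℝ) (k : ℕ) (i : ℤ) (a : ℕ → ℝ) :
    cellSum dx k i a ((i + 1) * dx) = ∑ p ∈ Finset.range (k + 1), a p := by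
  simp [cellSum, cellLegendre_right]

lemma cellSum_left {dx : ℝ} (hdx : 0 < dx) (k : ℕ) (i : ℤ) (a : ℕ → ℝ) :
    cellSum dx k i a (i * dx) = ∑ p ∈ Finset.range (k + 1), a p * (-1) ^ p := by
  simp [cellSum, cellLegendre_left hdx]

lemma integral_cellSum_mul {dx : ℝ} (hdx : 0 < dx) (k : ℕ) (i : ℤ) (a : ℕ → ℝ) {q : ℕ}
    (hq : q ≤ k) :
    ∫ x in (i * dx)..((i + 1) * dx), cellSum dx k i a x * cellLegendre dx i q x =
      dx / (2 * q + 1) * a q := by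
  have h := intervalIntegral_cell_comp hdx i (fun y =>
    (∑ p ∈ Finset.range (k + 1), a p * (realLegendre p).eval y) * (realLegendre q).eval y)
  rw [integral_sum_realLegendre_mul k a (by simp; omega)] at h
  simp only [cellSum, cellLegendre]
  rw [h]
  ring

/-- Every polynomial of degree at most `k` belongs to the discontinuous Galerkin space of a
cell. -/
lemma exists_cellSum_eq {dx : ℝ} (hdx : 0 < dx) (k : ℕ) (i : ℤ) (q : Polynomial ℝ)
    (hq : q.natDegree ≤ k) : ∃ a : ℕ → ℝ, ∀ x, cellSum dx k i a x = q.eval x := by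
  obtain ⟨a, ha⟩ := exists_eq_sum_realLegendre k
    (q.comp (Polynomial.C ((i + 1) * dx) - Polynomial.C dx * Polynomial.X)) (by
      refine Polynomial.natDegree_comp_le.trans ?_
      have : (Polynomial.C ((i + 1) * dx) - Polynomial.C dx * Polynomial.X).natDegree ≤ 1 := by
        compute_degree
      nlinarith)
  refine ⟨a, fun x => ?_⟩
  have h := congrArg (Polynomial.eval (((i + 1) * dx - x) / dx)) ha
  simp only [Polynomial.eval_comp, Polynomial.eval_sub, Polynomial.eval_mul, Polynomial.eval_C,
    Polynomial.eval_X, Polynomial.eval_finsetSum] at h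
  rw [cellSum]
  simp only [cellLegendre]
  rw [← h]
  congr 1
  field_simp
  ring

lemma exists_cellSum_eq_deriv (dx : ℝ) (k : ℕ) (i : ℤ) {q : ℕ} (hq : q ≤ k) :
    ∃ a : ℕ → ℝ, ∀ x, deriv (cellLegendre dx i q) x = cellSum dx k i a x := by
  obtain ⟨a, ha⟩ := exists_eq_sum_realLegendre k
    (Polynomial.C (-1 / dx) * Polynomial.derivative (realLegendre q)) (by
      refine (Polynomial.natDegree_C_mul_le _ _).trans
        ((Polynomial.natDegree_derivative_le _).trans ?_)
      rw [natDegree_realLegendre]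
      omega)
  refine ⟨a, fun x => ?_⟩
  rw [(hasDerivAt_cellLegendre dx i q x).deriv]
  have h := congrArg (Polynomial.eval (((i + 1) * dx - x) / dx)) ha
  simp only [Polynomial.eval_mul, Polynomial.eval_C, Polynomial.eval_finsetSum] at h
  rw [cellSum, mul_comm, h]
  rfl

/-- A constant which bounds, uniformly in the cell and the mesh size, the Legendre polynomials of
degree at most `k`, and their Lipschitz constants after multiplication by `dx`. -/
lemma exists_bound_cellLegendre (k : ℕ) : ∃ B : ℝ, 1 ≤ B ∧ ∀ dx : ℝ, 0 < dx → ∀ (i : ℤ), ∀ p ≤ k,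
    (∀ x ∈ Icc (i * dx) ((i + 1) * dx), |cellLegendre dx i p x| ≤ B) ∧
    ∀ x ∈ Icc (i * dx) ((i + 1) * dx), ∀ y ∈ Icc (i * dx) ((i + 1) * dx),
      |cellLegendre dx i p x - cellLegendre dx i p y| ≤ B * (|x - y| / dx) := by
  obtain ⟨B, hB1, hB⟩ := exists_bound_realLegendre k
  refine ⟨B, hB1, fun dx hdx i p hp => ?_⟩
  have hm : ∀ x ∈ Icc (i * dx) ((i + 1) * dx), ((i + 1) * dx - x) / dx ∈ Icc (0 : ℝ) 1 := by
    intro x hx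
    refine ⟨div_nonneg (by linarith [hx.2]) hdx.le, ?_⟩
    rw [div_le_one hdx]
    linarith [hx.1]
  refine ⟨fun x hx => (hB p hp).1 _ (hm x hx), fun x hx y hy => ?_⟩
  refine ((hB p hp).2 _ (hm x hx) _ (hm y hy)).trans (le_of_eq ?_)
  rw [← sub_div, abs_div, abs_of_pos hdx, sub_sub_sub_cancel_left, abs_sub_comm]

/-! ### Primitives of locally integrable functions -/

lemma absolutelyContinuousOnInterval_of_primitive {f f' : ℝ → ℝ} {a b : ℝ}
    (hi : IntervalIntegrable f' volume a b)
    (hf : ∀ x ∈ uIcc a b, f x = f a + ∫ y in a..x, f' y) :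
    AbsolutelyContinuousOnInterval f a b ∧ ∀ᵐ x, x ∈ uIoc a b → deriv f x = f' x := by
  have h1 := hi.absolutelyContinuousOnInterval_intervalIntegral (c := a) left_mem_uIcc
  constructor
  · have h2 : AbsolutelyContinuousOnInterval (fun _ : ℝ => f a) a b :=
      (contDiffOn_const (𝕜 := ℝ)).absolutelyContinuousOnInterval
    have h3 := h2.add h1
    rw [absolutelyContinuousOnInterval_iff] at h3 ⊢
    intro ε hε
    obtain ⟨δ, hδ, h⟩ := h3 ε hε
    refine ⟨δ, hδ, fun E hE hE' => ?_⟩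
    refine lt_of_le_of_lt (Finset.sum_le_sum fun i hi => ?_) (h E hE hE')
    rw [hf _ (hE.1 i hi).1, hf _ (hE.1 i hi).2]
    rfl
  · have hne : ∀ᵐ x : ℝ, x ≠ max a b := by simp [ae_iff, measure_singleton]
    filter_upwards [hi.ae_hasDerivAt_integral, hne] with x hx hxb hxm
    have h4 : HasDerivAt (fun x => f a + ∫ y in a..x, f' y) (f' x) x :=
      (hx (uIoc_subset_uIcc hxm) a left_mem_uIcc).const_add _
    refine HasDerivAt.deriv (h4.congr_of_eventuallyEq ?_)
    have : Ioo (min a b) (max a b) ∈ 𝓝 x :=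
      isOpen_Ioo.mem_nhds ⟨hxm.1, lt_of_le_of_ne hxm.2 hxb⟩
    filter_upwards [this] with y hy
    exact hf y ⟨hy.1.le, hy.2.le⟩

/-- Integration by parts for primitives of integrable functions. -/
lemma integral_mul_eq_sub_of_primitive {f f' g g' : ℝ → ℝ} {a b : ℝ}
    (hfi : IntervalIntegrable f' volume a b) (hgi : IntervalIntegrable g' volume a b)
    (hf : ∀ x ∈ uIcc a b, f x = f a + ∫ y in a..x, f' y)
    (hg : ∀ x ∈ uIcc a b, g x = g a + ∫ y in a..x, g' y) :
    ∫ x in a..b, f x * g' x = f b * g b - f a * g a - ∫ x in a..b, f' x * g x := by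
  obtain ⟨hf1, hf2⟩ := absolutelyContinuousOnInterval_of_primitive hfi hf
  obtain ⟨hg1, hg2⟩ := absolutelyContinuousOnInterval_of_primitive hgi hg
  have h := hf1.integral_mul_deriv_eq_deriv_mul hg1
  have h1 : ∫ x in a..b, f x * deriv g x = ∫ x in a..b, f x * g' x := by
    refine intervalIntegral.integral_congr_ae ?_
    filter_upwards [hg2] with x hx hxm
    rw [hx hxm]
  have h2 : ∫ x in a..b, deriv f x * g x = ∫ x in a..b, f' x * g x := by
    refine intervalIntegral.integral_congr_ae ?_
    filter_upwards [hf2] with x hx hxm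
    rw [hx hxm]
  rw [← h1, ← h2, h]

lemma primitive_of_hasDerivAt {g g' : ℝ → ℝ} (hg : ∀ x, HasDerivAt g (g' x) x)
    (hg' : Continuous g') (a x : ℝ) : g x = g a + ∫ y in a..x, g' y := by
  rw [intervalIntegral.integral_eq_sub_of_hasDerivAt (fun y _ => hg y)
    (hg'.intervalIntegrable _ _)]
  ring

/-! ### The fundamental lemma with countably many test functions -/

/-- A sequence of bump functions centred at `0`, whose supports shrink to `0`. -/
def bumpSeq (n : ℕ) : ContDiffBump (0 : ℝ) where
  rIn := 1 / (2 * (n + 1))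
  rOut := 1 / (n + 1)
  rIn_pos := by positivity
  rIn_lt_rOut := by
    apply one_div_lt_one_div_of_lt <;> nlinarith [(Nat.cast_nonneg n : (0 : ℝ) ≤ n)]

/-- The standard mollifier `ψ_n`, reflected and centred at `a`, as a function of the integration
variable. -/
def mollifier (n : ℕ) (a x : ℝ) : ℝ := (bumpSeq n).normed volume (a - x)

lemma tendsto_bumpSeq : Tendsto (fun n => (bumpSeq n).rOut) atTop (𝓝 0) :=
  tendsto_one_div_add_atTop_nhds_zero_nat

lemma contDiff_mollifier (n : ℕ) (a : ℝ) : ContDiff ℝ ∞ (mollifier n a) :=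
  (bumpSeq n).contDiff_normed.comp (contDiff_const.sub contDiff_id)

lemma mollifier_eq_zero {n : ℕ} {a x : ℝ} (h : (bumpSeq n).rOut ≤ |x - a|) :
    mollifier n a x = 0 := by
  have : a - x ∉ Function.support ((bumpSeq n).normed volume) := by
    rw [ContDiffBump.support_normed_eq, Metric.mem_ball, dist_zero_right, Real.norm_eq_abs,
      abs_sub_comm]
    exact not_lt.2 h
  rwa [Function.notMem_support] at this

lemma tsupport_mollifier_subset (n : ℕ) (a : ℝ) :
    tsupport (mollifier n a) ⊆ Metric.closedBall a (bumpSeq n).rOut := by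
  refine closure_minimal (fun x hx => ?_) Metric.isClosed_closedBall
  by_contra h
  rw [Metric.mem_closedBall, Real.dist_eq, not_le] at h
  exact hx (mollifier_eq_zero h.le)

lemma hasCompactSupport_mollifier (n : ℕ) (a : ℝ) : HasCompactSupport (mollifier n a) :=
  (isCompact_closedBall a _).of_isClosed_subset (isClosed_tsupport _)
    (tsupport_mollifier_subset n a)

lemma convolution_bumpSeq (n : ℕ) (f : ℝ → ℝ) (a : ℝ) :
    convolution ((bumpSeq n).normed volume) f (ContinuousLinearMap.lsmul ℝ ℝ) volume a =
      ∫ x, f x * mollifier n a x := by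
  rw [convolution_eq_swap]
  simp [mollifier, mul_comm]

open ContinuousLinearMap in
lemma continuous_integral_mul_mollifier {f : ℝ → ℝ} (hf : LocallyIntegrable f volume) (n : ℕ) :
    Continuous fun a => ∫ x, f x * mollifier n a x := by
  simp_rw [← convolution_bumpSeq]
  exact (bumpSeq n).hasCompactSupport_normed.continuous_convolution_left (lsmul ℝ ℝ)
    (bumpSeq n).continuous_normed hf

lemma deriv_mollifier (n : ℕ) (a x : ℝ) :
    deriv (mollifier n a) x = - deriv ((bumpSeq n).normed volume) (a - x) := by
  have h := ((bumpSeq n).contDiff_normed (μ := volume) (n := 1)).differentiable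
    (by norm_num) (a - x)
  have h2 : HasDerivAt (fun x : ℝ => a - x) (-1) x := by
    simpa using (hasDerivAt_id x).const_sub a
  have := h.hasDerivAt.comp x h2
  rw [mul_neg_one] at this
  exact this.deriv

open ContinuousLinearMap in
lemma hasDerivAt_integral_mul_mollifier {f : ℝ → ℝ} (hf : LocallyIntegrable f volume) (n : ℕ)
    (a : ℝ) : HasDerivAt (fun a => ∫ x, f x * mollifier n a x)
      (- ∫ x, f x * deriv (mollifier n a) x) a := by
  have h := (bumpSeq n).hasCompactSupport_normed.hasDerivAt_convolution_left (μ := volume)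
    (lsmul ℝ ℝ) ((bumpSeq n).contDiff_normed (μ := volume) (n := 1)) hf a
  rw [convolution_eq_swap] at h
  have e : (fun a => ∫ x, f x * mollifier n a x) =
      convolution ((bumpSeq n).normed volume) f (lsmul ℝ ℝ) volume := by
    funext a
    rw [convolution_bumpSeq]
  rw [e, ← integral_neg]
  refine h.congr_deriv (integral_congr_ae (.of_forall fun x => ?_))
  simp only [deriv_mollifier, lsmul_apply, smul_eq_mul]
  ring

open ContinuousLinearMap in
lemma continuous_integral_mul_deriv_mollifier {f : ℝ → ℝ} (hf : LocallyIntegrable f volume)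
    (n : ℕ) : Continuous fun a => ∫ x, f x * deriv (mollifier n a) x := by
  have e : (fun a => ∫ x, f x * deriv (mollifier n a) x) =
      fun a => - convolution (deriv ((bumpSeq n).normed volume)) f (lsmul ℝ ℝ) volume a := by
    funext a
    rw [convolution_eq_swap, ← integral_neg]
    refine integral_congr_ae (.of_forall fun x => ?_)
    simp only [deriv_mollifier, lsmul_apply, smul_eq_mul]
    ring
  rw [e]
  have h1 : HasCompactSupport (deriv ((bumpSeq n).normed (volume : Measure ℝ))) :=
    (bumpSeq n).hasCompactSupport_normed.deriv
  have h2 : Continuous (deriv ((bumpSeq n).normed (volume : Measure ℝ))) :=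
    ((bumpSeq n).contDiff_normed (μ := volume) (n := 1)).continuous_deriv le_rfl
  exact (h1.continuous_convolution_left (lsmul ℝ ℝ) h2 hf).neg

/-- A function whose weak derivative vanishes on an interval is constant there; only the countably
many test functions `mollifier n q` with rational `q` are needed. -/
lemma exists_ae_eq_const_of_integral_deriv_mollifier {f : ℝ → ℝ} (hf : LocallyIntegrable f volume)
    {J : Set ℝ} (hJ : IsOpen J) (hJc : J.OrdConnected)
    (h : ∀ n : ℕ, ∀ q : ℚ, Metric.closedBall (q : ℝ) (bumpSeq n).rOut ⊆ J →
      ∫ x, f x * deriv (mollifier n q) x = 0) :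
    ∃ C : ℝ, ∀ᵐ x, x ∈ J → f x = C := by
  have hae := ContDiffBump.ae_convolution_tendsto_right_of_locallyIntegrable
    (φ := bumpSeq) (K := 2) tendsto_bumpSeq (.of_forall fun n => by
      simp only [bumpSeq]; field_simp; norm_num) hf
  have hlim : ∀ a ∈ J, ∀ b ∈ J, a ≤ b → ∀ᶠ n in atTop,
      (∫ x, f x * mollifier n a x) = ∫ x, f x * mollifier n b x := by
    intro a ha b hb hab
    have hK : Icc a b ⊆ J := hJc.out ha hb
    obtain ⟨δ, hδ, hδJ⟩ := isCompact_Icc.exists_cthickening_subset_open hJ hK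
    filter_upwards [tendsto_bumpSeq.eventually (gt_mem_nhds (half_pos hδ))] with n hn
    have hz : ∀ z ∈ Icc a b, ∫ x, f x * deriv (mollifier n z) x = 0 := by
      intro z hz
      have hcl : IsClosed {z : ℝ | ∫ x, f x * deriv (mollifier n z) x = 0} :=
        isClosed_singleton.preimage (continuous_integral_mul_deriv_mollifier hf n)
      refine closure_minimal (s := Metric.ball z (δ / 2) ∩ range ((↑) : ℚ → ℝ)) ?_ hcl ?_
      · rintro _ ⟨hw, q, rfl⟩
        refine h n q fun y hy => hδJ ?_
        refine Metric.mem_cthickening_of_dist_le y z δ _ hz ?_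
        rw [Metric.mem_ball] at hw
        rw [Metric.mem_closedBall] at hy
        linarith [dist_triangle y (q : ℝ) z]
      · exact Rat.denseRange_cast.open_subset_closure_inter Metric.isOpen_ball
          (Metric.mem_ball_self (half_pos hδ))
    refine (constant_of_has_deriv_right_zero (f := fun a => ∫ x, f x * mollifier n a x)
      (continuous_integral_mul_mollifier hf n).continuousOn (fun z hzm => ?_) b
      (right_mem_Icc.2 hab)).symm
    have := hasDerivAt_integral_mul_mollifier hf n z
    rw [hz z ⟨hzm.1, hzm.2.le⟩, neg_zero] at this
    exact this.hasDerivWithinAt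
  by_cases hne : ∃ a ∈ J, Tendsto (fun n => ∫ x, f x * mollifier n a x) atTop (𝓝 (f a))
  · obtain ⟨a, ha, hta⟩ := hne
    refine ⟨f a, ?_⟩
    filter_upwards [hae] with b hb hbJ
    simp_rw [convolution_bumpSeq] at hb
    have he : ∀ᶠ n in atTop, (∫ x, f x * mollifier n a x) = ∫ x, f x * mollifier n b x := by
      rcases le_total a b with hab | hab
      · exact hlim a ha b hbJ hab
      · exact (hlim b hbJ a ha hab).mono fun n hn => hn.symm
    exact tendsto_nhds_unique hb (hta.congr' he)
  · refine ⟨0, ?_⟩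
    filter_upwards [hae] with b hb hbJ
    simp_rw [convolution_bumpSeq] at hb
    exact absurd ⟨b, hbJ, hb⟩ hne

/-- A function `f` with weak derivative `g` on an interval is almost everywhere a primitive of
`g` there; only countably many test functions are needed. -/
lemma exists_ae_eq_primitive_of_integral_deriv_mollifier {f g : ℝ → ℝ}
    (hf : LocallyIntegrable f volume) (hg : LocallyIntegrable g volume)
    {J : Set ℝ} (hJ : IsOpen J) (hJc : J.OrdConnected)
    (h : ∀ n : ℕ, ∀ q : ℚ, Metric.closedBall (q : ℝ) (bumpSeq n).rOut ⊆ J →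
      ∫ x, f x * deriv (mollifier n q) x = - ∫ x, g x * mollifier n q x) (x₀ : ℝ) :
    ∃ C : ℝ, ∀ᵐ x, x ∈ J → f x = C + ∫ y in x₀..x, g y := by
  have hgi : ∀ a b, IntervalIntegrable g volume a b := fun a b =>
    (hg.integrableOn_isCompact isCompact_uIcc).intervalIntegrable
  have hcont : Continuous fun x => ∫ y in x₀..x, g y :=
    intervalIntegral.continuous_primitive hgi x₀
  obtain ⟨C, hC⟩ := exists_ae_eq_const_of_integral_deriv_mollifier
    (f := fun x => f x - ∫ y in x₀..x, g y) (hf.sub hcont.locallyIntegrable) hJ hJc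
    fun n q hq => by
      have hc : Continuous (deriv (mollifier n q)) :=
        (contDiff_mollifier n q).continuous_deriv (by simp)
      have hcs : HasCompactSupport (deriv (mollifier n q)) :=
        (hasCompactSupport_mollifier n q).deriv
      simp_rw [sub_mul]
      rw [integral_sub, h n q hq]
      · set r := (bumpSeq n).rOut + 1
        have hr : 0 < r := by have := (bumpSeq n).rOut_pos; positivity
        have hb : ∀ F : ℝ → ℝ, (∀ x, r - 1 ≤ |x - (q : ℝ)| → F x = 0) →
            ∫ x, F x = ∫ x in (q - r)..(q + r), F x := by
          intro F hF
          rw [intervalIntegral.integral_of_le (by linarith),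
            setIntegral_eq_integral_of_forall_compl_eq_zero]
          intro x hx
          apply hF
          by_contra hlt
          rw [not_le, abs_lt] at hlt
          exact hx ⟨by linarith, by linarith⟩
        have hz : ∀ x, r - 1 ≤ |x - (q : ℝ)| → mollifier n q x = 0 := fun x hx =>
          mollifier_eq_zero (by simpa [r] using hx)
        have hzd : ∀ x, r - 1 ≤ |x - (q : ℝ)| → deriv (mollifier n q) x = 0 := by
          intro x hx
          by_contra hne
          have hmem := tsupport_mollifier_subset n q (support_deriv_subset hne)
          rw [Metric.mem_closedBall, Real.dist_eq] at hmem
          have hmin : IsMinOn (mollifier n q) univ x := fun y _ => by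
            rw [mem_ofPred_eq, hz x hx]
            exact (bumpSeq n).nonneg_normed _
          exact hne (hmin.isLocalMin univ_mem).deriv_eq_zero
        rw [hb (fun x => g x * mollifier n q x) (fun x hx => by rw [hz x hx, mul_zero]),
          hb (fun x => (∫ y in x₀..x, g y) * deriv (mollifier n q) x)
            (fun x hx => by rw [hzd x hx, mul_zero]),
          integral_mul_eq_sub_of_primitive (f' := g) (g := mollifier n q) (hgi _ _)
            (hc.intervalIntegrable _ _)
            (fun x _ => ?_) (fun x _ => ?_), hz ((q : ℝ) + r) (by simp [abs_of_pos hr]),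
          hz ((q : ℝ) - r) (by simp [abs_of_pos hr])]
        · ring
        · rw [intervalIntegral.integral_add_adjacent_intervals (hgi _ _) (hgi _ _)]
        · exact primitive_of_hasDerivAt (fun x =>
            ((contDiff_mollifier n q).differentiable (by simp) x).hasDerivAt) hc _ _
      · simpa [mul_comm] using hf.integrable_smul_right_of_hasCompactSupport hc hcs
      · exact (hcont.mul hc).integrable_of_hasCompactSupport hcs.mul_left
  exact ⟨C, hC.mono fun x hx hxJ => by linarith [hx hxJ]⟩

/-! ### The Cauchy-Schwarz inequality -/

lemma integrable_mul_of_memLp_two {α : Type*} [MeasurableSpace α] {μ : Measure α} {f g : α → ℝ}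
    (hf : MemLp f 2 μ) (hg : MemLp g 2 μ) : Integrable (fun x => f x * g x) μ :=
  hf.integrable_mul hg

lemma sq_integral_mul_le {α : Type*} [MeasurableSpace α] {μ : Measure α} {f g : α → ℝ}
    (hf : MemLp f 2 μ) (hg : MemLp g 2 μ) :
    (∫ x, f x * g x ∂μ) ^ 2 ≤ (∫ x, f x ^ 2 ∂μ) * ∫ x, g x ^ 2 ∂μ := by
  have hfg : Integrable (fun x => f x * g x) μ := hf.integrable_mul hg
  have h : ∀ s : ℝ, 0 ≤ (∫ x, g x ^ 2 ∂μ) * (s * s) + (2 * ∫ x, f x * g x ∂μ) * s +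
      ∫ x, f x ^ 2 ∂μ := by
    intro s
    have h1 : 0 ≤ ∫ x, (g x ^ 2 * (s * s) + 2 * (f x * g x) * s) + f x ^ 2 ∂μ :=
      integral_nonneg fun x => by
        have := sq_nonneg (f x + s * g x)
        simp only [Pi.zero_apply]
        nlinarith
    have i1 : Integrable (fun x => g x ^ 2 * (s * s)) μ := hg.integrable_sq.mul_const _
    have i2 : Integrable (fun x => 2 * (f x * g x) * s) μ := (hfg.const_mul 2).mul_const _
    have i3 : Integrable (fun x => g x ^ 2 * (s * s) + 2 * (f x * g x) * s) μ := i1.add i2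
    rwa [integral_add i3 hf.integrable_sq, integral_add i1 i2, integral_mul_const,
      integral_mul_const, integral_const_mul] at h1
  have := discrim_le_zero h
  rw [discrim] at this
  nlinarith

/-! ### Time slices of functions on the strip -/

lemma restrict_strip (T : ℝ) : (volume : Measure (ℝ × ℝ)).restrict (strip T) =
    (volume : Measure ℝ).prod (volume.restrict (Ioo 0 T)) := by
  rw [strip, Measure.volume_eq_prod, ← Measure.prod_restrict, Measure.restrict_univ]

lemma MemL2Strip.memLp_prod {T : ℝ} {v : ℝ → ℝ → ℝ} (hv : MemL2Strip T v) :
    MemLp (fun p : ℝ × ℝ => v p.1 p.2) 2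
      ((volume : Measure ℝ).prod (volume.restrict (Ioo 0 T))) := by
  rw [← restrict_strip]
  exact hv

lemma MemL2Strip.ae_memLp {T : ℝ} {v : ℝ → ℝ → ℝ} (hv : MemL2Strip T v) :
    ∀ᵐ t ∂(volume.restrict (Ioo 0 T)), MemLp (fun x => v x t) 2 volume := by
  have h := hv.memLp_prod
  filter_upwards [h.integrable_sq.prod_left_ae, h.aestronglyMeasurable.prodMk_right] with t h1 h2
  exact (memLp_two_iff_integrable_sq h2).2 h1

lemma MemL2Strip.integrable_integral_sq {T : ℝ} {v : ℝ → ℝ → ℝ} (hv : MemL2Strip T v) :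
    Integrable (fun t => ∫ x, v x t ^ 2) (volume.restrict (Ioo 0 T)) :=
  hv.memLp_prod.integrable_sq.integral_prod_right

lemma MemL2Strip.integrable_mul {T : ℝ} {v : ℝ → ℝ → ℝ} (hv : MemL2Strip T v) {χ : ℝ → ℝ}
    (hχ : MemLp χ 2 volume) :
    Integrable (fun p : ℝ × ℝ => v p.1 p.2 * χ p.1)
      ((volume : Measure ℝ).prod (volume.restrict (Ioo 0 T))) :=
  hv.memLp_prod.integrable_mul (hχ.comp_fst _)

/-- `w` is the weak `x`-derivative of `v` in the strip, tested with products of test functions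
only. -/
def IsWeakDerivX (T : ℝ) (v w : ℝ → ℝ → ℝ) : Prop :=
  ∀ η ψ : ℝ → ℝ, ContDiff ℝ ∞ η → HasCompactSupport η → ContDiff ℝ ∞ ψ → HasCompactSupport ψ →
    tsupport ψ ⊆ Ioo 0 T →
    ∫ p in strip T, v p.1 p.2 * (deriv η p.1 * ψ p.2) =
      - ∫ p in strip T, w p.1 p.2 * (η p.1 * ψ p.2)

/-- On a product of functions of one variable the partial derivatives factor. -/
lemma partialDeriv_mul (a b : ℕ) (η ψ : ℝ → ℝ) (p : ℝ × ℝ) :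
    partialDeriv a b (fun p => η p.1 * ψ p.2) p =
      iteratedDeriv a η p.1 * iteratedDeriv b ψ p.2 := by
  simp only [partialDeriv, iteratedDeriv_const_mul_field]
  simp_rw [mul_comm (η _), iteratedDeriv_const_mul_field]
  rw [mul_comm]

lemma tsupport_mul_subset_strip {T : ℝ} {η ψ : ℝ → ℝ} (hψ : tsupport ψ ⊆ Ioo 0 T) :
    tsupport (fun p : ℝ × ℝ => η p.1 * ψ p.2) ⊆ strip T := by
  have : tsupport (fun p : ℝ × ℝ => η p.1 * ψ p.2) ⊆ univ ×ˢ tsupport ψ := by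
    refine closure_minimal (fun p hp => ⟨mem_univ _, subset_tsupport _ ?_⟩)
      (isClosed_univ.prod (isClosed_tsupport _))
    exact right_ne_zero_of_mul hp
  exact this.trans (prod_mono le_rfl hψ)

lemma hasCompactSupport_mul_prod {η ψ : ℝ → ℝ} (hη : HasCompactSupport η)
    (hψ : HasCompactSupport ψ) : HasCompactSupport (fun p : ℝ × ℝ => η p.1 * ψ p.2) := by
  refine HasCompactSupport.intro (hη.prod hψ) fun p hp => ?_
  by_contra h
  exact hp ⟨subset_tsupport _ (left_ne_zero_of_mul h), subset_tsupport _ (right_ne_zero_of_mul h)⟩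

lemma HasWeakDerivL2.integral_mul_prod {T : ℝ} {a b : ℕ} {u v : ℝ → ℝ → ℝ}
    (h : HasWeakDerivL2 T a b u v) {η ψ : ℝ → ℝ} (hη : ContDiff ℝ ∞ η) (hηc : HasCompactSupport η)
    (hψ : ContDiff ℝ ∞ ψ) (hψc : HasCompactSupport ψ) (hψT : tsupport ψ ⊆ Ioo 0 T) :
    ∫ p in strip T, u p.1 p.2 * (iteratedDeriv a η p.1 * iteratedDeriv b ψ p.2) =
      (-1) ^ (a + b) * ∫ p in strip T, v p.1 p.2 * (η p.1 * ψ p.2) := by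
  have := h.2 (fun p => η p.1 * ψ p.2) ((hη.comp contDiff_fst).mul (hψ.comp contDiff_snd))
    (hasCompactSupport_mul_prod hηc hψc) (tsupport_mul_subset_strip hψT)
  simpa only [partialDeriv_mul] using this

/-- If `v` and `w` are the weak derivatives `∂ₓ^a ∂ₜ^b u` and `∂ₓ^{a+1} ∂ₜ^b u`, then `w` is the
weak `x`-derivative of `v`. -/
lemma HasWeakDerivL2.isWeakDerivX {T : ℝ} {a b : ℕ} {u v w : ℝ → ℝ → ℝ}
    (hv : HasWeakDerivL2 T a b u v) (hw : HasWeakDerivL2 T (a + 1) b u w) :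
    IsWeakDerivX T v w := by
  intro η ψ hη hηc hψ hψc hψT
  have h1 := hv.integral_mul_prod (contDiff_infty_iff_deriv.1 hη).2 hηc.deriv hψ hψc hψT
  have h2 := hw.integral_mul_prod hη hηc hψ hψc hψT
  rw [← iteratedDeriv_succ', h2] at h1
  have h3 : ((-1 : ℝ) ^ (a + b)) * (-1) ^ (a + b) = 1 := by rw [← mul_pow]; simp
  calc _ = ((-1 : ℝ) ^ (a + b) * (-1) ^ (a + b)) *
        ∫ p in strip T, v p.1 p.2 * (deriv η p.1 * ψ p.2) := by rw [h3, one_mul]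
    _ = (-1 : ℝ) ^ (a + b) * ((-1) ^ (a + 1 + b) *
        ∫ p in strip T, w p.1 p.2 * (η p.1 * ψ p.2)) := by rw [mul_assoc, ← h1]
    _ = - (((-1 : ℝ) ^ (a + b) * (-1) ^ (a + b)) *
        ∫ p in strip T, w p.1 p.2 * (η p.1 * ψ p.2)) := by ring
    _ = _ := by rw [h3, one_mul]

/-- The weak derivative on almost every time slice. The exceptional set of times depends on the test
function, which is why only countably many test functions can be used on a slice. -/
lemma IsWeakDerivX.ae_integral_eq {T : ℝ} {v w : ℝ → ℝ → ℝ} (hv : MemL2Strip T v)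
    (hw : MemL2Strip T w) (h : IsWeakDerivX T v w) {η : ℝ → ℝ} (hη : ContDiff ℝ ∞ η)
    (hηc : HasCompactSupport η) :
    ∀ᵐ t ∂(volume.restrict (Ioo 0 T)),
      ∫ x, v x t * deriv η x = - ∫ x, w x t * η x := by
  have hη0 : MemLp η 2 volume := hη.continuous.memLp_of_hasCompactSupport hηc
  have hη1 : MemLp (deriv η) 2 volume :=
    (hη.continuous_deriv (by simp)).memLp_of_hasCompactSupport hηc.deriv
  have hi1 := (hv.integrable_mul hη1)
  have hi2 := (hw.integrable_mul hη0)
  have hF : Integrable (fun t => (∫ x, v x t * deriv η x) + ∫ x, w x t * η x)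
      (volume.restrict (Ioo 0 T)) := hi1.integral_prod_right.add hi2.integral_prod_right
  have := isOpen_Ioo.ae_eq_zero_of_integral_contDiff_smul_eq_zero (μ := volume) (U := Ioo 0 T)
    (f := fun t => (∫ x, v x t * deriv η x) + ∫ x, w x t * η x)
    (IntegrableOn.locallyIntegrableOn hF) (fun ψ hψ hψc hψT => by
      obtain ⟨B, hB⟩ := hψc.exists_bound_of_continuous hψ.continuous
      have hψb : ∀ {F : ℝ × ℝ → ℝ}, Integrable F
          ((volume : Measure ℝ).prod (volume.restrict (Ioo 0 T))) →
          Integrable (fun p => ψ p.2 * F p)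
            ((volume : Measure ℝ).prod (volume.restrict (Ioo 0 T))) := fun hF =>
        hF.bdd_mul (hψ.continuous.comp continuous_snd).aestronglyMeasurable
          (.of_forall fun p => hB p.2)
      have e := h η ψ hη hηc hψ hψc hψT
      rw [restrict_strip] at e
      have e1 : ∀ {f : ℝ → ℝ → ℝ} {χ : ℝ → ℝ}, Integrable (fun p : ℝ × ℝ => f p.1 p.2 * χ p.1)
          ((volume : Measure ℝ).prod (volume.restrict (Ioo 0 T))) →
          ∫ p, f p.1 p.2 * (χ p.1 * ψ p.2)
            ∂((volume : Measure ℝ).prod (volume.restrict (Ioo 0 T))) =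
          ∫ t in Ioo 0 T, ψ t * ∫ x, f x t * χ x := by
        intro f χ hf
        have : ∀ p : ℝ × ℝ, f p.1 p.2 * (χ p.1 * ψ p.2) = ψ p.2 * (f p.1 p.2 * χ p.1) :=
          fun p => by ring
        simp_rw [this]
        rw [integral_prod_symm _ (hψb hf)]
        simp_rw [integral_const_mul]
      rw [e1 hi1, e1 hi2] at e
      have hψi : ∀ {F : ℝ → ℝ}, Integrable F (volume.restrict (Ioo 0 T)) →
          Integrable (fun t => ψ t * F t) (volume.restrict (Ioo 0 T)) := fun hF =>
        hF.bdd_mul hψ.continuous.aestronglyMeasurable (.of_forall hB)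
      have e2 : ∫ t, ψ t • ((∫ x, v x t * deriv η x) + ∫ x, w x t * η x) =
          ∫ t in Ioo 0 T, ψ t • ((∫ x, v x t * deriv η x) + ∫ x, w x t * η x) := by
        rw [setIntegral_eq_integral_of_forall_compl_eq_zero]
        intro t ht
        rw [image_eq_zero_of_notMem_tsupport (fun h' => ht (hψT h')), zero_smul]
      rw [e2]
      simp_rw [smul_eq_mul, mul_add]
      rw [integral_add (hψi hi1.integral_prod_right) (hψi hi2.integral_prod_right), e]
      ring)
  rw [ae_restrict_iff' measurableSet_Ioo]
  filter_upwards [this] with t ht htm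
  linarith [ht htm]

/-- `W 0, W 1, …, W n` are square integrable, and each `W j` with `j < n` is a primitive of
`W (j + 1)`: thus `W 0` belongs to `H^n(ℝ)` and `W j` is the continuous representative of its
`j`-th derivative. -/
structure IsDerivChain (n : ℕ) (W : ℕ → ℝ → ℝ) : Prop where
  memLp : ∀ j ≤ n, MemLp (W j) 2 volume
  sub_eq : ∀ j < n, ∀ x y, W j y - W j x = ∫ s in x..y, W (j + 1) s

lemma locallyIntegrable_of_memLp_two {f : ℝ → ℝ} (hf : MemLp f 2 volume) :
    LocallyIntegrable f volume := hf.locallyIntegrable (by norm_num)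

lemma intervalIntegrable_of_memLp_two {f : ℝ → ℝ} (hf : MemLp f 2 volume) (a b : ℝ) :
    IntervalIntegrable f volume a b :=
  ((locallyIntegrable_of_memLp_two hf).integrableOn_isCompact isCompact_uIcc).intervalIntegrable

/-- For almost every time, the weak `x`-derivatives of a function on the strip are the derivatives
of its time slice. -/
lemma ae_exists_isDerivChain {T : ℝ} (n : ℕ) (v : ℕ → ℝ → ℝ → ℝ)
    (hv : ∀ j ≤ n, MemL2Strip T (v j)) (hd : ∀ j < n, IsWeakDerivX T (v j) (v (j + 1))) :
    ∀ᵐ t ∂(volume.restrict (Ioo 0 T)), ∃ W : ℕ → ℝ → ℝ, IsDerivChain n W ∧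
      ∀ j ≤ n, W j =ᵐ[volume] fun x => v j x t := by
  have h1 : ∀ᵐ t ∂(volume.restrict (Ioo 0 T)), ∀ j, j ≤ n → MemLp (fun x => v j x t) 2 volume := by
    rw [ae_all_iff]
    intro j
    by_cases hj : j ≤ n
    · filter_upwards [(hv j hj).ae_memLp] with t ht _ using ht
    · exact .of_forall fun t h => absurd h hj
  have h2 : ∀ᵐ t ∂(volume.restrict (Ioo 0 T)), ∀ j, ∀ m : ℕ, ∀ q : ℚ, j < n →
      ∫ x, v j x t * deriv (mollifier m q) x = - ∫ x, v (j + 1) x t * mollifier m q x := by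
    rw [ae_all_iff]
    intro j
    rw [ae_all_iff]
    intro m
    rw [ae_all_iff]
    intro q
    by_cases hj : j < n
    · filter_upwards [(hd j hj).ae_integral_eq (hv j hj.le) (hv (j + 1) hj)
        (contDiff_mollifier m q) (hasCompactSupport_mollifier m q)] with t ht _ using ht
    · exact .of_forall fun t h => absurd h hj
  filter_upwards [h1, h2] with t h1 h2
  have h3 : ∀ j, ∃ C : ℝ, j < n → ∀ᵐ x, v j x t = C + ∫ y in (0 : ℝ)..x, v (j + 1) y t := by
    intro j
    by_cases hj : j < n
    · obtain ⟨C, hC⟩ := exists_ae_eq_primitive_of_integral_deriv_mollifier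
        (locallyIntegrable_of_memLp_two (h1 j hj.le))
        (locallyIntegrable_of_memLp_two (h1 (j + 1) hj)) isOpen_univ ordConnected_univ
        (fun m q _ => h2 j m q hj) 0
      exact ⟨C, fun _ => hC.mono fun x hx => hx (mem_univ x)⟩
    · exact ⟨0, fun h => absurd h hj⟩
  choose C hC using h3
  set W : ℕ → ℝ → ℝ := fun j x => if j < n then C j + ∫ y in (0 : ℝ)..x, v (j + 1) y t else v j x t
    with hW
  have hWv : ∀ j ≤ n, W j =ᵐ[volume] fun x => v j x t := by
    intro j hj
    by_cases hjn : j < n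
    · filter_upwards [hC j hjn] with x hx
      simp only [hW, hjn, if_true, hx]
    · simp only [hW, hjn, if_false]
      exact EventuallyEq.rfl
  refine ⟨W, ⟨fun j hj => (memLp_congr_ae (hWv j hj)).2 (h1 j hj), fun j hj x y => ?_⟩, hWv⟩
  have hi : ∀ a b, IntervalIntegrable (fun x => v (j + 1) x t) volume a b :=
    intervalIntegrable_of_memLp_two (h1 (j + 1) hj)
  rw [intervalIntegral.integral_congr_ae (g := fun x => v (j + 1) x t)
    ((hWv (j + 1) hj).mono fun x hx _ => hx)]
  simp only [hW, hj, if_true]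
  rw [add_sub_add_left_eq_sub, intervalIntegral.integral_interval_sub_left (hi _ _) (hi _ _)]

/-! ### The time derivative -/

lemma toReal_eLpNorm_two_sq {α : Type*} [MeasurableSpace α] {μ : Measure α} {f : α → ℝ}
    (hf : MemLp f 2 μ) : (eLpNorm f 2 μ).toReal ^ 2 = ∫ x, f x ^ 2 ∂μ := by
  rw [hf.eLpNorm_eq_integral_rpow_norm two_ne_zero ENNReal.ofNat_ne_top, ENNReal.toReal_ofReal
    (by positivity), ← Real.rpow_natCast, ← Real.rpow_mul (by positivity)]
  simp

lemma abs_integral_mul_le {α : Type*} [MeasurableSpace α] {μ : Measure α} {f g : α → ℝ}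
    (hf : MemLp f 2 μ) (hg : MemLp g 2 μ) :
    |∫ x, f x * g x ∂μ| ≤ (eLpNorm f 2 μ).toReal * (eLpNorm g 2 μ).toReal := by
  have hcs := sq_integral_mul_le hf hg
  rw [← toReal_eLpNorm_two_sq hf, ← toReal_eLpNorm_two_sq hg, ← mul_pow] at hcs
  exact abs_le_of_sq_le_sq hcs (by positivity)

lemma IsContinuousL2.continuousOn_integral_mul {T : ℝ} {u : ℝ → ℝ → ℝ} (hu : IsContinuousL2 T u)
    {χ : ℝ → ℝ} (hχ : MemLp χ 2 volume) :
    ContinuousOn (fun t => ∫ x, u x t * χ x) (Icc 0 T) := by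
  intro t ht
  rw [ContinuousWithinAt, tendsto_iff_norm_sub_tendsto_zero]
  have h1 : Tendsto (fun s => (eLpNorm (fun x => u x s - u x t) 2 volume).toReal *
      (eLpNorm χ 2 volume).toReal) (𝓝[Icc 0 T] t) (𝓝 0) := by
    have := ((ENNReal.tendsto_toReal ENNReal.zero_ne_top).comp (hu t ht).2).mul_const
      (eLpNorm χ 2 volume).toReal
    simpa using this
  refine squeeze_zero' (.of_forall fun s => norm_nonneg _) ?_ h1
  filter_upwards [self_mem_nhdsWithin] with s hs
  have hd : MemLp (fun x => u x s - u x t) 2 volume := (hu s hs).1.sub (hu t ht).1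
  have hi : ∀ r ∈ Icc 0 T, Integrable (fun x => u x r * χ x) volume := fun r hr =>
    (hu r hr).1.integrable_mul hχ
  rw [← integral_sub (hi s hs) (hi t ht)]
  simp_rw [← sub_mul]
  exact abs_integral_mul_le hd hχ

lemma continuousOn_setIntegral_Ioo {T : ℝ} {g : ℝ → ℝ} (hg : IntegrableOn g (Ioo 0 T) volume)
    (hT : 0 < T) : ContinuousOn (fun t => ∫ s in (0 : ℝ)..t, g s) (Icc 0 T) := by
  have := intervalIntegral.continuousOn_primitive_interval (μ := volume) (a := 0) (b := T) (f := g)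
    (by rw [uIcc_of_le hT.le, integrableOn_Icc_iff_integrableOn_Ioo]; exact hg)
  rwa [uIcc_of_le hT.le] at this

/-- Tested with a fixed smooth function of `x`, the weak time derivative is the derivative of an
absolutely continuous function on the closed time interval. -/
lemma IsContinuousL2.integral_mul_sub_of_contDiff {T : ℝ} (hT : 0 < T) {u ut : ℝ → ℝ → ℝ}
    (hu : IsContinuousL2 T u) (hus : MemL2Strip T u) (hut : HasWeakDerivL2 T 0 1 u ut) {η : ℝ → ℝ}
    (hη : ContDiff ℝ ∞ η) (hηc : HasCompactSupport η) {a b : ℝ} (ha : a ∈ Icc 0 T)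
    (hb : b ∈ Icc 0 T) :
    (∫ x, u x b * η x) - ∫ x, u x a * η x = ∫ t in a..b, ∫ x, ut x t * η x := by
  have hη0 : MemLp η 2 volume := hη.continuous.memLp_of_hasCompactSupport hηc
  have hi1 := hus.integrable_mul hη0
  have hi2 := hut.1.integrable_mul hη0
  set m : ℝ → ℝ := fun t => ∫ x, u x t * η x with hm
  set g : ℝ → ℝ := fun t => ∫ x, ut x t * η x with hg
  have hmi : IntegrableOn m (Ioo 0 T) volume := hi1.integral_prod_right
  have hgi : IntegrableOn g (Ioo 0 T) volume := hi2.integral_prod_right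
  obtain ⟨C, hC⟩ := exists_ae_eq_primitive_of_integral_deriv_mollifier
    (f := (Ioo 0 T).indicator m) (g := (Ioo 0 T).indicator g) (J := Ioo 0 T)
    (hmi.integrable_indicator measurableSet_Ioo).locallyIntegrable
    (hgi.integrable_indicator measurableSet_Ioo).locallyIntegrable isOpen_Ioo ordConnected_Ioo
    (fun n q hq => by
      have hψT : tsupport (mollifier n q) ⊆ Ioo 0 T := (tsupport_mollifier_subset n q).trans hq
      have e := hut.integral_mul_prod hη hηc (contDiff_mollifier n q)
        (hasCompactSupport_mollifier n q) hψT
      rw [restrict_strip] at e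
      simp only [iteratedDeriv_zero, iteratedDeriv_one, zero_add, pow_one] at e
      have e1 : ∀ {f : ℝ → ℝ → ℝ} {χ : ℝ → ℝ}, Continuous χ → HasCompactSupport χ →
          Integrable (fun p : ℝ × ℝ => f p.1 p.2 * η p.1)
          ((volume : Measure ℝ).prod (volume.restrict (Ioo 0 T))) →
          ∫ p, f p.1 p.2 * (η p.1 * χ p.2)
            ∂((volume : Measure ℝ).prod (volume.restrict (Ioo 0 T))) =
          ∫ t in Ioo 0 T, (∫ x, f x t * η x) * χ t := by
        intro f χ hχ hχc hf
        obtain ⟨B, hB⟩ := hχc.exists_bound_of_continuous hχ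
        have : ∀ p : ℝ × ℝ, f p.1 p.2 * (η p.1 * χ p.2) = χ p.2 * (f p.1 p.2 * η p.1) :=
          fun p => by ring
        simp_rw [this]
        rw [integral_prod_symm _ (hf.bdd_mul (f := fun p : ℝ × ℝ => χ p.2)
          (hχ.comp continuous_snd).aestronglyMeasurable (.of_forall fun p => hB p.2))]
        simp_rw [integral_const_mul, mul_comm]
      rw [e1 ((contDiff_mollifier n q).continuous_deriv (by simp))
        (hasCompactSupport_mollifier n q).deriv hi1, e1 (contDiff_mollifier n q).continuous
        (hasCompactSupport_mollifier n q) hi2] at e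
      have e2 : ∀ F χ : ℝ → ℝ, ∫ t, (Ioo 0 T).indicator F t * χ t = ∫ t in Ioo 0 T, F t * χ t := by
        intro F χ
        simp_rw [← indicator_mul_left]
        rw [integral_indicator measurableSet_Ioo]
      rw [e2, e2, e]
      ring) 0
  -- Both sides are continuous on the closed interval, so that the equality holds everywhere there.
  have hall : ∀ t ∈ Icc 0 T, m t = C + ∫ s in (0 : ℝ)..t, g s := by
    have hc1 : ContinuousOn (fun t => m t - (C + ∫ s in (0 : ℝ)..t, g s)) (Icc 0 T) :=
      (hu.continuousOn_integral_mul hη0).sub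
        (continuousOn_const.add (continuousOn_setIntegral_Ioo hgi hT))
    have hae : ∀ᵐ t ∂(volume.restrict (Icc 0 T)), m t - (C + ∫ s in (0 : ℝ)..t, g s) = 0 := by
      rw [← restrict_Ioo_eq_restrict_Icc, ae_restrict_iff' measurableSet_Ioo]
      filter_upwards [hC] with t ht htm
      have h1 := ht htm
      rw [indicator_of_mem htm] at h1
      have h2 : ∫ s in (0 : ℝ)..t, (Ioo 0 T).indicator g s = ∫ s in (0 : ℝ)..t, g s := by
        refine intervalIntegral.integral_congr_ae (.of_forall fun s hs => ?_)
        rw [uIoc_of_le htm.1.le] at hs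
        exact indicator_of_mem (show s ∈ Ioo 0 T from ⟨hs.1, hs.2.trans_lt htm.2⟩) g
      rw [h1, h2, sub_self]
    have := Measure.eqOn_Icc_of_ae_eq volume hT.ne hae hc1 continuousOn_const
    intro t ht
    linarith [this ht]
  have hgI : ∀ c ∈ Icc 0 T, IntervalIntegrable g volume 0 c := fun c hc => by
    rw [intervalIntegrable_iff_integrableOn_Ioo_of_le hc.1]
    exact hgi.mono_set (Ioo_subset_Ioo_right hc.2)
  change m b - m a = _
  rw [hall a ha, hall b hb, add_sub_add_left_eq_sub,
    intervalIntegral.integral_interval_sub_left (hgI b hb) (hgI a ha)]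

lemma MemL2Strip.intervalIntegrable_integral_mul {T : ℝ} {v : ℝ → ℝ → ℝ} (hv : MemL2Strip T v)
    {χ : ℝ → ℝ} (hχ : MemLp χ 2 volume) {a b : ℝ} (ha : a ∈ Icc 0 T) (hb : b ∈ Icc 0 T) :
    IntervalIntegrable (fun t => ∫ x, v x t * χ x) volume a b := by
  have h : IntegrableOn (fun t => ∫ x, v x t * χ x) (Ioo 0 T) volume :=
    (hv.integrable_mul hχ).integral_prod_right
  have h0 : ∀ c ∈ Icc 0 T, IntervalIntegrable (fun t => ∫ x, v x t * χ x) volume 0 c := by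
    intro c hc
    rw [intervalIntegrable_iff_integrableOn_Ioo_of_le hc.1]
    exact h.mono_set (Ioo_subset_Ioo_right hc.2)
  exact (h0 a ha).symm.trans (h0 b hb)

lemma MemL2Strip.abs_integral_integral_mul_le {T : ℝ} {v : ℝ → ℝ → ℝ} (hv : MemL2Strip T v)
    {χ : ℝ → ℝ} (hχ : MemLp χ 2 volume) {a b : ℝ} (ha : a ∈ Icc 0 T) (hb : b ∈ Icc 0 T)
    (hab : a ≤ b) :
    |∫ t in a..b, ∫ x, v x t * χ x| ≤
      (∫ t in Ioo 0 T, (1 + ∫ x, v x t ^ 2)) * (eLpNorm χ 2 volume).toReal := by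
  have hG : IntegrableOn (fun t => 1 + ∫ x, v x t ^ 2) (Ioo 0 T) volume :=
    (integrable_const 1).add hv.integrable_integral_sq
  have hF : IntegrableOn (fun t => ∫ x, v x t * χ x) (Ioo 0 T) volume :=
    (hv.integrable_mul hχ).integral_prod_right
  have h1 : |∫ t in a..b, ∫ x, v x t * χ x| ≤ ∫ t in Ioo 0 T, |∫ x, v x t * χ x| := by
    rw [intervalIntegral.integral_of_le hab, integral_Ioc_eq_integral_Ioo]
    refine (abs_integral_le_integral_abs).trans ?_
    exact setIntegral_mono_set hF.abs (.of_forall fun t => abs_nonneg _)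
      (Ioo_subset_Ioo ha.1 hb.2).eventuallyLE
  refine h1.trans ?_
  rw [← integral_mul_const]
  refine integral_mono_ae hF.abs (hG.mul_const _) ?_
  filter_upwards [hv.ae_memLp] with t ht
  refine (abs_integral_mul_le ht hχ).trans ?_
  gcongr
  rw [← toReal_eLpNorm_two_sq ht]
  nlinarith [sq_nonneg ((eLpNorm (fun x => v x t) 2 volume).toReal - 1)]

/-- The weak time derivative, tested with a square integrable function of `x`. -/
lemma IsContinuousL2.integral_mul_sub {T : ℝ} (hT : 0 < T) {u ut : ℝ → ℝ → ℝ}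
    (hu : IsContinuousL2 T u) (hus : MemL2Strip T u) (hut : HasWeakDerivL2 T 0 1 u ut) {χ : ℝ → ℝ}
    (hχ : MemLp χ 2 volume) {a b : ℝ} (ha : a ∈ Icc 0 T) (hb : b ∈ Icc 0 T) (hab : a ≤ b) :
    (∫ x, u x b * χ x) - ∫ x, u x a * χ x = ∫ t in a..b, ∫ x, ut x t * χ x := by
  -- The difference of the two sides is linear and bounded in `χ`, and vanishes on a dense set.
  set D : (ℝ → ℝ) → ℝ := fun χ =>
    (∫ x, u x b * χ x) - (∫ x, u x a * χ x) - ∫ t in a..b, ∫ x, ut x t * χ x with hD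
  set K : ℝ := (eLpNorm (fun x => u x b) 2 volume).toReal +
    (eLpNorm (fun x => u x a) 2 volume).toReal + ∫ t in Ioo 0 T, (1 + ∫ x, ut x t ^ 2) with hK
  have hK0 : 0 ≤ K := by
    have : 0 ≤ ∫ t in Ioo 0 T, (1 + ∫ x, ut x t ^ 2) :=
      integral_nonneg fun t => add_nonneg zero_le_one (integral_nonneg fun x => sq_nonneg _)
    positivity
  have hbound : ∀ {ξ : ℝ → ℝ}, MemLp ξ 2 volume → |D ξ| ≤ K * (eLpNorm ξ 2 volume).toReal := by
    intro ξ hξ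
    have h1 := abs_integral_mul_le (hu b hb).1 hξ
    have h2 := abs_integral_mul_le (hu a ha).1 hξ
    have h3 := hut.1.abs_integral_integral_mul_le hξ ha hb hab
    calc |D ξ| ≤ |∫ x, u x b * ξ x| + |∫ x, u x a * ξ x| + |∫ t in a..b, ∫ x, ut x t * ξ x| :=
          (abs_sub _ _).trans (add_le_add_left (abs_sub _ _) _)
      _ ≤ _ := by rw [hK]; linarith
  suffices h : D χ = 0 by linarith [h]
  refine abs_eq_zero.1 (le_antisymm (le_of_forall_pos_le_add fun ε hε => ?_) (abs_nonneg _))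
  obtain ⟨η, hηc, hη, hηχ⟩ := hχ.exist_eLpNorm_sub_le (by norm_num) (by norm_num)
    (show (0 : ℝ) < ε / (K + 1) by positivity)
  have hη0 : MemLp η 2 volume := hη.continuous.memLp_of_hasCompactSupport hηc
  have hDη : D η = 0 := by
    simp only [hD, hu.integral_mul_sub_of_contDiff hT hus hut hη hηc ha hb, sub_self]
  have hlin : D χ = D (χ - η) := by
    have hsub : ∀ {f : ℝ → ℝ}, MemLp f 2 volume →
        ∫ x, f x * (χ - η) x = (∫ x, f x * χ x) - ∫ x, f x * η x := by
      intro f hf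
      rw [← integral_sub (integrable_mul_of_memLp_two hf hχ) (integrable_mul_of_memLp_two hf hη0)]
      simp only [Pi.sub_apply, mul_sub]
    have hti : ∫ t in a..b, ∫ x, ut x t * (χ - η) x =
        (∫ t in a..b, ∫ x, ut x t * χ x) - ∫ t in a..b, ∫ x, ut x t * η x := by
      rw [← intervalIntegral.integral_sub (hut.1.intervalIntegrable_integral_mul hχ ha hb)
        (hut.1.intervalIntegrable_integral_mul hη0 ha hb)]
      refine intervalIntegral.integral_congr_ae ?_
      have h1 := hut.1.ae_memLp
      rw [ae_restrict_iff' measurableSet_Ioo] at h1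
      have hne : ∀ᵐ t : ℝ, t ≠ b := by simp [ae_iff, measure_singleton]
      filter_upwards [h1, hne] with t ht htb htm
      rw [uIoc_of_le hab] at htm
      exact hsub (ht ⟨ha.1.trans_lt htm.1, (lt_of_le_of_ne htm.2 htb).trans_le hb.2⟩)
    have : D χ = D (χ - η) + D η := by
      simp only [hD, hsub (hu b hb).1, hsub (hu a ha).1, hti]
      ring
    rw [this, hDη, add_zero]
  rw [hlin, zero_add]
  refine (hbound (hχ.sub hη0)).trans ?_
  have h5 : (eLpNorm (χ - η) 2 volume).toReal ≤ ε / (K + 1) :=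
    ENNReal.toReal_le_of_le_ofReal (by positivity) hηχ
  calc K * (eLpNorm (χ - η) 2 volume).toReal ≤ (K + 1) * (ε / (K + 1)) := by gcongr; linarith
    _ = ε := by field_simp

/-! ### The Fourier transform on `L²` -/

lemma memLp_ofReal {v : ℝ → ℝ} (hv : MemLp v 2 volume) :
    MemLp (fun x => (v x : ℂ)) 2 (volume : Measure ℝ) := hv.ofReal

/-- A real function in `L²`, as an element of the complex space `L²`. -/
def toL2 {v : ℝ → ℝ} (hv : MemLp v 2 volume) : Lp ℂ 2 (volume : Measure ℝ) :=
  (memLp_ofReal hv).toLp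

lemma l2Fourier_eq {v : ℝ → ℝ} (hv : MemLp v 2 volume) :
    l2Fourier v = ((𝓕 (toL2 hv) : Lp ℂ 2 (volume : Measure ℝ)) : ℝ → ℂ) := by
  rw [l2Fourier, dif_pos (memLp_ofReal hv)]
  rfl

lemma memLp_l2Fourier {v : ℝ → ℝ} (hv : MemLp v 2 volume) : MemLp (l2Fourier v) 2 volume := by
  rw [l2Fourier_eq hv]
  exact Lp.memLp _

lemma l2Fourier_congr {v w : ℝ → ℝ} (hv : MemLp v 2 volume) (h : v =ᵐ[volume] w) :
    l2Fourier v = l2Fourier w := by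
  have hw : MemLp w 2 volume := (memLp_congr_ae h).1 hv
  rw [l2Fourier_eq hv, l2Fourier_eq hw]
  have : toL2 hv = toL2 hw := by
    rw [toL2, toL2, MemLp.toLp_eq_toLp_iff]
    filter_upwards [h] with x hx
    rw [hx]
  rw [this]

lemma l2Fourier_add {v w : ℝ → ℝ} (hv : MemLp v 2 volume) (hw : MemLp w 2 volume) :
    l2Fourier (fun x => v x + w x) =ᵐ[volume] fun ξ => l2Fourier v ξ + l2Fourier w ξ := by
  have h : MemLp (fun x => v x + w x) 2 volume := hv.add hw
  have e : toL2 h = toL2 hv + toL2 hw := by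
    rw [toL2, toL2, toL2, ← MemLp.toLp_add, MemLp.toLp_eq_toLp_iff]
    exact .of_forall fun x => by simp
  rw [l2Fourier_eq h, l2Fourier_eq hv, l2Fourier_eq hw, e, FourierTransform.fourier_add]
  exact Lp.coeFn_add _ _

lemma l2Fourier_const_mul {v : ℝ → ℝ} (hv : MemLp v 2 volume) (c : ℝ) :
    l2Fourier (fun x => c * v x) =ᵐ[volume] fun ξ => (c : ℂ) * l2Fourier v ξ := by
  have h : MemLp (fun x => c * v x) 2 volume := hv.const_mul c
  have e : toL2 h = (c : ℂ) • toL2 hv := by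
    rw [toL2, toL2, ← MemLp.toLp_const_smul, MemLp.toLp_eq_toLp_iff]
    exact .of_forall fun x => by simp
  rw [l2Fourier_eq h, l2Fourier_eq hv, e, FourierTransform.fourier_smul]
  exact Lp.coeFn_smul _ _

lemma l2Fourier_sub {v w : ℝ → ℝ} (hv : MemLp v 2 volume) (hw : MemLp w 2 volume) :
    l2Fourier (fun x => v x - w x) =ᵐ[volume] fun ξ => l2Fourier v ξ - l2Fourier w ξ := by
  have h := l2Fourier_add hv (hw.const_mul (-1))
  have e : (fun x => v x + -1 * w x) = fun x => v x - w x := by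
    funext x
    ring
  rw [e] at h
  filter_upwards [h, l2Fourier_const_mul hw (-1)] with ξ h1 h2
  rw [h1, h2]
  push_cast
  ring

/-- Plancherel's formula for real functions. -/
lemma integral_l2Fourier_mul_conj_re {v w : ℝ → ℝ} (hv : MemLp v 2 volume)
    (hw : MemLp w 2 volume) :
    ∫ ξ, (l2Fourier v ξ * (starRingEnd ℂ) (l2Fourier w ξ)).re = ∫ x, v x * w x := by
  have h := Lp.inner_fourier_eq (toL2 hw) (toL2 hv)
  have hi : ∀ f g : Lp ℂ 2 (volume : Measure ℝ), (inner ℂ f g).re =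
      ∫ x, (g x * (starRingEnd ℂ) (f x)).re := by
    intro f g
    rw [L2.inner_def]
    exact (integral_re (L2.integrable_inner (𝕜 := ℂ) f g)).symm
  have h2 := congrArg Complex.re h
  rw [hi, hi] at h2
  rw [l2Fourier_eq hv, l2Fourier_eq hw, h2]
  refine integral_congr_ae ?_
  filter_upwards [(memLp_ofReal hv).coeFn_toLp, (memLp_ofReal hw).coeFn_toLp] with x h3 h4
  rw [toL2, toL2, h3, h4]
  simp

lemma lintegral_enorm_l2Fourier_sq {v : ℝ → ℝ} (hv : MemLp v 2 volume) :
    ∫⁻ ξ, ‖l2Fourier v ξ‖ₑ ^ 2 = ∫⁻ x, ‖v x‖ₑ ^ 2 := by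
  have h : ∀ {E : Type} [NormedAddCommGroup E] (f : ℝ → E), ∫⁻ x, ‖f x‖ₑ ^ 2 =
      eLpNorm f 2 volume ^ 2 := by
    intro E _ f
    rw [eLpNorm_eq_lintegral_rpow_enorm_toReal two_ne_zero ENNReal.ofNat_ne_top,
      ← ENNReal.rpow_natCast, ← ENNReal.rpow_mul]
    simp
  rw [h, h, l2Fourier_eq hv]
  have h1 : ‖(𝓕 (toL2 hv) : Lp ℂ 2 (volume : Measure ℝ))‖ₑ = ‖toL2 hv‖ₑ := by
    rw [← ofReal_norm, ← ofReal_norm, Lp.norm_fourier_eq]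
  rw [Lp.enorm_def, Lp.enorm_def] at h1
  rw [h1, toL2, eLpNorm_congr_ae (memLp_ofReal hv).coeFn_toLp]
  congr 1
  exact eLpNorm_congr_norm_ae (.of_forall fun x => by simp)

/-- The phase `exp (2πihξ)` by which a translation acts on the Fourier side. -/
def phase (h ξ : ℝ) : ℂ := (Real.fourierChar (h * ξ) : ℂ)

lemma continuous_phase (h : ℝ) : Continuous (phase h) :=
  continuous_subtype_val.comp
    (Real.continuous_fourierChar.comp (continuous_const.mul continuous_id))

/-- The Fourier transform of a translate. The two sides are continuous in `f`, so that it is enough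
to compute them for Schwartz functions. -/
lemma fourier_compMeasurePreserving (h : ℝ) (f : Lp ℂ 2 (volume : Measure ℝ)) :
    (𝓕 (Lp.compMeasurePreserving (fun x : ℝ => x + h) (measurePreserving_add_right volume h) f) :
      Lp ℂ 2 (volume : Measure ℝ)) =ᵐ[volume]
      fun ξ => phase h ξ * (𝓕 f : Lp ℂ 2 (volume : Measure ℝ)) ξ := by
  have hm : MemLp (phase h) ∞ volume :=
    memLp_top_of_bound (continuous_phase h).aestronglyMeasurable 1
      (.of_forall fun ξ => (Circle.norm_coe _).le)
  set M : Lp ℂ 2 (volume : Measure ℝ) →L[ℂ] Lp ℂ 2 (volume : Measure ℝ) :=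
    (ContinuousLinearMap.mul ℂ ℂ).holderL volume ∞ 2 2 (hm.toLp) with hM
  have hMf : ∀ g : Lp ℂ 2 (volume : Measure ℝ), M g =ᵐ[volume] fun ξ => phase h ξ * g ξ := by
    intro g
    have h1 := (ContinuousLinearMap.mul ℂ ℂ).coeFn_holder (r := 2) hm.toLp g
    filter_upwards [h1, hm.coeFn_toLp] with ξ h2 h3
    rw [hM, ContinuousLinearMap.holderL_apply_apply, h2, h3]
    rfl
  have hmain : 𝓕 (Lp.compMeasurePreserving (fun x : ℝ => x + h)
      (measurePreserving_add_right volume h) f) = M (𝓕 f) := by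
    refine DenseRange.induction_on (p := fun f : Lp ℂ 2 (volume : Measure ℝ) =>
      𝓕 (Lp.compMeasurePreserving (fun x : ℝ => x + h)
        (measurePreserving_add_right volume h) f) = M (𝓕 f))
      (SchwartzMap.denseRange_toLpCLM (p := 2) ENNReal.ofNat_ne_top) f ?_ ?_
    · refine isClosed_eq ?_ ?_
      · exact ((Lp.fourierTransformₗᵢ ℝ ℂ).continuous).comp
          (Lp.isometry_compMeasurePreserving _).continuous
      · exact M.continuous.comp (Lp.fourierTransformₗᵢ ℝ ℂ).continuous
    · intro φ
      have hg : Function.HasTemperateGrowth (fun x : ℝ => x + h) := by fun_prop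
      have hl : AntilipschitzWith 1 (fun x : ℝ => x + h) :=
        AntilipschitzWith.of_le_mul_dist fun x y => by simp
      set τ : SchwartzMap ℝ ℂ := SchwartzMap.compCLMOfAntilipschitz ℂ hg hl φ with hτ
      have e1 : Lp.compMeasurePreserving (fun x : ℝ => x + h)
          (measurePreserving_add_right volume h) (φ.toLp 2) = τ.toLp 2 := by
        refine Lp.ext ?_
        refine (Lp.coeFn_compMeasurePreserving _ _).trans ?_
        have h1 := (measurePreserving_add_right volume h).quasiMeasurePreserving.ae_eq_comp
          (φ.coeFn_toLp 2)
        refine h1.trans ?_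
        filter_upwards [τ.coeFn_toLp 2] with x hx
        rw [hx]
        rfl
      change 𝓕 (Lp.compMeasurePreserving (fun x : ℝ => x + h)
        (measurePreserving_add_right volume h) (φ.toLp 2)) = M (𝓕 (φ.toLp 2))
      rw [e1, SchwartzMap.toLp_fourier_eq, SchwartzMap.toLp_fourier_eq]
      refine Lp.ext ?_
      refine EventuallyEq.trans ?_ (hMf _).symm
      filter_upwards [(𝓕 τ).coeFn_toLp 2, (𝓕 φ).coeFn_toLp 2] with ξ h1 h2
      rw [h1, h2, SchwartzMap.fourier_coe, SchwartzMap.fourier_coe]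
      have h3 := congrFun (VectorFourier.fourierIntegral_comp_add_right Real.fourierChar volume
        (innerₗ ℝ) (φ : ℝ → ℂ) h) ξ
      refine Eq.trans h3 ?_
      rw [Circle.smul_def, smul_eq_mul, phase, mul_comm h ξ]
      rfl
  rw [hmain]
  exact hMf _

lemma l2Fourier_translate {v : ℝ → ℝ} (hv : MemLp v 2 volume) (h : ℝ) :
    l2Fourier (fun x => v (x + h)) =ᵐ[volume] fun ξ => phase h ξ * l2Fourier v ξ := by
  have hτ : MemLp (fun x => v (x + h)) 2 volume :=
    hv.comp_measurePreserving (measurePreserving_add_right volume h)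
  have e : toL2 hτ = Lp.compMeasurePreserving (fun x : ℝ => x + h)
      (measurePreserving_add_right volume h) (toL2 hv) := by
    rw [toL2, toL2, Lp.toLp_compMeasurePreserving]
    rfl
  rw [l2Fourier_eq hτ, l2Fourier_eq hv, e]
  exact fourier_compMeasurePreserving h _

/-- For an increment `h` between a quarter and a half of the wavelength, the phase lies in the left
half plane. -/
lemma enorm_phase_sub_one_sq {h ξ : ℝ} (hh : 1 / 4 ≤ |h * ξ|) (hh' : |h * ξ| ≤ 1 / 2) :
    1 ≤ ‖phase h ξ - 1‖ₑ ^ 2 := by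
  have h1 : ‖phase h ξ - 1‖ ^ 2 = 2 - 2 * Real.cos (2 * Real.pi * (h * ξ)) := by
    rw [← Complex.normSq_eq_norm_sq, phase, Real.fourierChar_apply, Complex.normSq_apply]
    have := Complex.exp_ofReal_mul_I_re (2 * Real.pi * (h * ξ))
    have := Complex.exp_ofReal_mul_I_im (2 * Real.pi * (h * ξ))
    simp only [Complex.sub_re, Complex.sub_im, Complex.one_re, Complex.one_im, *]
    nlinarith [Real.sin_sq_add_cos_sq (2 * Real.pi * (h * ξ))]
  have h2 : Real.cos (2 * Real.pi * (h * ξ)) ≤ 0 := by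
    rw [← Real.cos_abs, abs_mul, abs_of_pos Real.two_pi_pos]
    apply Real.cos_nonpos_of_pi_div_two_le_of_le <;> nlinarith [Real.pi_pos]
  rw [← enorm_pow, ← ofReal_norm, norm_pow, h1, ← ENNReal.ofReal_one]
  exact ENNReal.ofReal_le_ofReal (by linarith)

/-! ### The energy of the fractional Laplacian -/

/-- The energy `∫ |2πξ|^lam |v̂|²` of the fractional Laplacian. -/
def fracEnergy (lam : ℝ) (v : ℝ → ℝ) : ℝ≥0∞ :=
  ∫⁻ ξ : ℝ, ENNReal.ofReal (|2 * Real.pi * ξ| ^ lam) * ‖l2Fourier v ξ‖ₑ ^ 2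

lemma lintegral_enorm_translate_sub_sq {v : ℝ → ℝ} (hv : MemLp v 2 volume) (h : ℝ) :
    ∫⁻ x, ‖v (x + h) - v x‖ₑ ^ 2 = ∫⁻ ξ, ‖phase h ξ - 1‖ₑ ^ 2 * ‖l2Fourier v ξ‖ₑ ^ 2 := by
  have hτ : MemLp (fun x => v (x + h)) 2 volume :=
    hv.comp_measurePreserving (measurePreserving_add_right volume h)
  have hd : MemLp (fun x => v (x + h) - v x) 2 volume := hτ.sub hv
  rw [← lintegral_enorm_l2Fourier_sq hd]
  refine lintegral_congr_ae ?_
  filter_upwards [l2Fourier_sub hτ hv, l2Fourier_translate hv h] with ξ h1 h2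
  rw [h1, h2, ← mul_pow, ← enorm_mul, sub_mul, one_mul]

/-- The symbol `|2πξ|^lam` as an average of `|exp (2πihξ) - 1|²` with weight `h^{-1-lam}`, up to a
constant. -/
lemma ofReal_rpow_le_lintegral_phase {lam : ℝ} (h0 : 0 < lam) (h1 : lam < 1) {ξ : ℝ} (hξ : ξ ≠ 0) :
    ENNReal.ofReal (|2 * Real.pi * ξ| ^ lam) ≤ ENNReal.ofReal (2 * Real.pi) *
      ∫⁻ h in Ioi (0 : ℝ), ENNReal.ofReal (h ^ (-1 - lam)) * ‖phase h ξ - 1‖ₑ ^ 2 := by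
  have hξ0 : 0 < |ξ| := abs_pos.2 hξ
  set r : ℝ := 2 * |ξ| with hr
  have hr0 : 0 < r := by positivity
  -- Only increments `h` of the order of the wavelength are needed for a lower bound.
  have hlow : ENNReal.ofReal (r ^ lam / 2) ≤
      ∫⁻ h in Ioi (0 : ℝ), ENNReal.ofReal (h ^ (-1 - lam)) * ‖phase h ξ - 1‖ₑ ^ 2 := by
    have hsub : Icc (1 / (2 * r)) (1 / r) ⊆ Ioi (0 : ℝ) := fun h hh =>
      lt_of_lt_of_le (by positivity) hh.1
    refine le_trans ?_ (lintegral_mono_set hsub)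
    have hle : ∀ h ∈ Icc (1 / (2 * r)) (1 / r), ENNReal.ofReal (r ^ (1 + lam)) ≤
        ENNReal.ofReal (h ^ (-1 - lam)) * ‖phase h ξ - 1‖ₑ ^ 2 := by
      intro h hh
      have hpos : 0 < h := hsub hh
      have e : |h * ξ| = h * r / 2 := by rw [abs_mul, abs_of_pos hpos, hr]; ring
      have h2 : 1 / 2 ≤ h * r := by
        have := mul_le_mul_of_nonneg_right hh.1 hr0.le
        have e2 : 1 / (2 * r) * r = 1 / 2 := by field_simp
        linarith
      have h3 : h * r ≤ 1 := by
        have := mul_le_mul_of_nonneg_right hh.2 hr0.le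
        have e2 : 1 / r * r = 1 := by field_simp
        linarith
      have h4 := enorm_phase_sub_one_sq (h := h) (ξ := ξ) (by rw [e]; linarith)
        (by rw [e]; linarith)
      have h5 : r ^ (1 + lam) ≤ h ^ (-1 - lam) := by
        rw [show -1 - lam = -(1 + lam) by ring, Real.rpow_neg hpos.le, ← Real.inv_rpow hpos.le]
        refine Real.rpow_le_rpow hr0.le ?_ (by linarith)
        rw [le_inv_comm₀ hr0 hpos, ← one_div]
        exact hh.2
      calc ENNReal.ofReal (r ^ (1 + lam)) = ENNReal.ofReal (r ^ (1 + lam)) * 1 := by rw [mul_one]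
        _ ≤ _ := by gcongr
    calc ENNReal.ofReal (r ^ lam / 2)
        = ENNReal.ofReal (r ^ (1 + lam)) * volume (Icc (1 / (2 * r)) (1 / r)) := by
          rw [Real.volume_Icc, ← ENNReal.ofReal_mul (by positivity), Real.rpow_add hr0,
            Real.rpow_one]
          congr 1
          field_simp
          ring
      _ = ∫⁻ _ in Icc (1 / (2 * r)) (1 / r), ENNReal.ofReal (r ^ (1 + lam)) := by
          rw [lintegral_const, Measure.restrict_apply_univ]
      _ ≤ _ := setLIntegral_mono' measurableSet_Icc hle
  refine le_trans ?_ (mul_le_mul_right hlow _)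
  rw [← ENNReal.ofReal_mul (by positivity)]
  refine ENNReal.ofReal_le_ofReal ?_
  have e : |2 * Real.pi * ξ| = Real.pi * r := by
    rw [abs_mul, abs_of_pos Real.two_pi_pos, hr]
    ring
  rw [e, Real.mul_rpow Real.pi_pos.le hr0.le]
  have h2 : Real.pi ^ lam ≤ Real.pi := by
    conv_rhs => rw [← Real.rpow_one Real.pi]
    exact Real.rpow_le_rpow_of_exponent_le (by linarith [Real.pi_gt_three]) h1.le
  have h3 : 0 ≤ r ^ lam := by positivity
  nlinarith

/-- Tonelli's theorem for an integrand with a weight in each variable. -/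
lemma lintegral_lintegral_mul_swap {μ ν : Measure ℝ} [SFinite μ] [SFinite ν] {w G : ℝ → ℝ≥0∞}
    {P : ℝ → ℝ → ℝ≥0∞} (hw : Measurable w) (hw' : ∀ h, w h ≠ ⊤)
    (hP : Measurable (Function.uncurry P)) (hG : AEMeasurable G μ) :
    ∫⁻ ξ, (∫⁻ h, w h * P h ξ ∂ν) * G ξ ∂μ = ∫⁻ h, w h * ∫⁻ ξ, P h ξ * G ξ ∂μ ∂ν := by
  have hwP : Measurable (fun p : ℝ × ℝ => w p.2 * P p.2 p.1) :=
    (hw.comp measurable_snd).mul (hP.comp measurable_swap)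
  have hG' : AEMeasurable (fun p : ℝ × ℝ => G p.1) (μ.prod ν) := hG.comp_fst
  have hj : AEMeasurable (fun p : ℝ × ℝ => w p.2 * P p.2 p.1 * G p.1) (μ.prod ν) :=
    hwP.aemeasurable.mul hG'
  have e1 : ∀ ξ, (∫⁻ h, w h * P h ξ ∂ν) * G ξ = ∫⁻ h, w h * P h ξ * G ξ ∂ν := fun ξ =>
    (lintegral_mul_const _ (hwP.comp (measurable_prodMk_left (x := ξ)))).symm
  have e2 : ∀ h, w h * ∫⁻ ξ, P h ξ * G ξ ∂μ = ∫⁻ ξ, w h * P h ξ * G ξ ∂μ := fun h => by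
    rw [← lintegral_const_mul' _ _ (hw' h)]
    simp_rw [mul_assoc]
  simp_rw [e1, e2]
  exact lintegral_lintegral_swap hj

/-- The energy is controlled by the `L²` norms of the increments of the function. -/
lemma fracEnergy_le_lintegral {lam : ℝ} (h0 : 0 < lam) (h1 : lam < 1) {v : ℝ → ℝ}
    (hv : MemLp v 2 volume) :
    fracEnergy lam v ≤ ENNReal.ofReal (2 * Real.pi) *
      ∫⁻ h in Ioi (0 : ℝ), ENNReal.ofReal (h ^ (-1 - lam)) * ∫⁻ x, ‖v (x + h) - v x‖ₑ ^ 2 := by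
  have hne : ∀ᵐ ξ : ℝ, ξ ≠ 0 := by simp [ae_iff, measure_singleton]
  have hm : AEMeasurable (fun ξ => ‖l2Fourier v ξ‖ₑ ^ 2) volume :=
    (memLp_l2Fourier hv).aestronglyMeasurable.enorm.pow_const 2
  have hjoint : Continuous (fun p : ℝ × ℝ => phase p.1 p.2) :=
    continuous_subtype_val.comp (Real.continuous_fourierChar.comp
      (continuous_fst.mul continuous_snd))
  have hpm : Measurable (Function.uncurry fun h ξ : ℝ => ‖phase h ξ - 1‖ₑ ^ 2) :=
    ((hjoint.sub continuous_const).measurable.enorm).pow_const 2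
  have hwm : Measurable (fun h : ℝ => ENNReal.ofReal (h ^ (-1 - lam))) :=
    ENNReal.measurable_ofReal.comp (measurable_id.pow_const _)
  have hswap := lintegral_lintegral_mul_swap (μ := volume) (ν := volume.restrict (Ioi 0)) hwm
    (fun h => ENNReal.ofReal_ne_top) hpm hm
  simp_rw [lintegral_enorm_translate_sub_sq hv]
  rw [← hswap, ← lintegral_const_mul' _ _ ENNReal.ofReal_ne_top]
  refine lintegral_mono_ae ?_
  filter_upwards [hne] with ξ hξ
  rw [← mul_assoc]
  exact mul_le_mul_left (ofReal_rpow_le_lintegral_phase h0 h1 hξ) _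

/-! ### The mesh -/

lemma cell_unique {dx : ℝ} (hdx : 0 < dx) {i j : ℤ} {x : ℝ} (hi : x ∈ cell dx i)
    (hj : x ∈ cell dx j) : i = j := by
  have h1 : (i : ℝ) < j + 1 := lt_of_mul_lt_mul_right (hi.1.trans hj.2) hdx.le
  have h2 : (j : ℝ) < i + 1 := lt_of_mul_lt_mul_right (hj.1.trans hi.2) hdx.le
  have h1' : i < j + 1 := by exact_mod_cast h1
  have h2' : j < i + 1 := by exact_mod_cast h2
  omega

lemma iUnion_Ico_cell {dx : ℝ} (hdx : 0 < dx) :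
    ⋃ i : ℤ, Ico ((i : ℝ) * dx) ((i + 1) * dx) = univ := by
  have := iUnion_Ico_zsmul hdx
  simpa using this

lemma pairwise_disjoint_Ico_cell (dx : ℝ) :
    Pairwise (Function.onFun Disjoint fun i : ℤ => Ico ((i : ℝ) * dx) ((i + 1) * dx)) := by
  have := pairwise_disjoint_Ico_zsmul dx
  simpa using this

lemma restrict_Ico_cell (dx : ℝ) (i : ℤ) :
    (volume : Measure ℝ).restrict (Ico ((i : ℝ) * dx) ((i + 1) * dx)) =
      volume.restrict (cell dx i) :=
  restrict_Ioo_eq_restrict_Ico.symm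

lemma lintegral_eq_tsum_cell {dx : ℝ} (hdx : 0 < dx) (f : ℝ → ℝ≥0∞) :
    ∫⁻ x, f x = ∑' i : ℤ, ∫⁻ x in cell dx i, f x := by
  rw [← setLIntegral_univ, ← iUnion_Ico_cell hdx,
    lintegral_iUnion (fun i => measurableSet_Ico) (pairwise_disjoint_Ico_cell dx)]
  simp_rw [restrict_Ico_cell]

lemma hasSum_integral_cell {dx : ℝ} (hdx : 0 < dx) {f : ℝ → ℝ} (hf : Integrable f volume) :
    HasSum (fun i : ℤ => ∫ x in cell dx i, f x) (∫ x, f x) := by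
  have h := hasSum_integral_iUnion (fun i : ℤ => measurableSet_Ico) (pairwise_disjoint_Ico_cell dx)
    (hf.integrableOn (s := ⋃ i : ℤ, Ico ((i : ℝ) * dx) ((i + 1) * dx)))
  rw [iUnion_Ico_cell hdx, setIntegral_univ] at h
  simpa only [restrict_Ico_cell] using h

lemma volume_cell (dx : ℝ) (i : ℤ) : volume (cell dx i) = ENNReal.ofReal dx := by
  rw [cell, Real.volume_Ioo]
  congr 1
  ring

/-! ### Functions which are Hölder continuous on each cell -/

/-- On the cell `I_i` the function `ρ` is bounded by `√(a i)` and is Hölder continuous with exponent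
`1/2`, with constant `√(a i / dx)`; it may jump at the grid points. -/
structure IsCellHolder (dx : ℝ) (ρ : ℝ → ℝ) (a : ℤ → ℝ) : Prop where
  nonneg : ∀ i, 0 ≤ a i
  sq_le : ∀ i, ∀ x ∈ cell dx i, ρ x ^ 2 ≤ a i
  sub_sq_le : ∀ i, ∀ x ∈ cell dx i, ∀ y ∈ cell dx i, (ρ x - ρ y) ^ 2 ≤ a i * (|x - y| / dx)

lemma enorm_sq_eq_ofReal (x : ℝ) : ‖x‖ₑ ^ 2 = ENNReal.ofReal (x ^ 2) := by
  rw [Real.enorm_eq_ofReal_abs, ← ENNReal.ofReal_pow (abs_nonneg x), sq_abs]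

lemma IsCellHolder.lintegral_sq_le {dx : ℝ} (hdx : 0 < dx) {ρ : ℝ → ℝ} {a : ℤ → ℝ}
    (h : IsCellHolder dx ρ a) :
    ∫⁻ x, ‖ρ x‖ₑ ^ 2 ≤ ENNReal.ofReal dx * ∑' i, ENNReal.ofReal (a i) := by
  rw [lintegral_eq_tsum_cell hdx, ← ENNReal.tsum_mul_left]
  refine ENNReal.tsum_le_tsum fun i => ?_
  calc ∫⁻ x in cell dx i, ‖ρ x‖ₑ ^ 2 ≤ ∫⁻ _ in cell dx i, ENNReal.ofReal (a i) := by
        refine setLIntegral_mono' measurableSet_Ioo fun x hx => ?_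
        rw [enorm_sq_eq_ofReal]
        exact ENNReal.ofReal_le_ofReal (h.sq_le i x hx)
    _ = _ := by
        rw [lintegral_const, Measure.restrict_apply_univ, volume_cell, mul_comm]

lemma IsCellHolder.memLp {dx : ℝ} (hdx : 0 < dx) {ρ : ℝ → ℝ} {a : ℤ → ℝ}
    (h : IsCellHolder dx ρ a) (ha : Summable a) (hm : AEStronglyMeasurable ρ volume) :
    MemLp ρ 2 volume := by
  refine ⟨hm, ?_⟩
  rw [eLpNorm_eq_lintegral_rpow_enorm_toReal two_ne_zero ENNReal.ofNat_ne_top]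
  refine ENNReal.rpow_lt_top_of_nonneg (by simp) (ne_of_lt ?_)
  have h1 := h.lintegral_sq_le hdx
  rw [← ENNReal.ofReal_tsum_of_nonneg h.nonneg ha] at h1
  simp only [ENNReal.toReal_ofNat, ENNReal.rpow_ofNat]
  exact h1.trans_lt (ENNReal.mul_lt_top ENNReal.ofReal_lt_top ENNReal.ofReal_lt_top)

/-- For small `h` the squared `L²` norm of the increments is of order `h`, in spite of the jumps:
these only affect a set of measure `h` in each cell. -/
lemma IsCellHolder.lintegral_translate_le_of_le {dx : ℝ} (hdx : 0 < dx) {ρ : ℝ → ℝ} {a : ℤ → ℝ}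
    (H : IsCellHolder dx ρ a) {h : ℝ} (hh : 0 < h) (hh' : h ≤ dx) :
    ∫⁻ x, ‖ρ (x + h) - ρ x‖ₑ ^ 2 ≤ ENNReal.ofReal (5 * h) * ∑' i, ENNReal.ofReal (a i) := by
  have hcell : ∀ i : ℤ, ∫⁻ x in cell dx i, ‖ρ (x + h) - ρ x‖ₑ ^ 2 ≤
      ENNReal.ofReal (3 * h) * ENNReal.ofReal (a i) +
        ENNReal.ofReal (2 * h) * ENNReal.ofReal (a (i + 1)) := by
    intro i
    have hai := H.nonneg i
    have hai' := H.nonneg (i + 1)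
    have hne : ∀ᵐ x : ℝ, x ≠ (i + 1) * dx - h := by simp [ae_iff, measure_singleton]
    -- Either `x + h` stays in the cell of `x`, or `x` lies within `h` of the right end point.
    have hpt : ∀ᵐ x ∂(volume.restrict (cell dx i)), ‖ρ (x + h) - ρ x‖ₑ ^ 2 ≤
        ENNReal.ofReal (a i * (h / dx)) + (Ioo ((i + 1) * dx - h) ((i + 1) * dx)).indicator
          (fun _ => ENNReal.ofReal (2 * a i + 2 * a (i + 1))) x := by
      filter_upwards [ae_restrict_of_ae hne, ae_restrict_mem measurableSet_Ioo] with x hxne hx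
      rw [enorm_sq_eq_ofReal]
      rcases lt_or_gt_of_ne hxne with hlt | hgt
      · refine le_trans (ENNReal.ofReal_le_ofReal ?_) le_self_add
        have := H.sub_sq_le i (x + h) ⟨by linarith [hx.1], by linarith⟩ x hx
        rwa [add_sub_cancel_left, abs_of_pos hh] at this
      · rw [indicator_of_mem (show x ∈ Ioo ((i + 1) * dx - h) ((i + 1) * dx) from ⟨hgt, hx.2⟩)]
        refine le_trans (ENNReal.ofReal_le_ofReal ?_) le_add_self
        have h1 := H.sq_le i x hx
        have h2 := H.sq_le (i + 1) (x + h) ⟨by push_cast; linarith, by push_cast; linarith [hx.2]⟩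
        nlinarith [sq_nonneg (ρ (x + h) + ρ x)]
    refine (lintegral_mono_ae hpt).trans ?_
    rw [lintegral_add_left measurable_const, lintegral_const, Measure.restrict_apply_univ,
      volume_cell]
    have h3 : ∫⁻ x in cell dx i, (Ioo ((i + 1) * dx - h) ((i + 1) * dx)).indicator
        (fun _ => ENNReal.ofReal (2 * a i + 2 * a (i + 1))) x ≤
        ENNReal.ofReal (2 * a i + 2 * a (i + 1)) * ENNReal.ofReal h := by
      refine (setLIntegral_le_lintegral _ _).trans ?_
      rw [lintegral_indicator_const measurableSet_Ioo, Real.volume_Ioo, sub_sub_cancel]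
    refine (add_le_add_right h3 _).trans (le_of_eq ?_)
    rw [← ENNReal.ofReal_mul (by positivity), ← ENNReal.ofReal_mul (by positivity),
      ← ENNReal.ofReal_mul (by positivity), ← ENNReal.ofReal_mul (by positivity),
      ← ENNReal.ofReal_add (by positivity) (by positivity),
      ← ENNReal.ofReal_add (by positivity) (by positivity)]
    congr 1
    field_simp
    ring
  rw [lintegral_eq_tsum_cell hdx]
  refine (ENNReal.tsum_le_tsum hcell).trans (le_of_eq ?_)
  have hshift : ∑' i : ℤ, ENNReal.ofReal (a (i + 1)) = ∑' i, ENNReal.ofReal (a i) :=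
    (Equiv.addRight (1 : ℤ)).tsum_eq (fun i => ENNReal.ofReal (a i))
  rw [ENNReal.tsum_add, ENNReal.tsum_mul_left, ENNReal.tsum_mul_left, hshift, ← add_mul,
    ← ENNReal.ofReal_add (by positivity) (by positivity)]
  congr 2
  ring

/-- The trivial bound for the increments, used for `h` larger than the mesh size. -/
lemma IsCellHolder.lintegral_translate_le {dx : ℝ} (hdx : 0 < dx) {ρ : ℝ → ℝ} {a : ℤ → ℝ}
    (H : IsCellHolder dx ρ a) (hm : AEStronglyMeasurable ρ volume) (h : ℝ) :
    ∫⁻ x, ‖ρ (x + h) - ρ x‖ₑ ^ 2 ≤ ENNReal.ofReal (4 * dx) * ∑' i, ENNReal.ofReal (a i) := by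
  have hpt : ∀ x, ‖ρ (x + h) - ρ x‖ₑ ^ 2 ≤ 2 * ‖ρ (x + h)‖ₑ ^ 2 + 2 * ‖ρ x‖ₑ ^ 2 := by
    intro x
    simp_rw [enorm_sq_eq_ofReal]
    rw [← ENNReal.ofReal_ofNat 2, ← ENNReal.ofReal_mul (by norm_num),
      ← ENNReal.ofReal_mul (by norm_num), ← ENNReal.ofReal_add (by positivity) (by positivity)]
    exact ENNReal.ofReal_le_ofReal (by nlinarith [sq_nonneg (ρ (x + h) + ρ x)])
  refine (lintegral_mono hpt).trans ?_
  have hm2 : AEMeasurable (fun x => 2 * ‖ρ x‖ₑ ^ 2) volume := (hm.enorm.pow_const 2).const_mul 2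
  rw [lintegral_add_right' _ hm2, lintegral_const_mul' _ _ (by norm_num),
    lintegral_const_mul' _ _ (by norm_num),
    lintegral_add_right_eq_self (fun x => ‖ρ x‖ₑ ^ 2) h, ← add_mul]
  refine (mul_le_mul_right (H.lintegral_sq_le hdx) _).trans (le_of_eq ?_)
  rw [← mul_assoc, ENNReal.ofReal_mul (by norm_num)]
  norm_num

/-- A function which is Hölder continuous on each cell has finite energy: since `lam < 1`, the jumps
at the grid points do no harm. -/
lemma exists_fracEnergy_le {lam : ℝ} (h0 : 0 < lam) (h1 : lam < 1) : ∃ K : ℝ, 0 < K ∧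
    ∀ dx : ℝ, 0 < dx → ∀ (ρ : ℝ → ℝ) (a : ℤ → ℝ), AEStronglyMeasurable ρ volume →
      IsCellHolder dx ρ a → Summable a →
      fracEnergy lam ρ ≤ ENNReal.ofReal (K * dx ^ (1 - lam) * ∑' i, a i) := by
  have h2 : 0 < 1 - lam := by linarith
  refine ⟨2 * Real.pi * (5 / (1 - lam) + 4 / lam), by positivity, fun dx hdx ρ a hm H ha => ?_⟩
  refine (fracEnergy_le_lintegral h0 h1 (H.memLp hdx ha hm)).trans ?_
  set S := ∑' i, a i with hS
  have hS0 : 0 ≤ S := tsum_nonneg H.nonneg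
  have hSe : ∑' i, ENNReal.ofReal (a i) = ENNReal.ofReal S :=
    (ENNReal.ofReal_tsum_of_nonneg H.nonneg ha).symm
  have hI1 : ∫⁻ h in Ioc 0 dx, ENNReal.ofReal (h ^ (-1 - lam)) * ∫⁻ x, ‖ρ (x + h) - ρ x‖ₑ ^ 2 ≤
      ENNReal.ofReal (5 / (1 - lam) * dx ^ (1 - lam) * S) := by
    have hint : IntegrableOn (fun h : ℝ => 5 * S * h ^ (-lam)) (Ioc 0 dx) volume := by
      have := (intervalIntegral.intervalIntegrable_rpow' (a := 0) (b := dx)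
        (show -1 < -lam by linarith)).const_mul (5 * S)
      rwa [intervalIntegrable_iff_integrableOn_Ioc_of_le hdx.le] at this
    calc _ ≤ ∫⁻ h in Ioc 0 dx, ENNReal.ofReal (5 * S * h ^ (-lam)) := by
          refine setLIntegral_mono' measurableSet_Ioc fun h hh => ?_
          have h3 := H.lintegral_translate_le_of_le hdx hh.1 hh.2
          rw [hSe, ← ENNReal.ofReal_mul (by linarith [hh.1])] at h3
          refine (mul_le_mul_right h3 _).trans (le_of_eq ?_)
          rw [← ENNReal.ofReal_mul (Real.rpow_nonneg hh.1.le _), show -lam = (-1 - lam) + 1 by ring,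
            Real.rpow_add_one hh.1.ne']
          congr 1
          ring
      _ = ENNReal.ofReal (∫ h in Ioc 0 dx, 5 * S * h ^ (-lam)) := by
          rw [ofReal_integral_eq_lintegral_ofReal hint]
          filter_upwards [ae_restrict_mem measurableSet_Ioc] with h hh
          exact mul_nonneg (by positivity) (Real.rpow_nonneg hh.1.le _)
      _ = _ := by
          rw [← intervalIntegral.integral_of_le hdx.le, intervalIntegral.integral_const_mul,
            integral_rpow (Or.inl (by linarith)), Real.zero_rpow (by linarith)]
          congr 1
          rw [show -lam + 1 = 1 - lam by ring]
          field_simp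
          ring
  have hI2 : ∫⁻ h in Ioi dx, ENNReal.ofReal (h ^ (-1 - lam)) * ∫⁻ x, ‖ρ (x + h) - ρ x‖ₑ ^ 2 ≤
      ENNReal.ofReal (4 / lam * dx ^ (1 - lam) * S) := by
    have hint : IntegrableOn (fun h : ℝ => 4 * dx * S * h ^ (-1 - lam)) (Ioi dx) volume :=
      (integrableOn_Ioi_rpow_of_lt (by linarith) hdx).const_mul _
    calc _ ≤ ∫⁻ h in Ioi dx, ENNReal.ofReal (4 * dx * S * h ^ (-1 - lam)) := by
          refine setLIntegral_mono' measurableSet_Ioi fun h hh => ?_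
          have h3 := H.lintegral_translate_le hdx hm h
          rw [hSe, ← ENNReal.ofReal_mul (by positivity)] at h3
          refine (mul_le_mul_right h3 _).trans (le_of_eq ?_)
          rw [mul_comm, ← ENNReal.ofReal_mul (by positivity)]
      _ = ENNReal.ofReal (∫ h in Ioi dx, 4 * dx * S * h ^ (-1 - lam)) := by
          rw [ofReal_integral_eq_lintegral_ofReal hint]
          filter_upwards [ae_restrict_mem measurableSet_Ioi] with h hh
          exact mul_nonneg (by positivity) (Real.rpow_nonneg (hdx.trans hh).le _)
      _ = _ := by
          rw [integral_const_mul, integral_Ioi_rpow_of_lt (by linarith) hdx,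
            show -1 - lam + 1 = -lam by ring, show 1 - lam = -lam + 1 by ring,
            Real.rpow_add_one hdx.ne']
          congr 1
          field_simp
  rw [← Ioc_union_Ioi_eq_Ioi hdx.le, lintegral_union measurableSet_Ioi
    (Ioc_disjoint_Ioi le_rfl)]
  refine (mul_le_mul_right (add_le_add hI1 hI2) _).trans (le_of_eq ?_)
  rw [← ENNReal.ofReal_add (by positivity) (by positivity),
    ← ENNReal.ofReal_mul (by positivity)]
  congr 1
  ring

/-! ### The bilinear form of the fractional Laplacian -/

/-- The function `|2πξ|^{lam/2} v̂(ξ)`, whose `L²` norm is the square root of the energy. -/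
def energyDensity (lam : ℝ) (v : ℝ → ℝ) (ξ : ℝ) : ℂ :=
  ((|2 * Real.pi * ξ| ^ (lam / 2) : ℝ) : ℂ) * l2Fourier v ξ

/-- Membership in `L²(ℝ)` together with finiteness of the energy. -/
structure HasFiniteEnergy (lam : ℝ) (v : ℝ → ℝ) : Prop where
  memLp : MemLp v 2 volume
  energy : MemLp (energyDensity lam v) 2 volume

lemma symbolG_mul_re (lam : ℝ) (v w : ℝ → ℝ) (ξ : ℝ) :
    symbolG lam ξ * (l2Fourier v ξ * (starRingEnd ℂ) (l2Fourier w ξ)).re =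
      - ((energyDensity lam v ξ).re * (energyDensity lam w ξ).re +
        (energyDensity lam v ξ).im * (energyDensity lam w ξ).im) := by
  have h : |2 * Real.pi * ξ| ^ lam =
      |2 * Real.pi * ξ| ^ (lam / 2) * |2 * Real.pi * ξ| ^ (lam / 2) := by
    rw [← Real.mul_rpow (abs_nonneg _) (abs_nonneg _), ← sq, ← Real.rpow_natCast,
      ← Real.rpow_mul (abs_nonneg _)]
    congr 1
    push_cast
    ring
  simp only [symbolG, energyDensity, Complex.mul_re, Complex.mul_im, Complex.conj_re,
    Complex.conj_im, Complex.ofReal_re, Complex.ofReal_im, h]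
  ring

section
variable {lam : ℝ} {v w z : ℝ → ℝ}

lemma HasFiniteEnergy.re (hv : HasFiniteEnergy lam v) :
    MemLp (fun ξ => (energyDensity lam v ξ).re) 2 volume := hv.energy.re

lemma HasFiniteEnergy.im (hv : HasFiniteEnergy lam v) :
    MemLp (fun ξ => (energyDensity lam v ξ).im) 2 volume := hv.energy.im

lemma integrable_pairingG (hv : HasFiniteEnergy lam v) (hw : HasFiniteEnergy lam w) :
    Integrable (fun ξ => symbolG lam ξ * (l2Fourier v ξ * (starRingEnd ℂ) (l2Fourier w ξ)).re)
      volume := by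
  simp_rw [symbolG_mul_re]
  exact ((integrable_mul_of_memLp_two hv.re hw.re).add
    (integrable_mul_of_memLp_two hv.im hw.im)).neg

lemma pairingG_eq (hv : HasFiniteEnergy lam v) (hw : HasFiniteEnergy lam w) :
    pairingG lam v w = - ((∫ ξ, (energyDensity lam v ξ).re * (energyDensity lam w ξ).re) +
      ∫ ξ, (energyDensity lam v ξ).im * (energyDensity lam w ξ).im) := by
  rw [pairingG]
  simp_rw [symbolG_mul_re]
  rw [integral_neg, integral_add (integrable_mul_of_memLp_two hv.re hw.re)
    (integrable_mul_of_memLp_two hv.im hw.im)]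

lemma pairingG_comm (lam : ℝ) (v w : ℝ → ℝ) : pairingG lam v w = pairingG lam w v := by
  rw [pairingG, pairingG]
  simp_rw [symbolG_mul_re]
  congr 1
  funext ξ
  ring

lemma pairingG_self_nonpos (lam : ℝ) (v : ℝ → ℝ) : pairingG lam v v ≤ 0 := by
  rw [pairingG]
  simp_rw [symbolG_mul_re]
  refine integral_nonpos fun ξ => ?_
  simp only [Pi.zero_apply]
  nlinarith [mul_self_nonneg (energyDensity lam v ξ).re,
    mul_self_nonneg (energyDensity lam v ξ).im]

/-- The Cauchy-Schwarz inequality for the energy. -/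
lemma sq_pairingG_le (hv : HasFiniteEnergy lam v) (hw : HasFiniteEnergy lam w) :
    pairingG lam v w ^ 2 ≤ pairingG lam v v * pairingG lam w w := by
  rw [pairingG_eq hv hw, pairingG_eq hv hv, pairingG_eq hw hw]
  have h1 := sq_integral_mul_le hv.re hw.re
  have h2 := sq_integral_mul_le hv.im hw.im
  simp only [← sq]
  set a := ∫ ξ, (energyDensity lam v ξ).re * (energyDensity lam w ξ).re
  set b := ∫ ξ, (energyDensity lam v ξ).im * (energyDensity lam w ξ).im
  have nn : ∀ f : ℝ → ℝ, 0 ≤ ∫ ξ, f ξ ^ 2 := fun f => integral_nonneg fun ξ => sq_nonneg _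
  have p1 := nn fun ξ => (energyDensity lam v ξ).re
  have p2 := nn fun ξ => (energyDensity lam w ξ).re
  have p3 := nn fun ξ => (energyDensity lam v ξ).im
  have p4 := nn fun ξ => (energyDensity lam w ξ).im
  set A := ∫ ξ, (energyDensity lam v ξ).re ^ 2
  set B := ∫ ξ, (energyDensity lam w ξ).re ^ 2
  set C := ∫ ξ, (energyDensity lam v ξ).im ^ 2
  set D := ∫ ξ, (energyDensity lam w ξ).im ^ 2
  have h3 : 2 * (a * b) ≤ A * D + C * B := by
    refine (le_abs_self _).trans (abs_le_of_sq_le_sq ?_ (by positivity))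
    have : (a * b) ^ 2 ≤ (A * B) * (C * D) := by
      rw [mul_pow]
      exact mul_le_mul h1 h2 (sq_nonneg _) (by positivity)
    nlinarith [sq_nonneg (A * D - C * B)]
  nlinarith

lemma HasFiniteEnergy.congr (hv : HasFiniteEnergy lam v) (h : v =ᵐ[volume] w) :
    HasFiniteEnergy lam w := by
  refine ⟨(memLp_congr_ae h).1 hv.memLp, ?_⟩
  have : energyDensity lam w = energyDensity lam v := by
    funext ξ
    rw [energyDensity, energyDensity, l2Fourier_congr hv.memLp h]
  rw [this]
  exact hv.energy

lemma HasFiniteEnergy.add (hv : HasFiniteEnergy lam v) (hw : HasFiniteEnergy lam w) :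
    HasFiniteEnergy lam (fun x => v x + w x) := by
  refine ⟨hv.memLp.add hw.memLp, (memLp_congr_ae ?_).1 (hv.energy.add hw.energy)⟩
  filter_upwards [l2Fourier_add hv.memLp hw.memLp] with ξ h
  simp only [Pi.add_apply, energyDensity, h]
  ring

lemma HasFiniteEnergy.const_mul (hv : HasFiniteEnergy lam v) (c : ℝ) :
    HasFiniteEnergy lam (fun x => c * v x) := by
  refine ⟨hv.memLp.const_mul c, (memLp_congr_ae ?_).1 (hv.energy.const_mul (c : ℂ))⟩
  filter_upwards [l2Fourier_const_mul hv.memLp c] with ξ h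
  simp only [energyDensity, h]
  ring

lemma HasFiniteEnergy.sub (hv : HasFiniteEnergy lam v) (hw : HasFiniteEnergy lam w) :
    HasFiniteEnergy lam (fun x => v x - w x) := by
  refine (hv.add (hw.const_mul (-1))).congr (.of_forall fun x => ?_)
  ring

lemma pairingG_add_left (hv : HasFiniteEnergy lam v) (hw : HasFiniteEnergy lam w)
    (hz : HasFiniteEnergy lam z) :
    pairingG lam (fun x => v x + w x) z = pairingG lam v z + pairingG lam w z := by
  rw [pairingG, pairingG, pairingG, ← integral_add (integrable_pairingG hv hz)
    (integrable_pairingG hw hz)]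
  refine integral_congr_ae ?_
  filter_upwards [l2Fourier_add hv.memLp hw.memLp] with ξ h
  rw [h, add_mul, Complex.add_re, mul_add]

lemma pairingG_const_mul_left (hv : HasFiniteEnergy lam v) (c : ℝ) :
    pairingG lam (fun x => c * v x) z = c * pairingG lam v z := by
  rw [pairingG, pairingG, ← integral_const_mul]
  refine integral_congr_ae ?_
  filter_upwards [l2Fourier_const_mul hv.memLp c] with ξ h
  simp only [h, mul_assoc, Complex.re_ofReal_mul]
  ring

lemma pairingG_sub_left (hv : HasFiniteEnergy lam v) (hw : HasFiniteEnergy lam w)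
    (hz : HasFiniteEnergy lam z) :
    pairingG lam (fun x => v x - w x) z = pairingG lam v z - pairingG lam w z := by
  have h := pairingG_add_left hv (hw.const_mul (-1)) hz
  rw [pairingG_const_mul_left hw] at h
  have e : (fun x => v x + -1 * w x) = fun x => v x - w x := by
    funext x
    ring
  rw [e] at h
  linarith

lemma hasFiniteEnergy_zero (lam : ℝ) : HasFiniteEnergy lam (fun _ => 0) := by
  have hz : MemLp (fun _ : ℝ => (0 : ℝ)) 2 volume := MemLp.zero'
  refine ⟨hz, (memLp_congr_ae ?_).1 (MemLp.zero' : MemLp (fun _ : ℝ => (0 : ℂ)) 2 volume)⟩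
  filter_upwards [l2Fourier_const_mul hz 0] with ξ h
  have h' : l2Fourier (fun _ => (0 : ℝ)) ξ = 0 := by simpa using h
  rw [energyDensity, h', mul_zero]

lemma HasFiniteEnergy.finset_sum {ι : Type*} (s : Finset ι) {f : ι → ℝ → ℝ}
    (hf : ∀ i ∈ s, HasFiniteEnergy lam (f i)) :
    HasFiniteEnergy lam (fun x => ∑ i ∈ s, f i x) := by
  classical
  induction s using Finset.induction_on with
  | empty => simpa using hasFiniteEnergy_zero lam
  | insert i s hi ih =>
    simp_rw [Finset.sum_insert hi]
    exact (hf i (by simp)).add (ih fun j hj => hf j (by simp [hj]))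

lemma pairingG_sum_right {ι : Type*} (s : Finset ι) {f : ι → ℝ → ℝ} (hv : HasFiniteEnergy lam v)
    (hf : ∀ i ∈ s, HasFiniteEnergy lam (f i)) :
    pairingG lam v (fun x => ∑ i ∈ s, f i x) = ∑ i ∈ s, pairingG lam v (f i) := by
  classical
  induction s using Finset.induction_on with
  | empty =>
    have h := pairingG_const_mul_left (z := v) (hasFiniteEnergy_zero lam) 0
    simp only [mul_zero, zero_mul] at h
    simp only [Finset.sum_empty]
    rw [pairingG_comm, h]
  | insert i s hi ih =>
    simp_rw [Finset.sum_insert hi]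
    rw [pairingG_comm, pairingG_add_left (hf i (by simp))
      (HasFiniteEnergy.finset_sum s fun j hj => hf j (by simp [hj])) hv, pairingG_comm,
      pairingG_comm lam (fun x => ∑ i ∈ s, f i x), ih fun j hj => hf j (by simp [hj])]

lemma enorm_energyDensity_sq (lam : ℝ) (v : ℝ → ℝ) (ξ : ℝ) : ‖energyDensity lam v ξ‖ₑ ^ 2 =
    ENNReal.ofReal (|2 * Real.pi * ξ| ^ lam) * ‖l2Fourier v ξ‖ₑ ^ 2 := by
  rw [energyDensity, enorm_mul, mul_pow]
  congr 1
  rw [← ofReal_norm, Complex.norm_real, Real.norm_of_nonneg (by positivity),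
    ← ENNReal.ofReal_pow (by positivity), ← Real.rpow_natCast, ← Real.rpow_mul (abs_nonneg _)]
  congr 2
  push_cast
  ring

lemma measurable_weight (lam : ℝ) :
    Measurable (fun ξ : ℝ => ((|2 * Real.pi * ξ| ^ (lam / 2) : ℝ) : ℂ)) :=
  Complex.measurable_ofReal.comp
    (((measurable_const.mul measurable_id).abs).pow_const _)

lemma hasFiniteEnergy_of_fracEnergy_lt_top (hv : MemLp v 2 volume) (h : fracEnergy lam v < ⊤) :
    HasFiniteEnergy lam v := by
  refine ⟨hv, ?_, ?_⟩
  · exact (measurable_weight lam).aestronglyMeasurable.mul (memLp_l2Fourier hv).aestronglyMeasurable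
  · rw [eLpNorm_eq_lintegral_rpow_enorm_toReal two_ne_zero ENNReal.ofNat_ne_top]
    refine ENNReal.rpow_lt_top_of_nonneg (by simp) (ne_of_lt ?_)
    simp only [ENNReal.toReal_ofNat, ENNReal.rpow_ofNat, enorm_energyDensity_sq]
    exact h

lemma neg_pairingG_self (hv : HasFiniteEnergy lam v) :
    - pairingG lam v v = (fracEnergy lam v).toReal := by
  have e : ∀ ξ, ENNReal.ofReal (|2 * Real.pi * ξ| ^ lam) * ‖l2Fourier v ξ‖ₑ ^ 2 =
      ENNReal.ofReal ((energyDensity lam v ξ).re ^ 2 + (energyDensity lam v ξ).im ^ 2) := by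
    intro ξ
    rw [← enorm_energyDensity_sq, ← ofReal_norm, ← ENNReal.ofReal_pow (norm_nonneg _),
      ← Complex.normSq_eq_norm_sq, Complex.normSq_apply]
    ring_nf
  rw [pairingG_eq hv hv, neg_neg, fracEnergy]
  simp_rw [e]
  have hi : Integrable (fun ξ => (energyDensity lam v ξ).re ^ 2 + (energyDensity lam v ξ).im ^ 2)
      volume := hv.re.integrable_sq.add hv.im.integrable_sq
  rw [← integral_eq_lintegral_of_nonneg_ae (.of_forall fun ξ => by positivity)
    hi.aestronglyMeasurable,
    integral_add hv.re.integrable_sq hv.im.integrable_sq]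
  simp_rw [sq]

/-- The relation `g[v] = h` in `L²` implies that `v` has finite energy. -/
lemma IsFracLaplacian.hasFiniteEnergy {h : ℝ → ℝ} (hvh : IsFracLaplacian lam v h) :
    HasFiniteEnergy lam v := by
  refine ⟨hvh.1, MemLp.of_le ((memLp_l2Fourier hvh.1).norm.add (memLp_l2Fourier hvh.2.1).norm)
    ((measurable_weight lam).aestronglyMeasurable.mul
      (memLp_l2Fourier hvh.1).aestronglyMeasurable) ?_⟩
  filter_upwards [hvh.2.2] with ξ hξ
  simp only [Pi.add_apply]
  rw [Real.norm_of_nonneg (add_nonneg (norm_nonneg _) (norm_nonneg _)), hξ, energyDensity, norm_mul,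
    norm_mul, Complex.norm_real, Complex.norm_real, symbolG, norm_neg,
    Real.norm_of_nonneg (by positivity), Real.norm_of_nonneg (by positivity)]
  have hle : |2 * Real.pi * ξ| ^ (lam / 2) ≤ 1 + |2 * Real.pi * ξ| ^ lam := by
    have : |2 * Real.pi * ξ| ^ lam = (|2 * Real.pi * ξ| ^ (lam / 2)) ^ 2 := by
      rw [← Real.rpow_natCast, ← Real.rpow_mul (abs_nonneg _)]
      congr 1
      push_cast
      ring
    rw [this]
    nlinarith [sq_nonneg (|2 * Real.pi * ξ| ^ (lam / 2) - 1)]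
  calc _ ≤ (1 + |2 * Real.pi * ξ| ^ lam) * ‖l2Fourier v ξ‖ := by gcongr
    _ = _ := by ring

/-- If `g[v] ∈ L²`, the pairing `⟨g[v], w⟩` is the inner product in `L²`. -/
lemma IsFracLaplacian.integral_mul {h : ℝ → ℝ} (hvh : IsFracLaplacian lam v h)
    (hw : MemLp w 2 volume) : ∫ x, h x * w x = pairingG lam v w := by
  rw [← integral_l2Fourier_mul_conj_re hvh.2.1 hw, pairingG]
  refine integral_congr_ae ?_
  filter_upwards [hvh.2.2] with ξ hξ
  rw [hξ, mul_assoc, Complex.re_ofReal_mul]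

end

/-! ### The cellwise `L²` projection -/

/-- The Legendre coefficients of the `L²` projection of `v` onto piecewise polynomials. -/
def legCoef (dx : ℝ) (v : ℝ → ℝ) (p : ℕ) (i : ℤ) : ℝ :=
  (2 * p + 1) / dx * ∫ x in cell dx i, v x * cellLegendre dx i p x

lemma measurableSet_cell (dx : ℝ) (i : ℤ) : MeasurableSet (cell dx i) := measurableSet_Ioo

lemma integrableOn_mul_continuous {dx : ℝ} {i : ℤ} {v g : ℝ → ℝ} (hv : IntegrableOn v (cell dx i))
    (hg : Continuous g) : IntegrableOn (fun x => v x * g x) (cell dx i) := by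
  rw [cell, ← integrableOn_Icc_iff_integrableOn_Ioo] at hv ⊢
  exact hv.mul_continuousOn hg.continuousOn isCompact_Icc

lemma integrableOn_cell_of_continuous {dx : ℝ} (i : ℤ) {g : ℝ → ℝ} (hg : Continuous g) :
    IntegrableOn g (cell dx i) :=
  (hg.continuousOn.integrableOn_compact isCompact_Icc).mono_set Ioo_subset_Icc_self

lemma integrableOn_cell_of_memLp {v : ℝ → ℝ} (hv : MemLp v 2 volume) (dx : ℝ) (i : ℤ) :
    IntegrableOn v (cell dx i) :=
  ((locallyIntegrable_of_memLp_two hv).integrableOn_isCompact isCompact_Icc).mono_set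
    Ioo_subset_Icc_self

lemma setIntegral_mul_legendreCell (dx : ℝ) (v : ℝ → ℝ) (p : ℕ) (i : ℤ) :
    ∫ x in cell dx i, v x * legendreCell dx p i x =
      ∫ x in cell dx i, v x * cellLegendre dx i p x := by
  refine setIntegral_congr_fun measurableSet_Ioo fun x hx => ?_
  simp only [legendreCell_eq]
  rw [indicator_of_mem (show x ∈ cell dx i from hx)]

lemma integral_mul_legendreCell (dx : ℝ) (v : ℝ → ℝ) (p : ℕ) (i : ℤ) :
    ∫ x, v x * legendreCell dx p i x = ∫ x in cell dx i, v x * cellLegendre dx i p x := by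
  rw [← integral_indicator (measurableSet_cell dx i)]
  congr 1
  funext x
  rw [legendreCell_eq]
  by_cases hx : x ∈ cell dx i
  · rw [indicator_of_mem hx, indicator_of_mem hx]
  · rw [indicator_of_notMem hx, indicator_of_notMem hx, mul_zero]

lemma memLp_legendreCell (dx : ℝ) (p : ℕ) (i : ℤ) : MemLp (legendreCell dx p i) 2 volume := by
  rw [legendreCell_eq, memLp_indicator_iff_restrict (measurableSet_cell dx i),
    memLp_two_iff_integrable_sq (continuous_cellLegendre dx i p).aestronglyMeasurable]
  exact integrableOn_cell_of_continuous i ((continuous_cellLegendre dx i p).pow 2)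

section Cell
variable {dx : ℝ} {i : ℤ} {v w : ℝ → ℝ}

lemma legCoef_sub (hv : IntegrableOn v (cell dx i)) (hw : IntegrableOn w (cell dx i)) (p : ℕ) :
    legCoef dx (fun x => v x - w x) p i = legCoef dx v p i - legCoef dx w p i := by
  simp only [legCoef, sub_mul]
  rw [integral_sub (integrableOn_mul_continuous hv (continuous_cellLegendre dx i p))
    (integrableOn_mul_continuous hw (continuous_cellLegendre dx i p))]
  ring

lemma legCoef_congr (h : ∀ᵐ x ∂(volume.restrict (cell dx i)), v x = w x) (p : ℕ) :
    legCoef dx v p i = legCoef dx w p i := by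
  rw [legCoef, legCoef]
  congr 1
  refine integral_congr_ae ?_
  filter_upwards [h] with x hx
  rw [hx]

lemma legCoef_cellSum (hdx : 0 < dx) (i : ℤ) {k : ℕ} (a : ℕ → ℝ) {p : ℕ} (hp : p ≤ k) :
    legCoef dx (cellSum dx k i a) p i = a p := by
  rw [legCoef, setIntegral_cell hdx, integral_cellSum_mul hdx k i a hp]
  field_simp

lemma integral_mul_cellSum (hdx : 0 < dx) (hv : IntegrableOn v (cell dx i)) (k : ℕ) (b : ℕ → ℝ) :
    ∫ x in cell dx i, v x * cellSum dx k i b x =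
      ∑ p ∈ Finset.range (k + 1), dx / (2 * p + 1) * (legCoef dx v p i * b p) := by
  simp only [cellSum, Finset.mul_sum]
  have hint : ∀ p ∈ Finset.range (k + 1),
      Integrable (fun x => v x * (b p * cellLegendre dx i p x)) (volume.restrict (cell dx i)) :=
    fun p _ => integrableOn_mul_continuous hv
      (continuous_const.mul (continuous_cellLegendre dx i p))
  rw [integral_finsetSum _ hint]
  refine Finset.sum_congr rfl fun p _ => ?_
  have : ∀ x, v x * (b p * cellLegendre dx i p x) = b p * (v x * cellLegendre dx i p x) :=
    fun x => by ring
  simp_rw [this]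
  rw [integral_const_mul, legCoef]
  have h2 : (2 * p + 1 : ℝ) ≠ 0 := by positivity
  field_simp

/-- The projection error is orthogonal to polynomials. -/
lemma integral_sub_cellSum_mul_cellSum (hdx : 0 < dx) (hv : IntegrableOn v (cell dx i)) (k : ℕ)
    (b : ℕ → ℝ) :
    ∫ x in cell dx i, (v x - cellSum dx k i (fun p => legCoef dx v p i) x) * cellSum dx k i b x
      = 0 := by
  have hc := integrableOn_cell_of_continuous (dx := dx) i
    (continuous_cellSum dx k i fun p => legCoef dx v p i)
  have hvc : IntegrableOn (fun x => v x - cellSum dx k i (fun p => legCoef dx v p i) x)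
      (cell dx i) := hv.sub hc
  rw [integral_mul_cellSum hdx hvc]
  refine Finset.sum_eq_zero fun p hp => ?_
  have hp' : p ≤ k := by simp at hp; omega
  have h := legCoef_sub hv hc p
  rw [legCoef_cellSum hdx i _ hp', sub_self] at h
  rw [h, zero_mul, mul_zero]

lemma sq_cellSum_le {k : ℕ} {B : ℝ} (a : ℕ → ℝ) {x : ℝ}
    (hB : ∀ p ≤ k, |cellLegendre dx i p x| ≤ B) :
    cellSum dx k i a x ^ 2 ≤ B ^ 2 * (k + 1) * ∑ p ∈ Finset.range (k + 1), a p ^ 2 := by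
  have h := sq_sum_le_card_mul_sum_sq (s := Finset.range (k + 1))
    (f := fun p => a p * cellLegendre dx i p x)
  rw [Finset.card_range] at h
  refine h.trans ?_
  push_cast
  rw [mul_comm (B ^ 2), mul_assoc, Finset.mul_sum (a := B ^ 2)]
  refine mul_le_mul_of_nonneg_left (Finset.sum_le_sum fun p hp => ?_) (by positivity)
  have hp' : p ≤ k := by simp at hp; omega
  have := pow_le_pow_left₀ (abs_nonneg _) (hB p hp') 2
  rw [sq_abs] at this
  rw [mul_pow, mul_comm]
  exact mul_le_mul_of_nonneg_right this (sq_nonneg _)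

lemma sq_cellSum_sub_le {k : ℕ} {B : ℝ} (a : ℕ → ℝ) {x y : ℝ}
    (hB : ∀ p ≤ k, |cellLegendre dx i p x - cellLegendre dx i p y| ≤ B) :
    (cellSum dx k i a x - cellSum dx k i a y) ^ 2 ≤
      B ^ 2 * (k + 1) * ∑ p ∈ Finset.range (k + 1), a p ^ 2 := by
  have h := sq_sum_le_card_mul_sum_sq (s := Finset.range (k + 1))
    (f := fun p => a p * (cellLegendre dx i p x - cellLegendre dx i p y))
  rw [Finset.card_range] at h
  have e : cellSum dx k i a x - cellSum dx k i a y =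
      ∑ p ∈ Finset.range (k + 1), a p * (cellLegendre dx i p x - cellLegendre dx i p y) := by
    simp only [cellSum, mul_sub, Finset.sum_sub_distrib]
  rw [e]
  refine h.trans ?_
  push_cast
  rw [mul_comm (B ^ 2), mul_assoc, Finset.mul_sum (a := B ^ 2)]
  refine mul_le_mul_of_nonneg_left (Finset.sum_le_sum fun p hp => ?_) (by positivity)
  have hp' : p ≤ k := by simp at hp; omega
  have := pow_le_pow_left₀ (abs_nonneg _) (hB p hp') 2
  rw [sq_abs] at this
  rw [mul_pow, mul_comm]
  exact mul_le_mul_of_nonneg_right this (sq_nonneg _)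

end Cell

/-! ### Piecewise polynomial functions -/

/-- The piecewise polynomial function with Legendre coefficients `a p i`. -/
def dgFun (dx : ℝ) (k : ℕ) (a : ℕ → ℤ → ℝ) (x : ℝ) : ℝ :=
  ∑' i : ℤ, ∑ p ∈ Finset.range (k + 1), a p i * legendreCell dx p i x

/-- The sum of the squares of the Legendre coefficients on the cell `I_i`. -/
def coefSq (k : ℕ) (a : ℕ → ℤ → ℝ) (i : ℤ) : ℝ := ∑ p ∈ Finset.range (k + 1), a p i ^ 2

lemma coefSq_nonneg (k : ℕ) (a : ℕ → ℤ → ℝ) (i : ℤ) : 0 ≤ coefSq k a i :=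
  Finset.sum_nonneg fun _ _ => sq_nonneg _

section DG
variable {dx : ℝ} {k : ℕ} {a b : ℕ → ℤ → ℝ} {v w : ℝ → ℝ}

lemma sum_mul_legendreCell_of_notMem (a : ℕ → ℤ → ℝ) {x : ℝ} {i : ℤ} (hx : x ∉ cell dx i) :
    ∑ p ∈ Finset.range (k + 1), a p i * legendreCell dx p i x = 0 := by
  refine Finset.sum_eq_zero fun p _ => ?_
  rw [legendreCell_eq, indicator_of_notMem hx, mul_zero]

lemma dgFun_of_mem (hdx : 0 < dx) (a : ℕ → ℤ → ℝ) {x : ℝ} {i : ℤ} (hx : x ∈ cell dx i) :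
    dgFun dx k a x = cellSum dx k i (fun p => a p i) x := by
  rw [dgFun, tsum_eq_single i fun j hj => sum_mul_legendreCell_of_notMem a
    fun hxj => hj (cell_unique hdx hxj hx), cellSum]
  refine Finset.sum_congr rfl fun p _ => ?_
  rw [legendreCell_eq, indicator_of_mem hx]

lemma dgFun_of_forall_notMem (a : ℕ → ℤ → ℝ) {x : ℝ} (hx : ∀ i : ℤ, x ∉ cell dx i) :
    dgFun dx k a x = 0 := by
  rw [dgFun]
  simp_rw [sum_mul_legendreCell_of_notMem a (hx _), tsum_zero]

lemma dgFun_congr (h : ∀ p ≤ k, ∀ i, a p i = b p i) : dgFun dx k a = dgFun dx k b := by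
  funext x
  rw [dgFun, dgFun]
  refine tsum_congr fun i => Finset.sum_congr rfl fun p hp => ?_
  rw [h p (by simp at hp; omega)]

lemma dgFun_add (hdx : 0 < dx) (a b : ℕ → ℤ → ℝ) (x : ℝ) :
    dgFun dx k (fun p i => a p i + b p i) x = dgFun dx k a x + dgFun dx k b x := by
  by_cases hx : ∃ i : ℤ, x ∈ cell dx i
  · obtain ⟨i, hi⟩ := hx
    simp only [dgFun_of_mem hdx _ hi, cellSum, add_mul, Finset.sum_add_distrib]
  · push Not at hx
    simp only [dgFun_of_forall_notMem _ hx, add_zero]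

lemma dgFun_sub (hdx : 0 < dx) (a b : ℕ → ℤ → ℝ) (x : ℝ) :
    dgFun dx k (fun p i => a p i - b p i) x = dgFun dx k a x - dgFun dx k b x := by
  by_cases hx : ∃ i : ℤ, x ∈ cell dx i
  · obtain ⟨i, hi⟩ := hx
    simp only [dgFun_of_mem hdx _ hi, cellSum, sub_mul, Finset.sum_sub_distrib]
  · push Not at hx
    simp only [dgFun_of_forall_notMem _ hx, sub_zero]

lemma aestronglyMeasurable_of_cell (hdx : 0 < dx)
    (h : ∀ i : ℤ, AEStronglyMeasurable v (volume.restrict (cell dx i))) :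
    AEStronglyMeasurable v volume := by
  have h1 : AEStronglyMeasurable v
      (volume.restrict (⋃ i : ℤ, Ico ((i : ℝ) * dx) ((i + 1) * dx))) := by
    rw [aestronglyMeasurable_iUnion_iff]
    intro i
    rw [restrict_Ico_cell]
    exact h i
  rwa [iUnion_Ico_cell hdx, Measure.restrict_univ] at h1

lemma aestronglyMeasurable_dgFun (hdx : 0 < dx) (k : ℕ) (a : ℕ → ℤ → ℝ) :
    AEStronglyMeasurable (dgFun dx k a) volume := by
  refine aestronglyMeasurable_of_cell hdx fun i => ?_
  refine (continuous_cellSum dx k i fun p => a p i).aestronglyMeasurable.congr ?_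
  filter_upwards [ae_restrict_mem measurableSet_Ioo] with x hx
  exact (dgFun_of_mem hdx a hx).symm

/-- A piecewise polynomial satisfies the cellwise Hölder bounds by equivalence of norms on
polynomials of degree at most `k`; the mesh size enters only by scaling. -/
lemma exists_isCellHolder_dgFun (k : ℕ) : ∃ B : ℝ, 0 < B ∧ ∀ dx : ℝ, 0 < dx → ∀ a : ℕ → ℤ → ℝ,
    IsCellHolder dx (dgFun dx k a) (fun i => B * coefSq k a i) := by
  obtain ⟨B, hB1, hB⟩ := exists_bound_cellLegendre k
  refine ⟨B ^ 2 * (k + 1), by positivity, fun dx hdx a =>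
    ⟨fun i => mul_nonneg (by positivity) (coefSq_nonneg k a i), fun i x hx => ?_,
    fun i x hx y hy => ?_⟩⟩
  · rw [dgFun_of_mem hdx a hx]
    exact sq_cellSum_le _ fun p hp => (hB dx hdx i p hp).1 x (Ioo_subset_Icc_self hx)
  · rw [dgFun_of_mem hdx a hx, dgFun_of_mem hdx a hy]
    refine (sq_cellSum_sub_le _ fun p hp => (hB dx hdx i p hp).2 x (Ioo_subset_Icc_self hx) y
      (Ioo_subset_Icc_self hy)).trans ?_
    have h1 : |x - y| / dx ≤ 1 := by
      rw [div_le_one hdx, abs_le]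
      constructor <;> linarith [hx.1, hx.2, hy.1, hy.2]
    have h0 : 0 ≤ |x - y| / dx := by positivity
    have h2 : (|x - y| / dx) ^ 2 ≤ |x - y| / dx := by nlinarith
    have h3 := coefSq_nonneg k a i
    rw [coefSq] at h3 ⊢
    calc _ = B ^ 2 * (k + 1) * (∑ p ∈ Finset.range (k + 1), a p i ^ 2) * (|x - y| / dx) ^ 2 := by
          ring
      _ ≤ _ := by gcongr

lemma memLp_dgFun (hdx : 0 < dx) (ha : Summable (coefSq k a)) : MemLp (dgFun dx k a) 2 volume := by
  obtain ⟨B, -, hB⟩ := exists_isCellHolder_dgFun k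
  exact (hB dx hdx a).memLp hdx (ha.mul_left B) (aestronglyMeasurable_dgFun hdx k a)

lemma exists_fracEnergy_dgFun_le {lam : ℝ} (h0 : 0 < lam) (h1 : lam < 1) (hdx : 0 < dx) (k : ℕ) :
    ∃ K : ℝ, 0 ≤ K ∧ ∀ a : ℕ → ℤ → ℝ, Summable (coefSq k a) →
      fracEnergy lam (dgFun dx k a) ≤ ENNReal.ofReal (K * ∑' i, coefSq k a i) := by
  obtain ⟨B, hB0, hB⟩ := exists_isCellHolder_dgFun k
  obtain ⟨K, hK0, hK⟩ := exists_fracEnergy_le h0 h1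
  refine ⟨K * dx ^ (1 - lam) * B, by positivity, fun a ha => ?_⟩
  have := hK dx hdx _ _ (aestronglyMeasurable_dgFun hdx k a) (hB dx hdx a) (ha.mul_left B)
  rwa [tsum_mul_left, ← mul_assoc] at this

lemma hasFiniteEnergy_dgFun {lam : ℝ} (h0 : 0 < lam) (h1 : lam < 1) (hdx : 0 < dx)
    (ha : Summable (coefSq k a)) : HasFiniteEnergy lam (dgFun dx k a) := by
  obtain ⟨K, -, hK⟩ := exists_fracEnergy_dgFun_le h0 h1 hdx k
  exact hasFiniteEnergy_of_fracEnergy_lt_top (memLp_dgFun hdx ha)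
    ((hK a ha).trans_lt ENNReal.ofReal_lt_top)

lemma setIntegral_mul_dgFun (hdx : 0 < dx) (i : ℤ) (v : ℝ → ℝ) (a : ℕ → ℤ → ℝ) :
    ∫ x in cell dx i, v x * dgFun dx k a x =
      ∫ x in cell dx i, v x * cellSum dx k i (fun p => a p i) x := by
  refine setIntegral_congr_fun measurableSet_Ioo fun x hx => ?_
  simp only [dgFun_of_mem hdx a hx]

/-- The projection reproduces piecewise polynomials. -/
lemma legCoef_dgFun (hdx : 0 < dx) (a : ℕ → ℤ → ℝ) {p : ℕ} (hp : p ≤ k) (i : ℤ) :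
    legCoef dx (dgFun dx k a) p i = a p i := by
  rw [← legCoef_cellSum hdx i (fun p => a p i) hp]
  refine legCoef_congr ?_ p
  filter_upwards [ae_restrict_mem measurableSet_Ioo] with x hx
  exact dgFun_of_mem hdx a hx

/-- Parseval's formula for the inner product with a piecewise polynomial function. -/
lemma hasSum_integral_mul_dgFun (hdx : 0 < dx) (hv : MemLp v 2 volume)
    (ha : MemLp (dgFun dx k a) 2 volume) :
    HasSum (fun i => ∑ p ∈ Finset.range (k + 1), dx / (2 * p + 1) * (legCoef dx v p i * a p i))
      (∫ x, v x * dgFun dx k a x) := by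
  have h := hasSum_integral_cell hdx (integrable_mul_of_memLp_two hv ha)
  simp_rw [setIntegral_mul_dgFun hdx] at h
  simpa only [integral_mul_cellSum hdx (integrableOn_cell_of_memLp hv dx _)] using h

lemma coefSq_le (hdx : 0 < dx) (a : ℕ → ℤ → ℝ) (i : ℤ) : coefSq k a i ≤
    (2 * k + 1) / dx * ∑ p ∈ Finset.range (k + 1), dx / (2 * p + 1) * (a p i * a p i) := by
  rw [coefSq, Finset.mul_sum]
  refine Finset.sum_le_sum fun p hp => ?_
  have hp' : (p : ℝ) ≤ k := by
    have : p ≤ k := by simp at hp; omega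
    exact_mod_cast this
  have e : (2 * k + 1) / dx * (dx / (2 * p + 1) * (a p i * a p i)) =
      (2 * k + 1) / (2 * p + 1) * a p i ^ 2 := by
    field_simp
  rw [e]
  have : (1 : ℝ) ≤ (2 * k + 1) / (2 * p + 1) := by
    rw [le_div_iff₀ (by positivity)]
    linarith
  nlinarith [sq_nonneg (a p i)]

/-- Bessel's inequality on a cell. -/
lemma sum_legCoef_sq_le (hdx : 0 < dx) (hv : MemLp v 2 volume) (k : ℕ) (i : ℤ) :
    ∑ p ∈ Finset.range (k + 1), dx / (2 * p + 1) * (legCoef dx v p i * legCoef dx v p i) ≤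
      ∫ x in cell dx i, v x ^ 2 := by
  set s := cellSum dx k i fun p => legCoef dx v p i with hs
  have hcs : Continuous s := continuous_cellSum dx k i _
  have hi := integrableOn_cell_of_memLp hv dx i
  have h1 := integral_mul_cellSum hdx hi k fun p => legCoef dx v p i
  have h2 := integral_sub_cellSum_mul_cellSum hdx hi k fun p => legCoef dx v p i
  rw [← h1]
  have i1 : IntegrableOn (fun x => v x ^ 2) (cell dx i) := hv.integrable_sq.integrableOn
  have i2 : IntegrableOn (fun x => v x * s x) (cell dx i) := integrableOn_mul_continuous hi hcs
  have i3 : IntegrableOn (fun x => (v x - s x) * s x) (cell dx i) :=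
    integrableOn_mul_continuous (hi.sub (integrableOn_cell_of_continuous i hcs)) hcs
  have h3 : 0 ≤ ∫ x in cell dx i, (v x ^ 2 - v x * s x) - (v x - s x) * s x :=
    integral_nonneg fun x => by
      simp only [Pi.zero_apply]
      nlinarith [sq_nonneg (v x - s x)]
  have h4 : ∫ x in cell dx i, (v x ^ 2 - v x * s x) - (v x - s x) * s x =
      (∫ x in cell dx i, v x ^ 2) - (∫ x in cell dx i, v x * s x) -
        ∫ x in cell dx i, (v x - s x) * s x := by
    have i4 : IntegrableOn (fun x => v x ^ 2 - v x * s x) (cell dx i) := i1.sub i2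
    rw [integral_sub i4 i3, integral_sub i1 i2]
  rw [h4, h2] at h3
  linarith

lemma summable_coefSq_legCoef (hdx : 0 < dx) (hv : MemLp v 2 volume) (k : ℕ) :
    Summable (coefSq k (legCoef dx v)) := by
  refine Summable.of_nonneg_of_le (coefSq_nonneg k _) (fun i => ?_)
    ((hasSum_integral_cell hdx hv.integrable_sq).summable.mul_left ((2 * k + 1) / dx))
  exact (coefSq_le hdx _ i).trans
    (mul_le_mul_of_nonneg_left (sum_legCoef_sq_le hdx hv k i) (by positivity))

lemma summable_coefSq_congr (h : ∀ p ≤ k, ∀ i, a p i = b p i) (ha : Summable (coefSq k a)) :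
    Summable (coefSq k b) := by
  refine ha.congr fun i => Finset.sum_congr rfl fun p hp => ?_
  rw [h p (by simp at hp; omega)]

lemma summable_coefSq_of_memLp (hdx : 0 < dx) (ha : MemLp (dgFun dx k a) 2 volume) :
    Summable (coefSq k a) :=
  summable_coefSq_congr (fun _ hp i => legCoef_dgFun hdx a hp i)
    (summable_coefSq_legCoef hdx ha k)

lemma summable_coefSq_sub (ha : Summable (coefSq k a)) (hb : Summable (coefSq k b)) :
    Summable (coefSq k fun p i => a p i - b p i) := by
  refine Summable.of_nonneg_of_le (coefSq_nonneg k _) (fun i => ?_)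
    ((ha.mul_left 2).add (hb.mul_left 2))
  simp only [coefSq, Finset.mul_sum]
  rw [← Finset.sum_add_distrib]
  refine Finset.sum_le_sum fun p _ => ?_
  nlinarith [sq_nonneg (a p i + b p i)]

lemma integral_dgFun_sq_hasSum (hdx : 0 < dx) (ha : Summable (coefSq k a)) :
    HasSum (fun i => ∑ p ∈ Finset.range (k + 1), dx / (2 * p + 1) * (a p i * a p i))
      (∫ x, dgFun dx k a x ^ 2) := by
  have hm := memLp_dgFun hdx ha
  have h := hasSum_integral_mul_dgFun hdx hm hm
  simp_rw [sq]
  convert h using 2 with i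
  refine Finset.sum_congr rfl fun p hp => ?_
  rw [legCoef_dgFun hdx a (by simp at hp; omega)]

/-- The projection error is orthogonal to piecewise polynomials. -/
lemma integral_sub_dgFun_legCoef_mul (hdx : 0 < dx) (hv : MemLp v 2 volume)
    (ha : MemLp (dgFun dx k a) 2 volume) :
    ∫ x, (v x - dgFun dx k (legCoef dx v) x) * dgFun dx k a x = 0 := by
  have hp := memLp_dgFun hdx (summable_coefSq_legCoef hdx hv k)
  have h := hasSum_integral_mul_dgFun hdx (hv.sub hp) ha
  refine h.unique ?_
  convert hasSum_zero with i
  refine Finset.sum_eq_zero fun p hp' => ?_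
  have h1 := legCoef_sub (integrableOn_cell_of_memLp hv dx i) (integrableOn_cell_of_memLp hp dx i) p
  rw [legCoef_dgFun hdx _ (by simp at hp'; omega), sub_self] at h1
  erw [h1]
  simp

/-- Pythagoras' theorem for the projection. -/
lemma integral_sq_eq_add_projection (hdx : 0 < dx) (hv : MemLp v 2 volume) (k : ℕ) :
    ∫ x, v x ^ 2 = (∫ x, (v x - dgFun dx k (legCoef dx v) x) ^ 2) +
      ∫ x, dgFun dx k (legCoef dx v) x ^ 2 := by
  have hp := memLp_dgFun hdx (summable_coefSq_legCoef hdx hv k)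
  have h := integral_sub_dgFun_legCoef_mul hdx hv hp
  have hs := hv.sub hp
  have e : ∀ x, v x ^ 2 = (v x - dgFun dx k (legCoef dx v) x) ^ 2 +
      dgFun dx k (legCoef dx v) x ^ 2 +
      2 * ((v x - dgFun dx k (legCoef dx v) x) * dgFun dx k (legCoef dx v) x) := fun x => by ring
  have i1 : Integrable (fun x => (v x - dgFun dx k (legCoef dx v) x) ^ 2) volume := hs.integrable_sq
  have i3 : Integrable (fun x => (v x - dgFun dx k (legCoef dx v) x) *
      dgFun dx k (legCoef dx v) x) volume := integrable_mul_of_memLp_two hs hp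
  have i4 : Integrable (fun x => (v x - dgFun dx k (legCoef dx v) x) ^ 2 +
      dgFun dx k (legCoef dx v) x ^ 2) volume := i1.add hp.integrable_sq
  rw [integral_congr_ae (.of_forall e), integral_add i4 (i3.const_mul 2),
    integral_add i1 hp.integrable_sq, integral_const_mul, h, mul_zero, add_zero]

/-! ### Expansion of the bilinear form in the basis functions -/

open scoped Classical in
/-- The coefficients `a` on the cells with index in `s`. -/
def truncCoef (s : Set ℤ) (a : ℕ → ℤ → ℝ) (p : ℕ) (i : ℤ) : ℝ := if i ∈ s then a p i else 0

lemma coefSq_truncCoef (k : ℕ) (s : Set ℤ) (a : ℕ → ℤ → ℝ) :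
    coefSq k (truncCoef s a) = s.indicator (coefSq k a) := by
  funext i
  by_cases hi : i ∈ s <;> simp [coefSq, truncCoef, hi]

lemma summable_coefSq_truncCoef (s : Set ℤ) (ha : Summable (coefSq k a)) :
    Summable (coefSq k (truncCoef s a)) := by
  rw [coefSq_truncCoef]
  exact ha.indicator s

lemma dgFun_truncCoef_finset (s : Finset ℤ) (a : ℕ → ℤ → ℝ) :
    dgFun dx k (truncCoef s a) =
      fun x => ∑ i ∈ s, ∑ p ∈ Finset.range (k + 1), a p i * legendreCell dx p i x := by
  funext x
  rw [dgFun, tsum_eq_sum (s := s)]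
  · refine Finset.sum_congr rfl fun i hi => Finset.sum_congr rfl fun p _ => ?_
    simp [truncCoef, hi]
  · intro i hi
    refine Finset.sum_eq_zero fun p _ => ?_
    simp [truncCoef, hi]

lemma dgFun_truncCoef_add_compl (hdx : 0 < dx) (s : Set ℤ) (a : ℕ → ℤ → ℝ) :
    dgFun dx k a = fun x => dgFun dx k (truncCoef s a) x + dgFun dx k (truncCoef sᶜ a) x := by
  funext x
  rw [← dgFun_add hdx]
  refine congrFun (dgFun_congr fun p _ i => ?_) x
  by_cases hi : i ∈ s <;> simp [truncCoef, hi]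

lemma hasFiniteEnergy_legendreCell {lam : ℝ} (h0 : 0 < lam) (h1 : lam < 1) (hdx : 0 < dx)
    (p : ℕ) (i : ℤ) : HasFiniteEnergy lam (legendreCell dx p i) := by
  set a : ℕ → ℤ → ℝ := truncCoef (({i} : Finset ℤ) : Set ℤ) (fun q _ => if q = p then 1 else 0)
    with ha
  have hs : Summable (coefSq p a) := by
    rw [ha, coefSq_truncCoef]
    refine summable_of_ne_finset_zero (s := {i}) fun j hj => ?_
    exact indicator_of_notMem (by simpa using hj) _
  have h := hasFiniteEnergy_dgFun h0 h1 hdx hs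
  rw [ha, dgFun_truncCoef_finset] at h
  refine h.congr (.of_forall fun x => ?_)
  simp

/-- The form `v ↦ ⟨g[v], w⟩` is continuous along the expansion of a piecewise polynomial `w` in the
basis functions. -/
lemma hasSum_pairingG_dgFun {lam : ℝ} (h0 : 0 < lam) (h1 : lam < 1) (hdx : 0 < dx)
    (hv : HasFiniteEnergy lam v) (ha : Summable (coefSq k a)) :
    HasSum (fun i => ∑ p ∈ Finset.range (k + 1), a p i * pairingG lam v (legendreCell dx p i))
      (pairingG lam v (dgFun dx k a)) := by
  obtain ⟨K, hK0, hK⟩ := exists_fracEnergy_dgFun_le h0 h1 hdx k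
  have hfin : ∀ s : Finset ℤ, ∑ i ∈ s, ∑ p ∈ Finset.range (k + 1),
      a p i * pairingG lam v (legendreCell dx p i) =
      pairingG lam v (dgFun dx k a) - pairingG lam v (dgFun dx k (truncCoef (s : Set ℤ)ᶜ a)) := by
    intro s
    have e1 : pairingG lam v (dgFun dx k (truncCoef (s : Set ℤ) a)) =
        ∑ i ∈ s, ∑ p ∈ Finset.range (k + 1), a p i * pairingG lam v (legendreCell dx p i) := by
      have hf := fun i p => (hasFiniteEnergy_legendreCell h0 h1 hdx p i).const_mul (a p i)
      rw [dgFun_truncCoef_finset, pairingG_sum_right s hv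
        fun i _ => HasFiniteEnergy.finset_sum _ fun p _ => hf i p]
      refine Finset.sum_congr rfl fun i _ => ?_
      rw [pairingG_sum_right _ hv fun p _ => hf i p]
      refine Finset.sum_congr rfl fun p _ => ?_
      rw [pairingG_comm, pairingG_const_mul_left (hasFiniteEnergy_legendreCell h0 h1 hdx p i),
        pairingG_comm]
    have e2 := pairingG_add_left
      (hasFiniteEnergy_dgFun h0 h1 hdx (summable_coefSq_truncCoef (s : Set ℤ) ha))
      (hasFiniteEnergy_dgFun h0 h1 hdx (summable_coefSq_truncCoef (s : Set ℤ)ᶜ ha)) hv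
    rw [← dgFun_truncCoef_add_compl hdx] at e2
    rw [← e1, pairingG_comm lam v, pairingG_comm lam v, pairingG_comm lam v, e2]
    ring
  rw [HasSum]
  simp_rw [hfin]
  have hz : Tendsto (fun s : Finset ℤ => pairingG lam v (dgFun dx k (truncCoef (s : Set ℤ)ᶜ a)))
      atTop (𝓝 0) := by
    have hb : ∀ s : Finset ℤ, |pairingG lam v (dgFun dx k (truncCoef (s : Set ℤ)ᶜ a))| ≤
        √(-pairingG lam v v * (K * ∑' i : { i // i ∉ s }, coefSq k a i)) := by
      intro s
      have hs := summable_coefSq_truncCoef (s : Set ℤ)ᶜ ha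
      have hd := hasFiniteEnergy_dgFun h0 h1 hdx hs
      have e1 := neg_pairingG_self hd
      have e2 : ∑' i, coefSq k (truncCoef (s : Set ℤ)ᶜ a) i =
          ∑' i : { i // i ∉ s }, coefSq k a i := by
        rw [coefSq_truncCoef, ← tsum_subtype]
        rfl
      have h3 := hK _ hs
      rw [e2] at h3
      have h4 : - pairingG lam (dgFun dx k (truncCoef (s : Set ℤ)ᶜ a))
          (dgFun dx k (truncCoef (s : Set ℤ)ᶜ a)) ≤ K * ∑' i : { i // i ∉ s }, coefSq k a i := by
        rw [e1]
        exact ENNReal.toReal_le_of_le_ofReal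
          (mul_nonneg hK0 (tsum_nonneg fun i => coefSq_nonneg k a i)) h3
      refine Real.abs_le_sqrt ((sq_pairingG_le hv hd).trans ?_)
      nlinarith [pairingG_self_nonpos lam v]
    have hlim : Tendsto (fun s : Finset ℤ =>
        √(-pairingG lam v v * (K * ∑' i : { i // i ∉ s }, coefSq k a i))) atTop (𝓝 0) := by
      have := ((tendsto_tsum_compl_atTop_zero (coefSq k a)).const_mul K).const_mul
        (-pairingG lam v v)
      simpa using this.sqrt
    exact squeeze_zero_norm hb hlim
  simpa using tendsto_const_nhds.sub hz

end DG

/-! ### Polynomial approximation on a cell -/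

lemma exists_derivative_eq (q : Polynomial ℝ) :
    ∃ Q : Polynomial ℝ, Q.derivative = q ∧ Q.natDegree ≤ q.natDegree + 1 := by
  refine ⟨∑ j ∈ Finset.range (q.natDegree + 1),
    Polynomial.C (q.coeff j / (j + 1)) * Polynomial.X ^ (j + 1), ?_, ?_⟩
  · rw [Polynomial.derivative_sum]
    conv_rhs => rw [q.as_sum_range_C_mul_X_pow]
    refine Finset.sum_congr rfl fun j _ => ?_
    rw [Polynomial.derivative_C_mul_X_pow]
    congr 2
    push_cast
    field_simp
  · refine Polynomial.natDegree_sum_le_of_forall_le _ _ fun j hj => ?_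
    refine (Polynomial.natDegree_C_mul_X_pow_le _ _).trans ?_
    simp at hj
    omega

/-- The Cauchy-Schwarz inequality: a primitive of an `L²` function is Hölder continuous with
exponent `1/2`. -/
lemma sq_intervalIntegral_le {f : ℝ → ℝ} (hf : MemLp f 2 volume) {a b x y : ℝ} (hxy : x ≤ y)
    (hx : a ≤ x) (hy : y ≤ b) :
    (∫ s in x..y, f s) ^ 2 ≤ (y - x) * ∫ s in Ioo a b, f s ^ 2 := by
  have h1 : MemLp (fun _ : ℝ => (1 : ℝ)) 2 (volume.restrict (Ioc x y)) := memLp_const 1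
  have h := sq_integral_mul_le (hf.mono_measure Measure.restrict_le_self) h1
  simp only [mul_one, one_pow] at h
  rw [intervalIntegral.integral_of_le hxy]
  refine h.trans ?_
  rw [integral_const, measureReal_restrict_apply_univ, Real.volume_real_Ioc_of_le hxy, smul_eq_mul,
    mul_one, mul_comm]
  refine mul_le_mul_of_nonneg_left ?_ (by linarith)
  rw [← integral_Icc_eq_integral_Ioo]
  exact setIntegral_mono_set hf.integrable_sq.integrableOn
    (.of_forall fun s => sq_nonneg _)
    (Ioc_subset_Icc_self.trans (Icc_subset_Icc hx hy)).eventuallyLE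

lemma IsDerivChain.shift {n : ℕ} {W : ℕ → ℝ → ℝ} (h : IsDerivChain (n + 1) W) :
    IsDerivChain n (fun j => W (j + 1)) :=
  ⟨fun j hj => h.memLp (j + 1) (by omega), fun j hj => h.sub_eq (j + 1) (by omega)⟩

/-- Taylor polynomials: the error in the supremum norm and in the Hölder seminorm, in terms of the
`L²` norm of the derivative of order `n + 1`. -/
lemma IsDerivChain.exists_polynomial {α h : ℝ} (hh : 0 < h) (n : ℕ) {W : ℕ → ℝ → ℝ}
    (hW : IsDerivChain (n + 1) W) : ∃ q : Polynomial ℝ, q.natDegree ≤ n ∧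
      (∀ x ∈ Icc α (α + h), (W 0 x - q.eval x) ^ 2 ≤
        h ^ (2 * n + 1) * ∫ s in Ioo α (α + h), W (n + 1) s ^ 2) ∧
      ∀ x ∈ Icc α (α + h), ∀ y ∈ Icc α (α + h),
        ((W 0 x - q.eval x) - (W 0 y - q.eval y)) ^ 2 ≤
          |x - y| / h * (h ^ (2 * n + 1) * ∫ s in Ioo α (α + h), W (n + 1) s ^ 2) := by
  -- The first bound follows from the second for an error which vanishes at `α`.
  have key : ∀ (f : ℝ → ℝ) (M : ℝ), 0 ≤ M → f α = 0 →
      (∀ x ∈ Icc α (α + h), ∀ y ∈ Icc α (α + h), y ≤ x → (f x - f y) ^ 2 ≤ |x - y| / h * M) →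
      (∀ x ∈ Icc α (α + h), f x ^ 2 ≤ M) ∧
      ∀ x ∈ Icc α (α + h), ∀ y ∈ Icc α (α + h), (f x - f y) ^ 2 ≤ |x - y| / h * M := by
    intro f M hM hf H
    have H' : ∀ x ∈ Icc α (α + h), ∀ y ∈ Icc α (α + h), (f x - f y) ^ 2 ≤ |x - y| / h * M := by
      intro x hx y hy
      rcases le_total y x with hyx | hyx
      · exact H x hx y hy hyx
      · have := H y hy x hx hyx
        rw [abs_sub_comm]
        nlinarith
    refine ⟨fun x hx => ?_, H'⟩
    have h1 := H' x hx α ⟨le_rfl, by linarith⟩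
    rw [hf, sub_zero] at h1
    refine h1.trans (mul_le_of_le_one_left hM ?_)
    rw [div_le_one hh, abs_of_nonneg (by linarith [hx.1])]
    linarith [hx.2]
  have hV : ∀ (m : ℕ) (f : ℝ → ℝ), 0 ≤ h ^ m * ∫ s in Ioo α (α + h), f s ^ 2 := fun m f =>
    mul_nonneg (by positivity) (integral_nonneg fun s => sq_nonneg _)
  induction n generalizing W with
  | zero =>
    refine ⟨Polynomial.C (W 0 α), by simp,
      key (fun x => W 0 x - (Polynomial.C (W 0 α)).eval x) _ (hV _ _) (by simp)
        fun x hx y hy hyx => ?_⟩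
    have h1 := sq_intervalIntegral_le (hW.memLp 1 (by omega)) hyx hy.1 hx.2
    rw [← hW.sub_eq 0 (by omega) y x] at h1
    simp only [Polynomial.eval_C, abs_of_nonneg (sub_nonneg.2 hyx)]
    refine le_of_eq_of_le (by ring) (h1.trans (le_of_eq ?_))
    field_simp
    ring
  | succ n ih =>
    obtain ⟨q', hq'd, hq', -⟩ := ih hW.shift
    obtain ⟨Q, hQ, hQd⟩ := exists_derivative_eq q'
    refine ⟨Q + Polynomial.C (W 0 α - Q.eval α), ?_,
      key (fun x => W 0 x - (Q + Polynomial.C (W 0 α - Q.eval α)).eval x) _ (hV _ _) (by simp)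
      fun x hx y hy hyx => ?_⟩
    · rw [Polynomial.natDegree_add_C]
      omega
    · have h1 : Q.eval x - Q.eval y = ∫ s in y..x, q'.eval s := by
        rw [← integral_eval_derivative, hQ]
      have h2 := hW.sub_eq 0 (by omega) y x
      set M := h ^ (2 * n + 1) * ∫ s in Ioo α (α + h), W (n + 1 + 1) s ^ 2 with hM
      have hM0 : 0 ≤ M := hV _ _
      have h3 : |∫ s in y..x, (W (0 + 1) s - q'.eval s)| ≤ √M * |x - y| := by
        rw [← Real.norm_eq_abs]
        refine intervalIntegral.norm_integral_le_of_norm_le_const fun s hs => ?_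
        rw [uIoc_of_le hyx] at hs
        exact Real.abs_le_sqrt (hq' s ⟨hy.1.trans hs.1.le, hs.2.trans hx.2⟩)
      rw [intervalIntegral.integral_sub (intervalIntegrable_of_memLp_two
        (hW.memLp (0 + 1) (by omega)) y x) (q'.continuous.intervalIntegrable _ _), ← h1, ← h2] at h3
      have h4 := pow_le_pow_left₀ (abs_nonneg _) h3 2
      rw [sq_abs, mul_pow, Real.sq_sqrt hM0] at h4
      have h5 : |x - y| ≤ h := by
        rw [abs_of_nonneg (sub_nonneg.2 hyx)]
        linarith [hx.2, hy.1]
      simp only [Polynomial.eval_add, Polynomial.eval_C]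
      calc _ = (W 0 x - W 0 y - (Q.eval x - Q.eval y)) ^ 2 := by ring
        _ ≤ M * |x - y| ^ 2 := h4
        _ ≤ M * (|x - y| * h) := by
          rw [sq]
          gcongr
        _ = _ := by
          rw [hM]
          field_simp
          ring

/-- The error of the `L²` projection on a cell, in the supremum norm and in the Hölder seminorm. -/
lemma exists_projection_error_le (k : ℕ) : ∃ C : ℝ, 0 < C ∧ ∀ dx : ℝ, 0 < dx → ∀ n ≤ k,
    ∀ W : ℕ → ℝ → ℝ, IsDerivChain (n + 1) W → ∀ i : ℤ,
      (∀ x ∈ Icc (i * dx) ((i + 1) * dx),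
        (W 0 x - cellSum dx k i (fun p => legCoef dx (W 0) p i) x) ^ 2 ≤
          C * dx ^ (2 * n + 1) * ∫ s in cell dx i, W (n + 1) s ^ 2) ∧
      ∀ x ∈ Icc (i * dx) ((i + 1) * dx), ∀ y ∈ Icc (i * dx) ((i + 1) * dx),
        ((W 0 x - cellSum dx k i (fun p => legCoef dx (W 0) p i) x) -
          (W 0 y - cellSum dx k i (fun p => legCoef dx (W 0) p i) y)) ^ 2 ≤
          C * dx ^ (2 * n + 1) * (∫ s in cell dx i, W (n + 1) s ^ 2) * (|x - y| / dx) := by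
  obtain ⟨B, hB1, hB⟩ := exists_bound_cellLegendre k
  set L : ℝ := B ^ 2 * (k + 1) * ((k + 1) * ((2 * k + 1) * B) ^ 2) with hL
  have hL0 : 0 ≤ L := by positivity
  refine ⟨2 + 2 * L, by positivity, fun dx hdx n hn W hW i => ?_⟩
  obtain ⟨q, hqd, hq1, hq2⟩ := hW.exists_polynomial (α := i * dx) hdx n
  rw [show (i : ℝ) * dx + dx = (i + 1) * dx by ring] at hq1 hq2
  obtain ⟨a, ha⟩ := exists_cellSum_eq hdx k i q (hqd.trans hn)
  set V := ∫ s in cell dx i, W (n + 1) s ^ 2 with hV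
  rw [show Ioo (i * dx) ((i + 1) * dx) = cell dx i from rfl, ← hV] at hq1 hq2
  set A := dx ^ (2 * n + 1) * V with hA
  have hA0 : 0 ≤ A := mul_nonneg (by positivity) (integral_nonneg fun s => sq_nonneg _)
  set z : ℝ → ℝ := fun x => W 0 x - cellSum dx k i a x with hz
  simp_rw [← ha] at hq1 hq2
  have hWi := integrableOn_cell_of_memLp (hW.memLp 0 (by omega)) dx i
  have hci := integrableOn_cell_of_continuous (dx := dx) i (continuous_cellSum dx k i a)
  set b : ℕ → ℝ := fun p => legCoef dx z p i with hb
  have hcoef : ∀ p ≤ k, legCoef dx (W 0) p i = a p + b p := by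
    intro p hp
    rw [hb]
    simp only
    rw [hz, legCoef_sub hWi hci, legCoef_cellSum hdx i a hp]
    ring
  have herr : ∀ x, W 0 x - cellSum dx k i (fun p => legCoef dx (W 0) p i) x =
      z x - cellSum dx k i b x := by
    intro x
    have : cellSum dx k i (fun p => legCoef dx (W 0) p i) x =
        cellSum dx k i a x + cellSum dx k i b x := by
      simp only [cellSum]
      rw [← Finset.sum_add_distrib]
      refine Finset.sum_congr rfl fun p hp => ?_
      rw [hcoef p (by simp at hp; omega)]
      ring
    rw [this, hz]
    ring
  have hbp : ∀ p ≤ k, b p ^ 2 ≤ ((2 * k + 1) * B) ^ 2 * A := by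
    intro p hp
    have h1 : |∫ x in cell dx i, z x * cellLegendre dx i p x| ≤ √A * B * dx := by
      have := norm_setIntegral_le_of_norm_le_const (μ := volume) (s := cell dx i)
        (f := fun x => z x * cellLegendre dx i p x) (C := √A * B)
        (by rw [volume_cell]; exact ENNReal.ofReal_lt_top) fun x hx => by
          rw [norm_mul]
          exact mul_le_mul (Real.abs_le_sqrt (hq1 x (Ioo_subset_Icc_self hx)))
            ((hB dx hdx i p hp).1 x (Ioo_subset_Icc_self hx)) (norm_nonneg _) (Real.sqrt_nonneg _)
      rwa [Measure.real, volume_cell, ENNReal.toReal_ofReal hdx.le] at this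
    have h2 : |b p| ≤ (2 * k + 1) * B * √A := by
      rw [hb]
      simp only [legCoef]
      rw [abs_mul, abs_of_nonneg (by positivity)]
      have hpk : (p : ℝ) ≤ k := by exact_mod_cast hp
      calc _ ≤ (2 * k + 1) / dx * (√A * B * dx) := by gcongr
        _ = _ := by field_simp
    have h3 := pow_le_pow_left₀ (abs_nonneg _) h2 2
    rwa [sq_abs, mul_pow, Real.sq_sqrt hA0] at h3
  have hsum : ∑ p ∈ Finset.range (k + 1), b p ^ 2 ≤ (k + 1) * (((2 * k + 1) * B) ^ 2 * A) := by
    refine (Finset.sum_le_card_nsmul _ _ _ fun p hp => hbp p (by simp at hp; omega)).trans ?_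
    simp
  have hLA : B ^ 2 * (k + 1) * ∑ p ∈ Finset.range (k + 1), b p ^ 2 ≤ L * A := by
    calc _ ≤ B ^ 2 * (k + 1) * ((k + 1) * (((2 * k + 1) * B) ^ 2 * A)) := by gcongr
      _ = _ := by rw [hL]; ring
  have hCA : (2 + 2 * L) * dx ^ (2 * n + 1) * V = 2 * A + 2 * (L * A) := by
    rw [hA]
    ring
  refine ⟨fun x hx => ?_, fun x hx y hy => ?_⟩
  · rw [herr, hCA]
    have h1 := (sq_cellSum_le b fun p hp => (hB dx hdx i p hp).1 x hx).trans hLA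
    have h2 := hq1 x hx
    nlinarith [sq_nonneg (z x + cellSum dx k i b x)]
  · rw [herr, herr, hCA]
    set r := |x - y| / dx with hr
    have hr1 : r ≤ 1 := by
      rw [hr, div_le_one hdx, abs_le]
      constructor <;> linarith [hx.1, hx.2, hy.1, hy.2]
    have hr0 : 0 ≤ r := by positivity
    have h1 := sq_cellSum_sub_le b fun p hp => (hB dx hdx i p hp).2 x hx y hy
    have h2 := hq2 x hx y hy
    have h3 : (cellSum dx k i b x - cellSum dx k i b y) ^ 2 ≤ r * (L * A) := by
      refine h1.trans ?_
      rw [← hr]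
      calc _ = (B ^ 2 * (k + 1) * ∑ p ∈ Finset.range (k + 1), b p ^ 2) * (r * r) := by ring
        _ ≤ (L * A) * (r * 1) := by gcongr
        _ = _ := by ring
    nlinarith [sq_nonneg ((z x - z y) + (cellSum dx k i b x - cellSum dx k i b y))]

/-! ### The upwind flux -/

lemma summable_mul_of_sq {ι : Type*} {f g : ι → ℝ} (hf : Summable fun i => f i ^ 2)
    (hg : Summable fun i => g i ^ 2) : Summable fun i => f i * g i := by
  refine Summable.of_norm_bounded (hf.add hg) fun i => ?_
  rw [Real.norm_eq_abs, abs_le]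
  constructor <;> nlinarith [sq_nonneg (f i + g i), sq_nonneg (f i - g i)]

/-- The jump `b - a` of the discrete error is absorbed by the dissipation of the upwind flux. The
flux of the projection error involves only one of the traces `r`, `s`, depending on the sign of
`c`. -/
lemma upwindFlux_mul_le (c a b r s : ℝ) :
    c / 2 * (a ^ 2 - b ^ 2) + (b - a) * (upwindFlux c a b - upwindFlux c r s) ≤
      |c| / 2 * (r ^ 2 + s ^ 2) := by
  rw [upwindFlux, upwindFlux]
  rcases abs_cases c with ⟨h, hc⟩ | ⟨h, hc⟩ <;> rw [h]
  · nlinarith [mul_nonneg hc (sq_nonneg (b - a + r)), mul_nonneg hc (sq_nonneg s)]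
  · nlinarith [mul_nonneg (neg_nonneg.2 hc.le) (sq_nonneg (b - a - s)),
      mul_nonneg (neg_nonneg.2 hc.le) (sq_nonneg r)]

/-- Dissipativity of the upwind flux: `a i`, `b i` are the left and right traces at the grid point
`x_i` of the discrete error, and `r i`, `s i` those of the projection error. -/
lemma exists_hasSum_flux_le (c : ℝ) {a b r s : ℤ → ℝ} (ha : Summable fun i => a i ^ 2)
    (hb : Summable fun i => b i ^ 2) (hr : Summable fun i => r i ^ 2)
    (hs : Summable fun i => s i ^ 2) :
    ∃ R : ℝ, HasSum (fun i => c / 2 * (a (i + 1) ^ 2 - b i ^ 2) +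
        b i * (upwindFlux c (a i) (b i) - upwindFlux c (r i) (s i)) -
        a (i + 1) * (upwindFlux c (a (i + 1)) (b (i + 1)) -
          upwindFlux c (r (i + 1)) (s (i + 1)))) R ∧
      R ≤ |c| / 2 * ((∑' i, r i ^ 2) + ∑' i, s i ^ 2) := by
  set G : ℤ → ℝ := fun i => upwindFlux c (a i) (b i) - upwindFlux c (r i) (s i) with hG
  have hmul : ∀ f : ℤ → ℝ, Summable (fun i => f i ^ 2) → Summable fun i => f i * G i := by
    intro f hf
    refine (((((summable_mul_of_sq hf ha).mul_left ((c + |c|) / 2)).add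
      ((summable_mul_of_sq hf hb).mul_left ((c - |c|) / 2))).sub
      ((summable_mul_of_sq hf hr).mul_left ((c + |c|) / 2))).sub
      ((summable_mul_of_sq hf hs).mul_left ((c - |c|) / 2))).congr fun i => ?_
    simp only [hG, upwindFlux]
    ring
  have h1 : Summable fun i => c / 2 * a i ^ 2 - a i * G i := (ha.mul_left _).sub (hmul a ha)
  have h2 : Summable fun i => b i * G i - c / 2 * b i ^ 2 := (hmul b hb).sub (hb.mul_left _)
  have h1' := ((Equiv.addRight (1 : ℤ)).hasSum_iff).2 h1.hasSum
  refine ⟨_, (h1'.add h2.hasSum).congr_fun ?_, ?_⟩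
  · intro i
    simp only [Function.comp, Equiv.coe_addRight, hG]
    ring
  · rw [← h1.tsum_add h2, ← hr.tsum_add hs, ← tsum_mul_left]
    refine (h1.add h2).tsum_le_tsum (fun i => ?_) ((hr.add hs).mul_left _)
    have := upwindFlux_mul_le c (a i) (b i) (r i) (s i)
    simp only [hG]
    linarith

/-! ### The error equation on a cell -/

section
variable {dx : ℝ} {k : ℕ}

lemma continuous_deriv_cellLegendre (dx : ℝ) (i : ℤ) (q : ℕ) :
    Continuous (deriv (cellLegendre dx i q)) := by
  obtain ⟨a, ha⟩ := exists_cellSum_eq_deriv dx q i le_rfl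
  rw [show deriv (cellLegendre dx i q) = cellSum dx q i a from funext ha]
  exact continuous_cellSum dx q i a

lemma hasDerivAt_deriv_cellLegendre (dx : ℝ) (i : ℤ) (q : ℕ) (x : ℝ) :
    HasDerivAt (cellLegendre dx i q) (deriv (cellLegendre dx i q) x) x :=
  (hasDerivAt_cellLegendre dx i q x).differentiableAt.hasDerivAt

/-- The transport term of the method only sees the traces of the discrete error. -/
lemma sum_mul_integral_cellSum_mul_deriv (hdx : 0 < dx) (k : ℕ) (i : ℤ) (a : ℕ → ℝ) :
    ∑ q ∈ Finset.range (k + 1),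
      a q * ∫ x in cell dx i, cellSum dx k i a x * deriv (cellLegendre dx i q) x =
      ((∑ q ∈ Finset.range (k + 1), a q) ^ 2 -
        (∑ q ∈ Finset.range (k + 1), a q * (-1) ^ q) ^ 2) / 2 := by
  set D : ℝ → ℝ := fun x => ∑ q ∈ Finset.range (k + 1), a q * deriv (cellLegendre dx i q) x with hD
  have hDc : Continuous D :=
    continuous_finsetSum _ fun q _ => continuous_const.mul (continuous_deriv_cellLegendre dx i q)
  have hder : ∀ x, HasDerivAt (cellSum dx k i a) (D x) x := by
    intro x
    have := HasDerivAt.fun_sum (u := Finset.range (k + 1)) fun q _ =>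
      (hasDerivAt_deriv_cellLegendre dx i q x).const_mul (a q)
    exact this
  have hs : Continuous (cellSum dx k i a) := continuous_cellSum dx k i a
  have h1 : ∫ x in (i * dx)..((i + 1) * dx), cellSum dx k i a x * D x =
      cellSum dx k i a ((i + 1) * dx) ^ 2 / 2 - cellSum dx k i a (i * dx) ^ 2 / 2 := by
    refine intervalIntegral.integral_eq_sub_of_hasDerivAt
      (f := fun x => cellSum dx k i a x ^ 2 / 2) (fun x _ => ?_)
      ((hs.mul hDc).intervalIntegrable _ _)
    have h := ((hder x).pow 2).div_const 2
    have e : cellSum dx k i a x * D x = ((2 : ℕ) : ℝ) * cellSum dx k i a x ^ (2 - 1) * D x / 2 := by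
      push_cast
      ring
    rw [e]
    exact h
  rw [cellSum_right, cellSum_left hdx, ← setIntegral_cell hdx] at h1
  rw [sub_div, ← h1]
  have h2 : ∀ x, cellSum dx k i a x * D x = ∑ q ∈ Finset.range (k + 1),
      a q * (cellSum dx k i a x * deriv (cellLegendre dx i q) x) := by
    intro x
    rw [hD, Finset.mul_sum]
    exact Finset.sum_congr rfl fun q _ => by ring
  simp_rw [h2]
  have hint : ∀ q ∈ Finset.range (k + 1), Integrable (fun x => a q * (cellSum dx k i a x *
      deriv (cellLegendre dx i q) x)) (volume.restrict (cell dx i)) := fun q _ =>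
    integrableOn_cell_of_continuous i
      (continuous_const.mul (hs.mul (continuous_deriv_cellLegendre dx i q)))
  rw [integral_finsetSum _ hint]
  exact Finset.sum_congr rfl fun q _ => (integral_const_mul _ _).symm

/-- Integration by parts on a cell. -/
lemma IsDerivChain.integral_mul_cellLegendre {n : ℕ} {W : ℕ → ℝ → ℝ} (hW : IsDerivChain (n + 1) W)
    (hdx : 0 < dx) (i : ℤ) (q : ℕ) :
    ∫ x in cell dx i, W 1 x * cellLegendre dx i q x =
      W 0 ((i + 1) * dx) - (-1) ^ q * W 0 (i * dx) -
        ∫ x in cell dx i, W 0 x * deriv (cellLegendre dx i q) x := by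
  have h := integral_mul_eq_sub_of_primitive (a := i * dx) (b := (i + 1) * dx)
    (f := cellLegendre dx i q) (g := W 0) (f' := deriv (cellLegendre dx i q)) (g' := W 1)
    ((continuous_deriv_cellLegendre dx i q).intervalIntegrable _ _)
    (intervalIntegrable_of_memLp_two (hW.memLp 1 (by omega)) _ _)
    (fun x _ => by
      rw [intervalIntegral.integral_eq_sub_of_hasDerivAt
        (fun y _ => hasDerivAt_deriv_cellLegendre dx i q y)
        ((continuous_deriv_cellLegendre dx i q).intervalIntegrable _ _)]
      ring)
    (fun x _ => by
      have := hW.sub_eq 0 (by omega) (i * dx) x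
      simp only [zero_add] at this
      linarith)
  rw [cellLegendre_right, cellLegendre_left hdx, ← setIntegral_cell hdx, ← setIntegral_cell hdx,
    one_mul] at h
  simp_rw [mul_comm (W 1 _), mul_comm (W 0 _) (deriv _ _)]
  exact h

/-- The coefficients of the derivative of the semidiscrete solution and of the projection of the
time derivative of the exact solution differ by the method applied to the error. -/
lemma error_equation {lam c : ℝ} (h0 : 0 < lam) (h1 : lam < 1) (hdx : 0 < dx) {n : ℕ}
    {W : ℕ → ℝ → ℝ} (hW : IsDerivChain (n + 1) W) {z : ℝ → ℝ} (hz : MemLp z 2 volume)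
    (hfrac : IsFracLaplacian lam (W 0) (fun x => z x + c * W 1 x)) {a : ℕ → ℤ → ℝ}
    (ha : Summable (coefSq k a)) {q : ℕ} (hq : q ≤ k) {i : ℤ} {d f g : ℝ}
    (hd : dx / (2 * q + 1) * d =
      (∫ x in cell dx i, c * dgFun dx k a x * deriv (legendreCell dx q i) x) + (-1) ^ q * f - g +
        pairingG lam (dgFun dx k a) (legendreCell dx q i)) :
    dx / (2 * q + 1) * (d - legCoef dx z q i) =
      c * (∫ x in cell dx i, cellSum dx k i (fun p => a p i - legCoef dx (W 0) p i) x *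
        deriv (cellLegendre dx i q) x) +
      (-1) ^ q * (f - c * W 0 (i * dx)) - (g - c * W 0 ((i + 1) * dx)) +
      pairingG lam (fun x => dgFun dx k a x - W 0 x) (legendreCell dx q i) := by
  have hφ := hasFiniteEnergy_legendreCell h0 h1 hdx q i
  have hW0 := hW.memLp 0 (by omega)
  have hW1 := hW.memLp 1 (by omega)
  have e1 := hfrac.integral_mul (memLp_legendreCell dx q i)
  have e2 : ∫ x, (z x + c * W 1 x) * legendreCell dx q i x =
      (∫ x in cell dx i, z x * cellLegendre dx i q x) +
        c * ∫ x in cell dx i, W 1 x * cellLegendre dx i q x := by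
    rw [integral_mul_legendreCell, ← integral_const_mul, ← integral_add]
    · congr 1
      funext x
      ring
    · exact integrableOn_mul_continuous (integrableOn_cell_of_memLp hz dx i)
        (continuous_cellLegendre dx i q)
    · exact (integrableOn_mul_continuous (integrableOn_cell_of_memLp hW1 dx i)
        (continuous_cellLegendre dx i q)).const_mul c
  have e3 : dx / (2 * q + 1) * legCoef dx z q i =
      ∫ x in cell dx i, z x * cellLegendre dx i q x := by
    rw [legCoef]
    have : (2 * q + 1 : ℝ) ≠ 0 := by positivity
    field_simp
  have e4 : ∫ x in cell dx i, c * dgFun dx k a x * deriv (legendreCell dx q i) x =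
      c * ∫ x in cell dx i, cellSum dx k i (fun p => a p i) x * deriv (cellLegendre dx i q) x := by
    rw [← integral_const_mul]
    refine setIntegral_congr_fun (measurableSet_cell dx i) fun x hx => ?_
    simp only [dgFun_of_mem hdx a hx, deriv_legendreCell q i hx]
    ring
  have e5 : ∫ x in cell dx i, cellSum dx k i (fun p => a p i - legCoef dx (W 0) p i) x *
        deriv (cellLegendre dx i q) x =
      (∫ x in cell dx i, cellSum dx k i (fun p => a p i) x * deriv (cellLegendre dx i q) x) -
        ∫ x in cell dx i, W 0 x * deriv (cellLegendre dx i q) x := by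
    obtain ⟨b, hb⟩ := exists_cellSum_eq_deriv dx k i hq
    have horth := integral_sub_cellSum_mul_cellSum hdx (integrableOn_cell_of_memLp hW0 dx i) k b
    simp_rw [hb]
    have i1 : IntegrableOn (fun x => cellSum dx k i (fun p => a p i - legCoef dx (W 0) p i) x *
        cellSum dx k i b x) (cell dx i) := integrableOn_cell_of_continuous i
      ((continuous_cellSum _ _ _ _).mul (continuous_cellSum _ _ _ _))
    have i2 : IntegrableOn (fun x => (W 0 x - cellSum dx k i (fun p => legCoef dx (W 0) p i) x) *
        cellSum dx k i b x) (cell dx i) := integrableOn_mul_continuous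
      ((integrableOn_cell_of_memLp hW0 dx i).sub
        (integrableOn_cell_of_continuous i (continuous_cellSum _ _ _ _)))
      (continuous_cellSum _ _ _ _)
    have i3 : IntegrableOn (fun x => cellSum dx k i (fun p => a p i) x * cellSum dx k i b x)
        (cell dx i) := integrableOn_cell_of_continuous i
      ((continuous_cellSum _ _ _ _).mul (continuous_cellSum _ _ _ _))
    have i4 : IntegrableOn (fun x => W 0 x * cellSum dx k i b x) (cell dx i) :=
      integrableOn_mul_continuous (integrableOn_cell_of_memLp hW0 dx i) (continuous_cellSum _ _ _ _)
    rw [← sub_zero (∫ x in cell dx i, cellSum dx k i (fun p => a p i - legCoef dx (W 0) p i) x *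
      cellSum dx k i b x), ← horth, ← integral_sub i1 i2, ← integral_sub i3 i4]
    congr 1
    funext x
    simp only [cellSum, sub_mul, Finset.sum_sub_distrib]
    ring
  have e6 := hW.integral_mul_cellLegendre hdx i q
  have e7 := pairingG_sub_left (z := legendreCell dx q i) (hasFiniteEnergy_dgFun h0 h1 hdx ha)
    hfrac.hasFiniteEnergy hφ
  rw [e2, e6] at e1
  rw [mul_sub, hd, e3, e4, e5, e7, ← e1]
  ring

/-- The rate of change of the squared discrete error is bounded by the approximation error of the
exact solution: the dissipation of the flux and of the fractional Laplacian absorb the terms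
in which the discrete error appears. -/
lemma exists_energy_rate_le {lam : ℝ} (h0 : 0 < lam) (h1 : lam < 1) (c : ℝ) (k : ℕ) :
    ∃ K : ℝ, 0 < K ∧ ∀ dx : ℝ, 0 < dx → ∀ W : ℕ → ℝ → ℝ, IsDerivChain (k + 1) W →
      ∀ z : ℝ → ℝ, MemLp z 2 volume → IsFracLaplacian lam (W 0) (fun x => z x + c * W 1 x) →
      ∀ a : ℕ → ℤ → ℝ, Summable (coefSq k a) → ∀ d : ℕ → ℤ → ℝ,
      (∀ q ≤ k, ∀ i : ℤ, dx / (2 * q + 1) * d q i =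
        (∫ x in cell dx i, c * dgFun dx k a x * deriv (legendreCell dx q i) x) +
          (-1) ^ q * upwindFlux c (∑ p ∈ Finset.range (k + 1), a p (i - 1))
            (∑ p ∈ Finset.range (k + 1), a p i * (-1) ^ p) -
          upwindFlux c (∑ p ∈ Finset.range (k + 1), a p (i + 1 - 1))
            (∑ p ∈ Finset.range (k + 1), a p (i + 1) * (-1) ^ p) +
          pairingG lam (dgFun dx k a) (legendreCell dx q i)) →
      ∃ R : ℝ, HasSum (fun i => ∑ q ∈ Finset.range (k + 1), dx / (2 * q + 1) *
          ((a q i - legCoef dx (W 0) q i) * (d q i - legCoef dx z q i))) R ∧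
        R ≤ K * ((1 + dx ^ (1 - lam)) * dx ^ (2 * k + 1)) * ∫ x, W (k + 1) x ^ 2 := by
  obtain ⟨C, hC0, hC⟩ := exists_projection_error_le k
  obtain ⟨E, hE0, hE⟩ := exists_fracEnergy_le h0 h1
  refine ⟨|c| * C + E * C, by positivity, fun dx hdx W hW z hz hfrac a ha d hd => ?_⟩
  have hW0 := hW.memLp 0 (by omega)
  set Θ : ℕ → ℤ → ℝ := fun p i => a p i - legCoef dx (W 0) p i with hΘ
  have hPs := summable_coefSq_legCoef hdx hW0 k
  have hΘs : Summable (coefSq k Θ) := summable_coefSq_sub ha hPs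
  set ρ : ℝ → ℝ := fun x => W 0 x - dgFun dx k (legCoef dx (W 0)) x with hρ
  set V : ℤ → ℝ := fun i => C * dx ^ (2 * k + 1) * ∫ s in cell dx i, W (k + 1) s ^ 2 with hV
  have hV0 : ∀ i, 0 ≤ V i := fun i =>
    mul_nonneg (by positivity) (integral_nonneg fun s => sq_nonneg _)
  have hVs : HasSum V (C * dx ^ (2 * k + 1) * ∫ x, W (k + 1) x ^ 2) :=
    (hasSum_integral_cell hdx (hW.memLp (k + 1) le_rfl).integrable_sq).mul_left _
  -- The traces at the grid points of the discrete error and of the projection error.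
  set A : ℤ → ℝ := fun i => ∑ p ∈ Finset.range (k + 1), Θ p (i - 1) with hA
  set B : ℤ → ℝ := fun i => ∑ p ∈ Finset.range (k + 1), Θ p i * (-1) ^ p with hB
  set r : ℤ → ℝ := fun i =>
    W 0 (i * dx) - ∑ p ∈ Finset.range (k + 1), legCoef dx (W 0) p (i - 1) with hr
  set s : ℤ → ℝ := fun i =>
    W 0 (i * dx) - ∑ p ∈ Finset.range (k + 1), legCoef dx (W 0) p i * (-1) ^ p with hs
  have hcs : ∀ (b : ℕ → ℝ), (∀ p, |b p| ≤ 1) → ∀ i, (∑ p ∈ Finset.range (k + 1), Θ p i * b p) ^ 2 ≤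
      (k + 1) * coefSq k Θ i := by
    intro b hb i
    have h := sq_sum_le_card_mul_sum_sq (s := Finset.range (k + 1)) (f := fun p => Θ p i * b p)
    rw [Finset.card_range] at h
    refine h.trans ?_
    push_cast
    refine mul_le_mul_of_nonneg_left (Finset.sum_le_sum fun p _ => ?_) (by positivity)
    have h2 : b p ^ 2 ≤ 1 := (sq_le_one_iff_abs_le_one _).2 (hb p)
    nlinarith [sq_nonneg (Θ p i)]
  have hAs : Summable fun i => A i ^ 2 := by
    have h : Summable fun i => ((k : ℝ) + 1) * coefSq k Θ (i - 1) :=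
      ((Equiv.subRight (1 : ℤ)).summable_iff.2 hΘs).mul_left _
    refine Summable.of_nonneg_of_le (fun i => sq_nonneg _) (fun i => ?_) h
    have := hcs (fun _ => 1) (by simp) (i - 1)
    simpa only [mul_one] using this
  have hBs : Summable fun i => B i ^ 2 :=
    Summable.of_nonneg_of_le (fun i => sq_nonneg _) (hcs (fun p => (-1) ^ p) (by simp))
      (hΘs.mul_left _)
  have hrV : ∀ i, r i ^ 2 ≤ V (i - 1) := by
    intro i
    have := (hC dx hdx k le_rfl W hW (i - 1)).1 (((i - 1 : ℤ) + 1) * dx)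
      ⟨cell_le hdx _, le_rfl⟩
    rw [cellSum_right] at this
    simpa only [Int.cast_sub, Int.cast_one, sub_add_cancel] using this
  have hsV : ∀ i, s i ^ 2 ≤ V i := by
    intro i
    have := (hC dx hdx k le_rfl W hW i).1 (i * dx) ⟨le_rfl, cell_le hdx _⟩
    rwa [cellSum_left hdx] at this
  have hVs' : HasSum (fun i => V (i - 1)) (C * dx ^ (2 * k + 1) * ∫ x, W (k + 1) x ^ 2) :=
    (Equiv.subRight (1 : ℤ)).hasSum_iff.2 hVs
  have hrs := Summable.of_nonneg_of_le (fun i => sq_nonneg (r i)) hrV hVs'.summable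
  have hss := Summable.of_nonneg_of_le (fun i => sq_nonneg (s i)) hsV hVs.summable
  obtain ⟨R, hR, hRle⟩ := exists_hasSum_flux_le c hAs hBs hrs hss
  have hrle : ∑' i, r i ^ 2 ≤ C * dx ^ (2 * k + 1) * ∫ x, W (k + 1) x ^ 2 :=
    (hrs.tsum_le_tsum hrV hVs'.summable).trans_eq hVs'.tsum_eq
  have hsle : ∑' i, s i ^ 2 ≤ C * dx ^ (2 * k + 1) * ∫ x, W (k + 1) x ^ 2 :=
    (hss.tsum_le_tsum hsV hVs.summable).trans_eq hVs.tsum_eq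
  -- The nonlocal term.
  have hfe : HasFiniteEnergy lam (fun x => dgFun dx k a x - W 0 x) :=
    (hasFiniteEnergy_dgFun h0 h1 hdx ha).sub hfrac.hasFiniteEnergy
  have hpair := hasSum_pairingG_dgFun h0 h1 hdx hfe hΘs
  have hθfe := hasFiniteEnergy_dgFun h0 h1 hdx hΘs
  have hρfe : HasFiniteEnergy lam ρ :=
    hfrac.hasFiniteEnergy.sub (hasFiniteEnergy_dgFun h0 h1 hdx hPs)
  have hpairle : pairingG lam (fun x => dgFun dx k a x - W 0 x) (dgFun dx k Θ) ≤
      E * dx ^ (1 - lam) * (C * dx ^ (2 * k + 1) * ∫ x, W (k + 1) x ^ 2) := by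
    have e1 : (fun x => dgFun dx k a x - W 0 x) = fun x => dgFun dx k Θ x - ρ x := by
      funext x
      rw [hΘ, hρ, dgFun_sub hdx]
      ring
    rw [e1, pairingG_sub_left hθfe hρfe hθfe]
    have hcsp := sq_pairingG_le hρfe hθfe
    have hρE : - pairingG lam ρ ρ ≤
        E * dx ^ (1 - lam) * (C * dx ^ (2 * k + 1) * ∫ x, W (k + 1) x ^ 2) := by
      rw [neg_pairingG_self hρfe, ← hVs.tsum_eq]
      refine ENNReal.toReal_le_of_le_ofReal (mul_nonneg (by positivity) (tsum_nonneg hV0))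
        (hE dx hdx ρ V hρfe.memLp.aestronglyMeasurable ⟨hV0, fun i x hx => ?_,
          fun i x hx y hy => ?_⟩ hVs.summable)
      · simp only [hρ, dgFun_of_mem hdx _ hx]
        exact (hC dx hdx k le_rfl W hW i).1 x (Ioo_subset_Icc_self hx)
      · simp only [hρ, dgFun_of_mem hdx _ hx, dgFun_of_mem hdx _ hy]
        exact (hC dx hdx k le_rfl W hW i).2 x (Ioo_subset_Icc_self hx) y (Ioo_subset_Icc_self hy)
    have n1 := pairingG_self_nonpos lam ρ
    have n2 := pairingG_self_nonpos lam (dgFun dx k Θ)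
    -- Cauchy-Schwarz: the mixed term is absorbed by the energies of `θ` and of `ρ`.
    have h3 : - pairingG lam ρ (dgFun dx k Θ) ≤
        - pairingG lam (dgFun dx k Θ) (dgFun dx k Θ) + - pairingG lam ρ ρ := by
      refine (neg_le_abs _).trans (abs_le_of_sq_le_sq (hcsp.trans ?_) (by linarith))
      nlinarith
    linarith
  refine ⟨R + pairingG lam (fun x => dgFun dx k a x - W 0 x) (dgFun dx k Θ), ?_, ?_⟩
  · refine (hR.add hpair).congr_fun fun i => ?_
    have hterm : ∀ q ∈ Finset.range (k + 1), dx / (2 * q + 1) *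
        (Θ q i * (d q i - legCoef dx z q i)) =
        c * (Θ q i * ∫ x in cell dx i, cellSum dx k i (fun p => Θ p i) x *
          deriv (cellLegendre dx i q) x) +
        Θ q i * (-1) ^ q * (upwindFlux c (A i) (B i) - upwindFlux c (r i) (s i)) -
        Θ q i * (upwindFlux c (A (i + 1)) (B (i + 1)) - upwindFlux c (r (i + 1)) (s (i + 1))) +
        Θ q i * pairingG lam (fun x => dgFun dx k a x - W 0 x) (legendreCell dx q i) := by
      intro q hq
      have hqk : q ≤ k := by simp at hq; omega
      have h := error_equation h0 h1 hdx hW hz hfrac ha hqk (hd q hqk i)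
      -- The flux is linear and consistent, so that it can be evaluated at the differences.
      have hf : ∀ j : ℤ, upwindFlux c (∑ p ∈ Finset.range (k + 1), a p (j - 1))
            (∑ p ∈ Finset.range (k + 1), a p j * (-1) ^ p) - c * W 0 (j * dx) =
          upwindFlux c (A j) (B j) - upwindFlux c (r j) (s j) := by
        intro j
        simp only [hA, hB, hr, hs, hΘ, upwindFlux, sub_mul, Finset.sum_sub_distrib]
        ring
      have hf1 := hf (i + 1)
      push_cast at hf1
      rw [hf, hf1] at h
      calc _ = Θ q i * (dx / (2 * q + 1) * (d q i - legCoef dx z q i)) := by ring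
        _ = _ := by
          rw [h]
          ring
    rw [Finset.sum_congr rfl hterm]
    rw [Finset.sum_add_distrib, Finset.sum_sub_distrib, Finset.sum_add_distrib, ← Finset.mul_sum,
      ← Finset.sum_mul, ← Finset.sum_mul, sum_mul_integral_cellSum_mul_deriv hdx]
    simp only [hA, hB, add_sub_cancel_right]
    ring
  · refine (add_le_add hRle hpairle).trans ?_
    have hI : 0 ≤ ∫ x, W (k + 1) x ^ 2 := integral_nonneg fun x => sq_nonneg _
    have hc : |c| / 2 * ((∑' i, r i ^ 2) + ∑' i, s i ^ 2) ≤
        |c| * (C * dx ^ (2 * k + 1) * ∫ x, W (k + 1) x ^ 2) := by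
      have := abs_nonneg c
      nlinarith
    refine (add_le_add hc le_rfl).trans ?_
    have p1 : 0 ≤ |c| * C * dx ^ (1 - lam) *
        (dx ^ (2 * k + 1) * ∫ x, W (k + 1) x ^ 2) := by positivity
    have p2 : 0 ≤ E * C * (dx ^ (2 * k + 1) * ∫ x, W (k + 1) x ^ 2) := by positivity
    linarith

end

/-! ### Curves in `L²` -/

/-- The coefficients as inner products in `L²(ℝ)` with functions which do not depend on time. -/
lemma legCoef_eq_integral (dx : ℝ) (v : ℝ → ℝ) (p : ℕ) (i : ℤ) :
    legCoef dx v p i = (2 * p + 1) / dx * ∫ x, v x * legendreCell dx p i x := by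
  rw [legCoef, integral_mul_legendreCell]

lemma eLpNorm_le_fracSobolevNorm (lam : ℝ) (v : ℝ → ℝ) :
    eLpNorm v 2 volume ≤ fracSobolevNorm lam v := by
  have h : eLpNorm v 2 volume = (eLpNorm v 2 volume ^ 2) ^ (1 / 2 : ℝ) := by
    rw [← ENNReal.rpow_natCast, ← ENNReal.rpow_mul]
    norm_num
  rw [fracSobolevNorm]
  calc eLpNorm v 2 volume = (eLpNorm v 2 volume ^ 2) ^ (1 / 2 : ℝ) := h
    _ ≤ _ := ENNReal.rpow_le_rpow le_self_add (by norm_num)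

lemma MemFracSobolev.memLp {lam : ℝ} {v : ℝ → ℝ} (h : MemFracSobolev lam v) :
    MemLp v 2 volume := ⟨h.1, (eLpNorm_le_fracSobolevNorm lam v).trans_lt h.2⟩

lemma IsContinuousL2.exists_integral_sq_le {T : ℝ} {u : ℝ → ℝ → ℝ} (hu : IsContinuousL2 T u) :
    ∃ M : ℝ, ∀ t ∈ Icc 0 T, ∫ x, u x t ^ 2 ≤ M := by
  have hc : ContinuousOn (fun t => (eLpNorm (fun x => u x t) 2 volume).toReal) (Icc 0 T) := by
    intro t ht
    rw [ContinuousWithinAt, tendsto_iff_norm_sub_tendsto_zero]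
    have h1 := (ENNReal.tendsto_toReal ENNReal.zero_ne_top).comp (hu t ht).2
    rw [ENNReal.toReal_zero] at h1
    refine squeeze_zero' (.of_forall fun s => norm_nonneg _) ?_ h1
    filter_upwards [self_mem_nhdsWithin] with s hs
    have ms := (hu s hs).1
    have mt := (hu t ht).1
    have md : MemLp (fun x => u x s - u x t) 2 volume := ms.sub mt
    have a1 : (eLpNorm (fun x => u x s) 2 volume).toReal ≤
        (eLpNorm (fun x => u x s - u x t) 2 volume).toReal +
          (eLpNorm (fun x => u x t) 2 volume).toReal := by
      rw [← ENNReal.toReal_add md.2.ne mt.2.ne]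
      refine ENNReal.toReal_mono (ENNReal.add_ne_top.2 ⟨md.2.ne, mt.2.ne⟩) ?_
      refine le_trans (le_of_eq ?_) (eLpNorm_add_le md.1 mt.1 one_le_two)
      congr 1
      funext x
      simp
    have a2 : (eLpNorm (fun x => u x t) 2 volume).toReal ≤
        (eLpNorm (fun x => u x s - u x t) 2 volume).toReal +
          (eLpNorm (fun x => u x s) 2 volume).toReal := by
      rw [← ENNReal.toReal_add md.2.ne ms.2.ne]
      refine ENNReal.toReal_mono (ENNReal.add_ne_top.2 ⟨md.2.ne, ms.2.ne⟩) ?_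
      have e : eLpNorm (fun x => u x s - u x t) 2 volume =
          eLpNorm (fun x => u x t - u x s) 2 volume :=
        eLpNorm_sub_comm (fun x => u x s) (fun x => u x t) 2 volume
      rw [e]
      refine le_trans (le_of_eq ?_) (eLpNorm_add_le (mt.sub ms).1 ms.1 one_le_two)
      congr 1
      funext x
      simp
    rw [Real.norm_eq_abs, abs_le]
    simp only [Function.comp]
    constructor <;> linarith
  obtain ⟨M, hM⟩ := isCompact_Icc.exists_bound_of_continuousOn hc
  refine ⟨M ^ 2, fun t ht => ?_⟩
  rw [← toReal_eLpNorm_two_sq (hu t ht).1]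
  have := hM t ht
  rw [Real.norm_of_nonneg ENNReal.toReal_nonneg] at this
  exact pow_le_pow_left₀ ENNReal.toReal_nonneg this 2

/-- `w` is the derivative of the curve `t ↦ v(·,t)` in `L²(ℝ)`. -/
def HasDerivL2 (T : ℝ) (v w : ℝ → ℝ → ℝ) : Prop :=
  ∀ t ∈ Icc 0 T, Tendsto (fun s => eLpNorm (fun x => (v x s - v x t) / (s - t) - w x t) 2 volume)
    (𝓝[Icc 0 T \ {t}] t) (𝓝 0)

lemma HasDerivL2.isContinuousL2 {T : ℝ} {v w : ℝ → ℝ → ℝ} (h : HasDerivL2 T v w)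
    (hv : ∀ t ∈ Icc 0 T, MemLp (fun x => v x t) 2 volume)
    (hw : ∀ t ∈ Icc 0 T, MemLp (fun x => w x t) 2 volume) : IsContinuousL2 T v := by
  intro t ht
  refine ⟨hv t ht, ?_⟩
  have hd : Tendsto (fun s => eLpNorm (fun x => v x s - v x t) 2 volume) (𝓝[Icc 0 T \ {t}] t)
      (𝓝 0) := by
    have hst : Tendsto (fun s : ℝ => ‖s - t‖ₑ) (𝓝[Icc 0 T \ {t}] t) (𝓝 0) := by
      have : Continuous fun s : ℝ => ‖s - t‖ₑ := by fun_prop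
      have h0 := (this.tendsto t).mono_left (nhdsWithin_le_nhds (s := Icc 0 T \ {t}))
      simpa using h0
    have hlim : Tendsto (fun s => ‖s - t‖ₑ *
        (eLpNorm (fun x => (v x s - v x t) / (s - t) - w x t) 2 volume +
          eLpNorm (fun x => w x t) 2 volume)) (𝓝[Icc 0 T \ {t}] t) (𝓝 0) := by
      have := ENNReal.Tendsto.mul hst (Or.inr (by simpa using (hw t ht).2.ne))
        ((h t ht).add_const (eLpNorm (fun x => w x t) 2 volume)) (Or.inr ENNReal.zero_ne_top)
      simpa using this
    refine tendsto_of_tendsto_of_tendsto_of_le_of_le' tendsto_const_nhds hlim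
      (.of_forall fun s => zero_le) ?_
    filter_upwards [self_mem_nhdsWithin] with s hs
    have hne : s - t ≠ 0 := sub_ne_zero.2 hs.2
    have e : (fun x => v x s - v x t) = (s - t) • ((fun x => (v x s - v x t) / (s - t) - w x t) +
        fun x => w x t) := by
      funext x
      simp only [Pi.smul_apply, Pi.add_apply, smul_eq_mul, sub_add_cancel]
      field_simp
    rw [e, eLpNorm_const_smul]
    refine mul_le_mul_right (eLpNorm_add_le ?_ (hw t ht).1 one_le_two) _
    have hm := (((hv s hs.1).sub (hv t ht)).const_mul (s - t)⁻¹).sub (hw t ht)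
    refine hm.1.congr (.of_forall fun x => ?_)
    simp only [Pi.sub_apply]
    ring
  have hins : 𝓝[Icc 0 T] t ≤ 𝓝[Icc 0 T \ {t}] t ⊔ pure t := by
    have hsub : Icc 0 T ⊆ insert t (Icc 0 T \ {t}) := fun s hs => by
      by_cases hst : s = t
      · exact Or.inl hst
      · exact Or.inr ⟨hs, hst⟩
    refine (nhdsWithin_mono t hsub).trans ?_
    rw [nhdsWithin_insert, sup_comm]
  refine Tendsto.mono_left ?_ hins
  rw [tendsto_sup]
  refine ⟨hd, ?_⟩
  have : eLpNorm (fun x => v x t - v x t) 2 volume = 0 := by simp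
  rw [tendsto_pure_left]
  intro s hs
  simp only [this]
  exact mem_of_mem_nhds hs

/-- Inner products with a fixed function are differentiable along a differentiable curve. -/
lemma HasDerivL2.hasDerivWithinAt {T : ℝ} {v w : ℝ → ℝ → ℝ} (h : HasDerivL2 T v w)
    (hv : ∀ t ∈ Icc 0 T, MemLp (fun x => v x t) 2 volume)
    (hw : ∀ t ∈ Icc 0 T, MemLp (fun x => w x t) 2 volume) {χ : ℝ → ℝ} (hχ : MemLp χ 2 volume)
    {t : ℝ} (ht : t ∈ Icc 0 T) :
    HasDerivWithinAt (fun s => ∫ x, v x s * χ x) (∫ x, w x t * χ x) (Icc 0 T) t := by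
  rw [hasDerivWithinAt_iff_tendsto_slope, tendsto_iff_norm_sub_tendsto_zero]
  have h1 := ((ENNReal.tendsto_toReal ENNReal.zero_ne_top).comp (h t ht)).mul_const
    (eLpNorm χ 2 volume).toReal
  rw [ENNReal.toReal_zero, zero_mul] at h1
  refine squeeze_zero' (.of_forall fun s => norm_nonneg _) ?_ h1
  filter_upwards [self_mem_nhdsWithin] with s hs
  have i1 := integrable_mul_of_memLp_two (hv s hs.1) hχ
  have i2 := integrable_mul_of_memLp_two (hv t ht) hχ
  have i3 := integrable_mul_of_memLp_two (hw t ht) hχ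
  have i4 : Integrable (fun x => (v x s * χ x - v x t * χ x) / (s - t)) volume :=
    (i1.sub i2).div_const _
  have e : slope (fun s => ∫ x, v x s * χ x) t s - ∫ x, w x t * χ x =
      ∫ x, ((v x s - v x t) / (s - t) - w x t) * χ x := by
    rw [slope_def_field, ← integral_sub i1 i2, ← integral_div, ← integral_sub i4 i3]
    congr 1
    funext x
    ring
  have hm : MemLp (fun x => (v x s - v x t) / (s - t) - w x t) 2 volume := by
    have hm := (((hv s hs.1).sub (hv t ht)).const_mul (s - t)⁻¹).sub (hw t ht)
    refine (memLp_congr_ae (.of_forall fun x => ?_)).1 hm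
    simp only [Pi.sub_apply]
    ring
  rw [e, Real.norm_eq_abs]
  exact abs_integral_mul_le hm hχ

lemma IsC1FracSobolev.exists_hasDerivL2 {lam T : ℝ} {v : ℝ → ℝ → ℝ} (h : IsC1FracSobolev lam T v) :
    ∃ w, IsContinuousL2 T v ∧ IsContinuousL2 T w ∧ HasDerivL2 T v w := by
  obtain ⟨hv, w, hw, hwc, hvw⟩ := h
  have hd : HasDerivL2 T v w := fun t ht =>
    tendsto_of_tendsto_of_tendsto_of_le_of_le tendsto_const_nhds (hvw t ht)
      (fun _ => zero_le) fun _ => eLpNorm_le_fracSobolevNorm lam _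
  exact ⟨w, hd.isContinuousL2 (fun t ht => (hv t ht).memLp) (fun t ht => (hw t ht).memLp),
    fun t ht => ⟨(hw t ht).memLp, tendsto_of_tendsto_of_tendsto_of_le_of_le tendsto_const_nhds
      (hwc t ht) (fun _ => zero_le) fun _ => eLpNorm_le_fracSobolevNorm lam _⟩, hd⟩

lemma IsFracLaplacian.congr {lam : ℝ} {v w f g : ℝ → ℝ} (h : IsFracLaplacian lam v f)
    (hv : v =ᵐ[volume] w) (hf : f =ᵐ[volume] g) : IsFracLaplacian lam w g := by
  refine ⟨(memLp_congr_ae hv).1 h.1, (memLp_congr_ae hf).1 h.2.1, ?_⟩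
  rw [← l2Fourier_congr h.1 hv, ← l2Fourier_congr h.2.1 hf]
  exact h.2.2

/-! ### The energy estimate -/

/-- For a curve `v - u` in `L²` with derivative `w - ut`, the square of each Legendre coefficient is
absolutely continuous. -/
lemma sq_legCoef_sub {T : ℝ} (hT : 0 < T) {u ut v w : ℝ → ℝ → ℝ} (hu : IsContinuousL2 T u)
    (hus : MemL2Strip T u) (hut : HasWeakDerivL2 T 0 1 u ut) (hv : IsContinuousL2 T v)
    (hw : IsContinuousL2 T w) (hvw : HasDerivL2 T v w) (dx : ℝ) (p : ℕ) (i : ℤ) :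
    let f := fun t => legCoef dx (fun x => v x t) p i - legCoef dx (fun x => u x t) p i
    let f' := fun t => legCoef dx (fun x => w x t) p i - legCoef dx (fun x => ut x t) p i
    IntervalIntegrable (fun t => f t * f' t) volume 0 T ∧
      2 * ∫ t in (0 : ℝ)..T, f t * f' t = f T ^ 2 - f 0 ^ 2 := by
  intro f f'
  have hχ := memLp_legendreCell dx p i
  have h0 : (0 : ℝ) ∈ Icc 0 T := ⟨le_rfl, hT.le⟩
  have hTm : T ∈ Icc 0 T := ⟨hT.le, le_rfl⟩
  have hwi : ∀ t ∈ Icc 0 T, IntervalIntegrable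
      (fun s => legCoef dx (fun x => w x s) p i) volume 0 t := by
    intro t ht
    simp_rw [legCoef_eq_integral]
    refine ContinuousOn.intervalIntegrable ?_
    rw [uIcc_of_le ht.1]
    exact (continuousOn_const.mul (hw.continuousOn_integral_mul hχ)).mono
      (Icc_subset_Icc le_rfl ht.2)
  have huti : ∀ t ∈ Icc 0 T, IntervalIntegrable
      (fun s => legCoef dx (fun x => ut x s) p i) volume 0 t := by
    intro t ht
    simp_rw [legCoef_eq_integral]
    exact (hut.1.intervalIntegrable_integral_mul hχ h0 ht).const_mul _
  have hf' : ∀ t ∈ Icc 0 T, IntervalIntegrable f' volume 0 t :=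
    fun t ht => (hwi t ht).sub (huti t ht)
  have hprim : ∀ t ∈ Icc 0 T, f t = f 0 + ∫ s in (0 : ℝ)..t, f' s := by
    intro t ht
    have e1 : (∫ x, u x t * legendreCell dx p i x) - ∫ x, u x 0 * legendreCell dx p i x = _ :=
      hu.integral_mul_sub hT hus hut hχ h0 ht ht.1
    have e2 : ∫ s in (0 : ℝ)..t, ∫ x, w x s * legendreCell dx p i x =
        (∫ x, v x t * legendreCell dx p i x) - ∫ x, v x 0 * legendreCell dx p i x := by
      refine intervalIntegral.integral_eq_sub_of_hasDerivAt_of_le ht.1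
        ((hv.continuousOn_integral_mul hχ).mono (Icc_subset_Icc le_rfl ht.2)) (fun s hs => ?_) ?_
      · have hs' : s ∈ Icc 0 T := ⟨hs.1.le, hs.2.le.trans ht.2⟩
        exact (hvw.hasDerivWithinAt (fun t ht => (hv t ht).1) (fun t ht => (hw t ht).1) hχ
          hs').hasDerivAt (Icc_mem_nhds hs.1 (hs.2.trans_le ht.2))
      · refine ContinuousOn.intervalIntegrable ?_
        rw [uIcc_of_le ht.1]
        exact (hw.continuousOn_integral_mul hχ).mono (Icc_subset_Icc le_rfl ht.2)
    have e3 : ∫ s in (0 : ℝ)..t, f' s = (2 * p + 1) / dx *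
        ((∫ s in (0 : ℝ)..t, ∫ x, w x s * legendreCell dx p i x) -
          ∫ s in (0 : ℝ)..t, ∫ x, ut x s * legendreCell dx p i x) := by
      simp only [f']
      rw [intervalIntegral.integral_sub (hwi t ht) (huti t ht)]
      simp_rw [legCoef_eq_integral]
      rw [intervalIntegral.integral_const_mul, intervalIntegral.integral_const_mul]
      ring
    rw [e3, e2, ← e1]
    simp only [f, legCoef_eq_integral]
    ring
  have hfc : ContinuousOn f (uIcc 0 T) := by
    rw [uIcc_of_le hT.le]
    simp only [f, legCoef_eq_integral]
    exact (continuousOn_const.mul (hv.continuousOn_integral_mul hχ)).sub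
      (continuousOn_const.mul (hu.continuousOn_integral_mul hχ))
  refine ⟨(hf' T hTm).continuousOn_mul hfc, ?_⟩
  have h := integral_mul_eq_sub_of_primitive (a := 0) (b := T) (f := f) (g := f) (hf' T hTm)
    (hf' T hTm) (fun x hx => hprim x (by rwa [uIcc_of_le hT.le] at hx))
    (fun x hx => hprim x (by rwa [uIcc_of_le hT.le] at hx))
  have e : ∫ t in (0 : ℝ)..T, f' t * f t = ∫ t in (0 : ℝ)..T, f t * f' t := by
    simp_rw [mul_comm (f' _)]
  rw [e] at h
  linarith

/-- A bound, uniform in the finite set of cells, for the partial sums of the inner product of two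
projections. -/
lemma abs_sum_mul_legCoef_le {dx : ℝ} (hdx : 0 < dx) {f g : ℝ → ℝ} (hf : MemLp f 2 volume)
    (hg : MemLp g 2 volume) (k : ℕ) (s : Finset ℤ) :
    |∑ i ∈ s, ∑ q ∈ Finset.range (k + 1), dx / (2 * q + 1) * (legCoef dx f q i * legCoef dx g q i)|
      ≤ (∫ x, f x ^ 2) + ∫ x, g x ^ 2 := by
  have hb : ∀ h : ℝ → ℝ, MemLp h 2 volume → ∑ i ∈ s, ∑ q ∈ Finset.range (k + 1),
      dx / (2 * q + 1) * (legCoef dx h q i * legCoef dx h q i) ≤ ∫ x, h x ^ 2 := by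
    intro h hh
    refine (Finset.sum_le_sum fun i _ => sum_legCoef_sq_le hdx hh k i).trans ?_
    exact sum_le_hasSum s (fun i _ => integral_nonneg fun x => sq_nonneg _)
      (hasSum_integral_cell hdx hh.integrable_sq)
  refine le_trans ?_ (add_le_add (hb f hf) (hb g hg))
  rw [← Finset.sum_add_distrib]
  refine (Finset.abs_sum_le_sum_abs _ _).trans (Finset.sum_le_sum fun i _ => ?_)
  rw [← Finset.sum_add_distrib]
  refine (Finset.abs_sum_le_sum_abs _ _).trans (Finset.sum_le_sum fun q _ => ?_)
  rw [abs_mul, abs_of_nonneg (by positivity), ← mul_add]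
  refine mul_le_mul_of_nonneg_left ?_ (by positivity)
  rw [abs_le]
  constructor <;> nlinarith [sq_nonneg (legCoef dx f q i + legCoef dx g q i),
    sq_nonneg (legCoef dx f q i - legCoef dx g q i), mul_self_nonneg (legCoef dx f q i),
    mul_self_nonneg (legCoef dx g q i)]

lemma integral_sub_sq_le {f g : ℝ → ℝ} (hf : MemLp f 2 volume) (hg : MemLp g 2 volume) :
    ∫ x, (f x - g x) ^ 2 ≤ 2 * (∫ x, f x ^ 2) + 2 * ∫ x, g x ^ 2 := by
  rw [← integral_const_mul, ← integral_const_mul, ← integral_add (hf.integrable_sq.const_mul 2)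
    (hg.integrable_sq.const_mul 2)]
  refine integral_mono (hf.sub hg).integrable_sq ((hf.integrable_sq.const_mul 2).add
    (hg.integrable_sq.const_mul 2)) fun x => ?_
  nlinarith [sq_nonneg (f x + g x)]

/-- The square of the norm of the projection of a curve in `L²` is controlled by the integral of a
bound for its rate of change. -/
lemma integral_dgFun_legCoef_sub_sq_le {T : ℝ} (hT : 0 < T) {u ut v w : ℝ → ℝ → ℝ}
    (hu : IsContinuousL2 T u) (hus : MemL2Strip T u) (hut : HasWeakDerivL2 T 0 1 u ut)
    (hv : IsContinuousL2 T v) (hw : IsContinuousL2 T w) (hvw : HasDerivL2 T v w) {dx : ℝ}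
    (hdx : 0 < dx) (k : ℕ) {Φ : ℝ → ℝ} (hΦ : Integrable Φ (volume.restrict (Ioo 0 T)))
    (hrate : ∀ᵐ t ∂(volume.restrict (Ioo 0 T)), ∃ R ≤ Φ t,
      HasSum (fun i => ∑ q ∈ Finset.range (k + 1), dx / (2 * q + 1) *
        ((legCoef dx (fun x => v x t) q i - legCoef dx (fun x => u x t) q i) *
          (legCoef dx (fun x => w x t) q i - legCoef dx (fun x => ut x t) q i))) R) :
    ∫ x, dgFun dx k (fun q i => legCoef dx (fun x => v x T) q i - legCoef dx (fun x => u x T) q i)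
        x ^ 2 ≤
      (∫ x, dgFun dx k (fun q i => legCoef dx (fun x => v x 0) q i -
        legCoef dx (fun x => u x 0) q i) x ^ 2) + 2 * ∫ t in Ioo 0 T, Φ t := by
  set f : ℕ → ℤ → ℝ → ℝ := fun q i t =>
    legCoef dx (fun x => v x t) q i - legCoef dx (fun x => u x t) q i with hf
  set f' : ℕ → ℤ → ℝ → ℝ := fun q i t =>
    legCoef dx (fun x => w x t) q i - legCoef dx (fun x => ut x t) q i with hf'
  set F : Finset ℤ → ℝ → ℝ := fun s t => ∑ i ∈ s, ∑ q ∈ Finset.range (k + 1),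
    dx / (2 * q + 1) * (f q i t * f' q i t) with hF
  have h0 : (0 : ℝ) ∈ Icc 0 T := ⟨le_rfl, hT.le⟩
  have hTm : T ∈ Icc 0 T := ⟨hT.le, le_rfl⟩
  have hsum : ∀ t ∈ Icc 0 T, HasSum (fun i => ∑ q ∈ Finset.range (k + 1),
      dx / (2 * q + 1) * (f q i t * f q i t)) (∫ x, dgFun dx k (fun q i => f q i t) x ^ 2) :=
    fun t ht => integral_dgFun_sq_hasSum hdx (summable_coefSq_sub
      (summable_coefSq_legCoef hdx (hv t ht).1 k) (summable_coefSq_legCoef hdx (hu t ht).1 k))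
  have hint : ∀ q i, IntervalIntegrable (fun t => f q i t * f' q i t) volume 0 T := fun q i =>
    (sq_legCoef_sub hT hu hus hut hv hw hvw dx q i).1
  have hFi : ∀ s, IntegrableOn (F s) (Ioo 0 T) volume := fun s => by
    refine integrable_finsetSum _ fun i _ => integrable_finsetSum _ fun q _ =>
      Integrable.const_mul ?_ _
    exact (intervalIntegrable_iff_integrableOn_Ioo_of_le hT.le).1 (hint q i)
  have hFint : ∀ s, 2 * ∫ t in Ioo 0 T, F s t = ∑ i ∈ s, ∑ q ∈ Finset.range (k + 1),
      dx / (2 * q + 1) * (f q i T * f q i T - f q i 0 * f q i 0) := by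
    intro s
    have e : ∫ t in Ioo 0 T, F s t = ∑ i ∈ s, ∑ q ∈ Finset.range (k + 1),
        dx / (2 * q + 1) * ∫ t in (0 : ℝ)..T, f q i t * f' q i t := by
      have hi : ∀ i q, Integrable (fun t => dx / (2 * q + 1) * (f q i t * f' q i t))
          (volume.restrict (Ioo 0 T)) := fun i q =>
        ((intervalIntegrable_iff_integrableOn_Ioo_of_le hT.le).1 (hint q i)).const_mul _
      simp only [hF]
      rw [integral_finsetSum _ fun i _ => integrable_finsetSum _ fun q _ => hi i q]
      refine Finset.sum_congr rfl fun i _ => ?_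
      rw [integral_finsetSum _ fun q _ => hi i q]
      refine Finset.sum_congr rfl fun q _ => ?_
      rw [integral_const_mul, ← integral_Ioc_eq_integral_Ioo,
        ← intervalIntegral.integral_of_le hT.le]
    rw [e, Finset.mul_sum]
    refine Finset.sum_congr rfl fun i _ => ?_
    rw [Finset.mul_sum]
    refine Finset.sum_congr rfl fun q _ => ?_
    have := (sq_legCoef_sub hT hu hus hut hv hw hvw dx q i).2
    rw [← sq, ← sq, ← this]
    ring
  -- The bound which allows to pass to the limit under the integral in time.
  obtain ⟨Mu, hMu⟩ := hu.exists_integral_sq_le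
  obtain ⟨Mv, hMv⟩ := hv.exists_integral_sq_le
  obtain ⟨Mw, hMw⟩ := hw.exists_integral_sq_le
  set G : ℝ → ℝ := fun t => (2 * Mv + 2 * Mu + 2 * Mw) + 2 * ∫ x, ut x t ^ 2 with hG
  have hGi : Integrable G (volume.restrict (Ioo 0 T)) :=
    (integrable_const _).add (hut.1.integrable_integral_sq.const_mul 2)
  have hFG : ∀ᵐ t ∂(volume.restrict (Ioo 0 T)), ∀ s, |F s t| ≤ G t := by
    filter_upwards [ae_restrict_mem measurableSet_Ioo, hut.1.ae_memLp] with t ht hutt s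
    have ht' : t ∈ Icc 0 T := Ioo_subset_Icc_self ht
    have mv := (hv t ht').1
    have mu := (hu t ht').1
    have mw := (hw t ht').1
    have h1 := abs_sum_mul_legCoef_le hdx (mv.sub mu) (mw.sub hutt) k s
    have e1 : ∀ q i, legCoef dx ((fun x => v x t) - fun x => u x t) q i = f q i t := fun q i =>
      legCoef_sub (integrableOn_cell_of_memLp mv dx i) (integrableOn_cell_of_memLp mu dx i) q
    have e2 : ∀ q i, legCoef dx ((fun x => w x t) - fun x => ut x t) q i = f' q i t := fun q i =>
      legCoef_sub (integrableOn_cell_of_memLp mw dx i) (integrableOn_cell_of_memLp hutt dx i) q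
    simp_rw [e1, e2] at h1
    have h2 := integral_sub_sq_le mv mu
    have h3 := integral_sub_sq_le mw hutt
    have h4 := hMu t ht'
    have h5 := hMv t ht'
    have h6 := hMw t ht'
    simp only [Pi.sub_apply] at h1
    simp only [hG]
    exact h1.trans (by linarith)
  -- The rate of change, summed over all cells.
  set R : ℝ → ℝ := fun t => ∑' i, ∑ q ∈ Finset.range (k + 1), dx / (2 * q + 1) *
    (f q i t * f' q i t) with hR
  have hlim : ∀ᵐ t ∂(volume.restrict (Ioo 0 T)), Tendsto (fun s => F s t) atTop (𝓝 (R t)) := by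
    filter_upwards [hrate] with t ht
    obtain ⟨r, -, hr⟩ := ht
    exact hr.summable.hasSum
  have hRΦ : ∀ᵐ t ∂(volume.restrict (Ioo 0 T)), R t ≤ Φ t := by
    filter_upwards [hrate] with t ht
    obtain ⟨r, hrle, hr⟩ := ht
    exact hr.tsum_eq.trans_le hrle
  have hRi : Integrable R (volume.restrict (Ioo 0 T)) := by
    refine hGi.mono' (aestronglyMeasurable_of_tendsto_ae atTop (fun s => (hFi s).1) hlim) ?_
    filter_upwards [hlim, hFG] with t h1 h2
    exact le_of_tendsto h1.norm (.of_forall h2)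
  have hconv : Tendsto (fun s => ∫ t in Ioo 0 T, F s t) atTop (𝓝 (∫ t in Ioo 0 T, R t)) := by
    refine tendsto_integral_filter_of_dominated_convergence G (.of_forall fun s => (hFi s).1)
      (.of_forall fun s => ?_) hGi hlim
    filter_upwards [hFG] with t ht
    exact ht s
  have hdiff : Tendsto (fun s : Finset ℤ => ∑ i ∈ s, ∑ q ∈ Finset.range (k + 1),
      dx / (2 * q + 1) * (f q i T * f q i T - f q i 0 * f q i 0)) atTop
      (𝓝 ((∫ x, dgFun dx k (fun q i => f q i T) x ^ 2) -
        ∫ x, dgFun dx k (fun q i => f q i 0) x ^ 2)) := by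
    have := (hsum T hTm).sub (hsum 0 h0)
    simp only [← Finset.sum_sub_distrib, ← mul_sub] at this
    exact this
  have heq := tendsto_nhds_unique ((hconv.const_mul 2).congr hFint) hdiff
  have hle := integral_mono_ae hRi hΦ hRΦ
  linarith

/-- The energy estimate for the discrete error. -/
lemma exists_energy_le {lam : ℝ} (h0 : 0 < lam) (h1 : lam < 1) (c : ℝ) (k : ℕ) :
    ∃ K : ℝ, 0 < K ∧ ∀ T : ℝ, 0 < T → ∀ u ut : ℝ → ℝ → ℝ, ∀ y : ℕ → ℝ → ℝ → ℝ,
      MemL2Strip T u → IsContinuousL2 T u → HasWeakDerivL2 T 0 1 u ut → y 0 = u →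
      (∀ j ≤ k + 1, MemL2Strip T (y j)) → (∀ j < k + 1, IsWeakDerivX T (y j) (y (j + 1))) →
      (∀ᵐ t ∂(volume.restrict (Ioo 0 T)),
        IsFracLaplacian lam (fun x => u x t) (fun x => ut x t + c * y 1 x t)) →
      ∀ dx : ℝ, 0 < dx → ∀ U : ℕ → ℤ → ℝ → ℝ, IsC1FracSobolev lam T (dgFunction dx k U) →
      (∀ q ≤ k, ∀ i : ℤ, ∀ t ∈ Icc 0 T, ∃ d : ℝ, HasDerivWithinAt (U q i) d (Icc 0 T) t ∧
        dx / (2 * q + 1) * d =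
          (∫ x in cell dx i, c * dgFunction dx k U x t * deriv (legendreCell dx q i) x)
            + (-1) ^ q * fluxAt (upwindFlux c) k U i t - fluxAt (upwindFlux c) k U (i + 1) t
            + pairingG lam (fun x => dgFunction dx k U x t) (legendreCell dx q i)) →
      ∫ x, dgFun dx k (fun q i => U q i T - legCoef dx (fun x => u x T) q i) x ^ 2 ≤
        (∫ x, dgFun dx k (fun q i => U q i 0 - legCoef dx (fun x => u x 0) q i) x ^ 2) +
        K * ((1 + dx ^ (1 - lam)) * dx ^ (2 * k + 1)) * ∫ t in Ioo 0 T, ∫ x, y (k + 1) x t ^ 2 := by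
  obtain ⟨K, hK0, hK⟩ := exists_energy_rate_le h0 h1 c k
  refine ⟨2 * K, by positivity, ?_⟩
  intro T hT u ut y hus hu hut hy0 hy hyd hfrac dx hdx U hU hev
  obtain ⟨w, hv, hw, hvw⟩ := hU.exists_hasDerivL2
  set v := dgFunction dx k U with hvdef
  have hvdg : ∀ t, (fun x => v x t) = dgFun dx k (fun p i => U p i t) := fun t => rfl
  have hcoef : ∀ q ≤ k, ∀ i t, legCoef dx (fun x => v x t) q i = U q i t := by
    intro q hq i t
    rw [hvdg]
    exact legCoef_dgFun hdx _ hq i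
  have hder : ∀ q ≤ k, ∀ i, ∀ t ∈ Icc 0 T, ∀ d, HasDerivWithinAt (U q i) d (Icc 0 T) t →
      d = legCoef dx (fun x => w x t) q i := by
    intro q hq i t ht d hd
    have h2 := (hvw.hasDerivWithinAt (fun t ht => (hv t ht).1) (fun t ht => (hw t ht).1)
      (memLp_legendreCell dx q i) ht).const_mul ((2 * q + 1) / dx)
    simp_rw [← legCoef_eq_integral] at h2
    have h3 : HasDerivWithinAt (U q i) (legCoef dx (fun x => w x t) q i) (Icc 0 T) t := by
      refine h2.congr_of_eventuallyEq_of_mem ?_ ht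
      exact .of_forall fun s => (hcoef q hq i s).symm
    exact (uniqueDiffOn_Icc hT t ht).eq_deriv _ hd h3
  set κ := K * ((1 + dx ^ (1 - lam)) * dx ^ (2 * k + 1)) with hκ
  have key := integral_dgFun_legCoef_sub_sq_le hT hu hus hut hv hw hvw hdx k
    (Φ := fun t => κ * ∫ x, y (k + 1) x t ^ 2)
    ((hy (k + 1) le_rfl).integrable_integral_sq.const_mul κ)
    (by
      filter_upwards [ae_restrict_mem measurableSet_Ioo, hut.1.ae_memLp, hfrac,
        ae_exists_isDerivChain (k + 1) y hy hyd] with t ht hutt hft hch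
      obtain ⟨W, hW, hWy⟩ := hch
      have ht' : t ∈ Icc 0 T := Ioo_subset_Icc_self ht
      have hW0 : W 0 =ᵐ[volume] fun x => u x t := by
        rw [← hy0]
        exact hWy 0 (by omega)
      have hfW : IsFracLaplacian lam (W 0) (fun x => ut x t + c * W 1 x) := by
        refine hft.congr hW0.symm ?_
        filter_upwards [hWy 1 (by omega)] with x hx
        rw [hx]
      have hvt := (hv t ht').1
      rw [hvdg] at hvt
      obtain ⟨R, hR, hRle⟩ := hK dx hdx W hW (fun x => ut x t) hutt hfW (fun p i => U p i t)
        (summable_coefSq_of_memLp hdx hvt) (fun q i => legCoef dx (fun x => w x t) q i) (by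
          intro q hq i
          obtain ⟨d, hd, hdeq⟩ := hev q hq i t ht'
          rw [← hder q hq i t ht' d hd]
          exact hdeq)
      refine ⟨R, ?_, hR.congr_fun fun i => Finset.sum_congr rfl fun q hq => ?_⟩
      · have e : ∫ x, W (k + 1) x ^ 2 = ∫ x, y (k + 1) x t ^ 2 := by
          refine integral_congr_ae ?_
          filter_upwards [hWy (k + 1) le_rfl] with x hx
          rw [hx]
        rw [hκ, ← e]
        exact hRle
      · rw [hcoef q (by simp at hq; omega), legCoef_congr (ae_restrict_of_ae hW0)])
  rw [integral_const_mul] at key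
  have e : ∀ t, dgFun dx k (fun q i => legCoef dx (fun x => v x t) q i -
      legCoef dx (fun x => u x t) q i) =
      dgFun dx k (fun q i => U q i t - legCoef dx (fun x => u x t) q i) := fun t =>
    dgFun_congr fun p hp i => by rw [hcoef p hp]
  rw [e, e] at key
  refine key.trans (le_of_eq ?_)
  rw [hκ]
  ring

/-! ### The projection error at the final time -/

/-- The approximation property of the projection, for functions with `n + 1 ≤ k + 1` derivatives. -/
lemma exists_integral_projection_error_sq_le (k : ℕ) : ∃ C : ℝ, 0 < C ∧ ∀ dx : ℝ, 0 < dx →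
    ∀ n ≤ k, ∀ W : ℕ → ℝ → ℝ, IsDerivChain (n + 1) W →
      ∫ x, (W 0 x - dgFun dx k (legCoef dx (W 0)) x) ^ 2 ≤
        C * dx ^ (2 * n + 2) * ∫ x, W (n + 1) x ^ 2 := by
  obtain ⟨C, hC0, hC⟩ := exists_projection_error_le k
  refine ⟨C, hC0, fun dx hdx n hn W hW => ?_⟩
  have hW0 := hW.memLp 0 (by omega)
  have hρ : MemLp (fun x => W 0 x - dgFun dx k (legCoef dx (W 0)) x) 2 volume :=
    hW0.sub (memLp_dgFun hdx (summable_coefSq_legCoef hdx hW0 k))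
  refine hasSum_le (fun i => ?_) (hasSum_integral_cell hdx hρ.integrable_sq)
    ((hasSum_integral_cell hdx (hW.memLp (n + 1) le_rfl).integrable_sq).mul_left
      (C * dx ^ (2 * n + 2)))
  set V := ∫ s in cell dx i, W (n + 1) s ^ 2
  have h : ∫ x in cell dx i, (W 0 x - dgFun dx k (legCoef dx (W 0)) x) ^ 2 ≤
      ∫ _ in cell dx i, C * dx ^ (2 * n + 1) * V := by
    refine setIntegral_mono_on hρ.integrable_sq.integrableOn
      (integrableOn_const (by rw [volume_cell]; exact ENNReal.ofReal_ne_top))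
      (measurableSet_cell dx i) fun x hx => ?_
    rw [dgFun_of_mem hdx _ hx]
    exact (hC dx hdx n hn W hW i).1 x (Ioo_subset_Icc_self hx)
  refine h.trans (le_of_eq ?_)
  rw [setIntegral_const, Measure.real, volume_cell, ENNReal.toReal_ofReal hdx.le, smul_eq_mul]
  ring

/-- The approximation property for functions with `k` derivatives. For `k = 0` it reduces to the
fact that the projection error is not larger than the function. -/
lemma exists_integral_projection_error_sq_le' (k : ℕ) : ∃ C : ℝ, 0 < C ∧ ∀ dx : ℝ, 0 < dx →
    ∀ W : ℕ → ℝ → ℝ, IsDerivChain k W →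
      ∫ x, (W 0 x - dgFun dx k (legCoef dx (W 0)) x) ^ 2 ≤ C * dx ^ (2 * k) * ∫ x, W k x ^ 2 := by
  obtain ⟨C, hC0, hC⟩ := exists_integral_projection_error_sq_le k
  rcases k with _ | m
  · refine ⟨1, one_pos, fun dx hdx W hW => ?_⟩
    have h := integral_sq_eq_add_projection hdx (hW.memLp 0 le_rfl) 0
    have h2 : 0 ≤ ∫ x, dgFun dx 0 (legCoef dx (W 0)) x ^ 2 := integral_nonneg fun x => sq_nonneg _
    simp only [mul_zero, pow_zero, one_mul]
    linarith
  · exact ⟨C, hC0, fun dx hdx W hW => hC dx hdx m (by omega) W hW⟩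

/-- The increment in time of the projection error. The increment itself is used as a test function
for the time derivative; it is orthogonal to piecewise polynomials, so that only the projection
error of `ut` matters. -/
lemma integral_projection_error_sub_sq_le {T : ℝ} (hT : 0 < T) {u ut : ℝ → ℝ → ℝ}
    (hu : IsContinuousL2 T u) (hus : MemL2Strip T u) (hut : HasWeakDerivL2 T 0 1 u ut) {dx : ℝ}
    (hdx : 0 < dx) (k : ℕ) {Y : ℝ → ℝ} (hY : Integrable Y (volume.restrict (Ioo 0 T)))
    (hY0 : ∀ t, 0 ≤ Y t) (hle : ∀ᵐ t ∂(volume.restrict (Ioo 0 T)),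
      ∫ x, (ut x t - dgFun dx k (legCoef dx fun x => ut x t) x) ^ 2 ≤ Y t) {s : ℝ}
    (hs : s ∈ Ioo 0 T) :
    ∫ x, ((u x T - dgFun dx k (legCoef dx fun x => u x T) x) -
        (u x s - dgFun dx k (legCoef dx fun x => u x s) x)) ^ 2 ≤
      (T - s) * ∫ t in Ioo 0 T, Y t := by
  have hTm : T ∈ Icc 0 T := ⟨hT.le, le_rfl⟩
  have hsm : s ∈ Icc 0 T := Ioo_subset_Icc_self hs
  have huT := (hu T hTm).1
  have hus' := (hu s hsm).1
  have hPT := memLp_dgFun hdx (summable_coefSq_legCoef hdx huT k)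
  have hPs := memLp_dgFun hdx (summable_coefSq_legCoef hdx hus' k)
  set PT := dgFun dx k (legCoef dx fun x => u x T) with hPTd
  set Ps := dgFun dx k (legCoef dx fun x => u x s) with hPsd
  set χ : ℝ → ℝ := fun x => (u x T - PT x) - (u x s - Ps x) with hχd
  have hχ : MemLp χ 2 volume := (huT.sub hPT).sub (hus'.sub hPs)
  have horth : ∀ a : ℕ → ℤ → ℝ, MemLp (dgFun dx k a) 2 volume →
      ∫ x, dgFun dx k a x * χ x = 0 := by
    intro a ha
    have o1 := integral_sub_dgFun_legCoef_mul hdx huT ha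
    have o2 := integral_sub_dgFun_legCoef_mul hdx hus' ha
    have j1 : Integrable (fun x => (u x T - PT x) * dgFun dx k a x) volume :=
      integrable_mul_of_memLp_two (huT.sub hPT) ha
    have j2 : Integrable (fun x => (u x s - Ps x) * dgFun dx k a x) volume :=
      integrable_mul_of_memLp_two (hus'.sub hPs) ha
    rw [← sub_zero (0 : ℝ)]
    nth_rewrite 1 [← o1]
    rw [← o2, ← integral_sub j1 j2]
    congr 1
    funext x
    simp only [hχd]
    ring
  set τ := T - s with hτ
  have hτ0 : 0 < τ := sub_pos.2 hs.2
  set S := ∫ x, χ x ^ 2 with hS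
  have e1 : S = ∫ t in s..T, ∫ x, ut x t * χ x := by
    have h1 : (∫ x, u x T * χ x) - ∫ x, u x s * χ x = _ :=
      hu.integral_mul_sub hT hus hut hχ hsm hTm hs.2.le
    rw [← h1, ← integral_sub (integrable_mul_of_memLp_two huT hχ)
      (integrable_mul_of_memLp_two hus' hχ)]
    have j1 : Integrable (fun x => u x T * χ x - u x s * χ x) volume :=
      (integrable_mul_of_memLp_two huT hχ).sub (integrable_mul_of_memLp_two hus' hχ)
    have j2 := integrable_mul_of_memLp_two hPT hχ
    have j3 := integrable_mul_of_memLp_two hPs hχ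
    have h2 : S = ∫ x, ((u x T * χ x - u x s * χ x) - PT x * χ x) + Ps x * χ x := by
      rw [hS]
      congr 1
      funext x
      simp only [hχd]
      ring
    have j4 : Integrable (fun x => (u x T * χ x - u x s * χ x) - PT x * χ x) volume := j1.sub j2
    rw [h2, integral_add j4 j3, integral_sub j1 j2, horth _ hPT, horth _ hPs]
    ring
  have hYs : IntervalIntegrable Y volume s T := by
    rw [intervalIntegrable_iff_integrableOn_Ioo_of_le hs.2.le]
    exact hY.mono_measure (Measure.restrict_mono (Ioo_subset_Ioo hs.1.le le_rfl) le_rfl)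
  -- Young's inequality, with the weight for which the terms containing `S` sum up to `S / 2`.
  have e2 : S ≤ ∫ t in s..T, (τ / 2 * Y t + S / (2 * τ)) := by
    refine e1.trans_le ?_
    refine intervalIntegral.integral_mono_ae_restrict hs.2.le
      (hut.1.intervalIntegrable_integral_mul hχ hsm hTm)
      ((hYs.const_mul _).add intervalIntegrable_const) ?_
    rw [← restrict_Ioo_eq_restrict_Icc]
    have hr : (volume : Measure ℝ).restrict (Ioo s T) ≤ volume.restrict (Ioo 0 T) :=
      Measure.restrict_mono (Ioo_subset_Ioo hs.1.le le_rfl) le_rfl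
    filter_upwards [ae_mono hr hle, ae_mono hr hut.1.ae_memLp] with t ht hutt
    have hP := memLp_dgFun hdx (summable_coefSq_legCoef hdx hutt k)
    have hρ : MemLp (fun x => ut x t - dgFun dx k (legCoef dx fun x => ut x t) x) 2 volume :=
      hutt.sub hP
    have h3 : ∫ x, ut x t * χ x =
        ∫ x, (ut x t - dgFun dx k (legCoef dx fun x => ut x t) x) * χ x := by
      simp_rw [sub_mul]
      rw [integral_sub (integrable_mul_of_memLp_two hutt hχ) (integrable_mul_of_memLp_two hP hχ),
        horth _ hP, sub_zero]
    rw [h3]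
    have h4 := sq_integral_mul_le hρ hχ
    rw [← hS] at h4
    set I := ∫ x, (ut x t - dgFun dx k (legCoef dx fun x => ut x t) x) * χ x
    have hS0 : 0 ≤ S := integral_nonneg fun x => sq_nonneg _
    have h5 : I ^ 2 ≤ (τ / 2 * Y t + S / (2 * τ)) ^ 2 := by
      have h6 : (τ / 2 * Y t + S / (2 * τ)) ^ 2 - Y t * S = (τ / 2 * Y t - S / (2 * τ)) ^ 2 := by
        field_simp
        ring
      have h7 : I ^ 2 ≤ Y t * S := h4.trans (mul_le_mul_of_nonneg_right ht hS0)
      nlinarith [sq_nonneg (τ / 2 * Y t - S / (2 * τ))]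
    have := hY0 t
    exact (le_abs_self _).trans (abs_le_of_sq_le_sq h5 (by positivity))
  rw [intervalIntegral.integral_add (hYs.const_mul _) intervalIntegrable_const,
    intervalIntegral.integral_const_mul, intervalIntegral.integral_const, ← hτ, smul_eq_mul] at e2
  have e3 : τ * (S / (2 * τ)) = S / 2 := by field_simp
  have e4 : ∫ t in s..T, Y t ≤ ∫ t in Ioo 0 T, Y t := by
    rw [intervalIntegral.integral_of_le hs.2.le, integral_Ioc_eq_integral_Ioo]
    exact setIntegral_mono_set hY (.of_forall hY0) (Ioo_subset_Ioo hs.1.le le_rfl).eventuallyLE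
  rw [e3] at e2
  have := mul_le_mul_of_nonneg_left e4 hτ0.le
  linarith

/-- At the final time only `u(·,T) ∈ L²` is directly available. The rate is obtained by comparison
with the times in an interval of length proportional to the mesh size. -/
lemma exists_final_projection_error_le {T : ℝ} (hT : 0 < T) (k : ℕ) {u ut : ℝ → ℝ → ℝ}
    {y z : ℕ → ℝ → ℝ → ℝ} (hu : IsContinuousL2 T u) (hus : MemL2Strip T u)
    (hut : HasWeakDerivL2 T 0 1 u ut) (hy0 : y 0 = u) (hy : ∀ j ≤ k + 1, MemL2Strip T (y j))
    (hyd : ∀ j < k + 1, IsWeakDerivX T (y j) (y (j + 1))) (hz0 : z 0 = ut)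
    (hz : ∀ j ≤ k, MemL2Strip T (z j)) (hzd : ∀ j < k, IsWeakDerivX T (z j) (z (j + 1))) :
    ∃ C : ℝ, 0 < C ∧ ∀ dx : ℝ, 0 < dx → dx ≤ 1 →
      ∫ x, (u x T - dgFun dx k (legCoef dx fun x => u x T) x) ^ 2 ≤ C * dx ^ (2 * k + 1) := by
  obtain ⟨C0, hC0, hC⟩ := exists_integral_projection_error_sq_le k
  obtain ⟨C1, hC1, hC'⟩ := exists_integral_projection_error_sq_le' k
  set M0 := ∫ t in Ioo 0 T, ∫ x, y (k + 1) x t ^ 2 with hM0d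
  set M1 := ∫ t in Ioo 0 T, ∫ x, z k x t ^ 2 with hM1d
  have hM0 : 0 ≤ M0 := integral_nonneg fun t => integral_nonneg fun x => sq_nonneg _
  have hM1 : 0 ≤ M1 := integral_nonneg fun t => integral_nonneg fun x => sq_nonneg _
  refine ⟨2 * C0 * M0 / T + 2 * T * C1 * M1 + 1, by positivity, fun dx hdx hdx1 => ?_⟩
  have hTm : T ∈ Icc 0 T := ⟨hT.le, le_rfl⟩
  set S := ∫ x, (u x T - dgFun dx k (legCoef dx fun x => u x T) x) ^ 2 with hS
  have hyE : ∀ᵐ t ∂(volume.restrict (Ioo 0 T)),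
      ∫ x, (u x t - dgFun dx k (legCoef dx fun x => u x t) x) ^ 2 ≤
        C0 * dx ^ (2 * k + 2) * ∫ x, y (k + 1) x t ^ 2 := by
    filter_upwards [ae_exists_isDerivChain (k + 1) y hy hyd] with t ht
    obtain ⟨W, hW, hWy⟩ := ht
    have h := hC dx hdx k le_rfl W hW
    have hW0 : W 0 =ᵐ[volume] fun x => u x t := by
      rw [← hy0]
      exact hWy 0 (by omega)
    have e1 : legCoef dx (W 0) = legCoef dx fun x => u x t := by
      funext p i
      exact legCoef_congr (ae_restrict_of_ae hW0) p
    have e2 : ∫ x, W (k + 1) x ^ 2 = ∫ x, y (k + 1) x t ^ 2 := by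
      refine integral_congr_ae ?_
      filter_upwards [hWy (k + 1) le_rfl] with x hx
      rw [hx]
    rw [e1, e2] at h
    refine le_of_eq_of_le (integral_congr_ae ?_) h
    filter_upwards [hW0] with x hx
    rw [hx]
  have hzE : ∀ᵐ t ∂(volume.restrict (Ioo 0 T)),
      ∫ x, (ut x t - dgFun dx k (legCoef dx fun x => ut x t) x) ^ 2 ≤
        C1 * dx ^ (2 * k) * ∫ x, z k x t ^ 2 := by
    filter_upwards [ae_exists_isDerivChain k z hz hzd] with t ht
    obtain ⟨W, hW, hWy⟩ := ht
    have h := hC' dx hdx W hW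
    have hW0 : W 0 =ᵐ[volume] fun x => ut x t := by
      rw [← hz0]
      exact hWy 0 (by omega)
    have e1 : legCoef dx (W 0) = legCoef dx fun x => ut x t := by
      funext p i
      exact legCoef_congr (ae_restrict_of_ae hW0) p
    have e2 : ∫ x, W k x ^ 2 = ∫ x, z k x t ^ 2 := by
      refine integral_congr_ae ?_
      filter_upwards [hWy k le_rfl] with x hx
      rw [hx]
    rw [e1, e2] at h
    refine le_of_eq_of_le (integral_congr_ae ?_) h
    filter_upwards [hW0] with x hx
    rw [hx]
  -- Averaging over an interval of length `T * dx` balances the two contributions.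
  set τ := T * dx with hτ
  have hτ0 : 0 < τ := by positivity
  have hτT : τ ≤ T := by rw [hτ]; nlinarith
  have hsub : Ioo (T - τ) T ⊆ Ioo 0 T := Ioo_subset_Ioo (by linarith) le_rfl
  have hr : (volume : Measure ℝ).restrict (Ioo (T - τ) T) ≤ volume.restrict (Ioo 0 T) :=
    Measure.restrict_mono hsub le_rfl
  have hyi := ((hy (k + 1) le_rfl).integrable_integral_sq).const_mul (2 * C0 * dx ^ (2 * k + 2))
  set D := 2 * (τ * (C1 * dx ^ (2 * k) * M1)) with hD
  have hpt : ∀ᵐ s ∂(volume.restrict (Ioo (T - τ) T)),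
      S ≤ 2 * C0 * dx ^ (2 * k + 2) * (∫ x, y (k + 1) x s ^ 2) + D := by
    filter_upwards [ae_restrict_mem measurableSet_Ioo, ae_mono hr hyE] with s hs hys
    have hs0 := hsub hs
    have hinc := integral_projection_error_sub_sq_le hT hu hus hut hdx k
      ((hz k le_rfl).integrable_integral_sq.const_mul (C1 * dx ^ (2 * k)))
      (fun t => mul_nonneg (by positivity) (integral_nonneg fun x => sq_nonneg _)) hzE hs0
    rw [integral_const_mul, ← hM1d] at hinc
    have huT := (hu T hTm).1
    have hus' := (hu s (Ioo_subset_Icc_self hs0)).1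
    have mT : MemLp (fun x => u x T - dgFun dx k (legCoef dx fun x => u x T) x) 2 volume :=
      huT.sub (memLp_dgFun hdx (summable_coefSq_legCoef hdx huT k))
    have ms : MemLp (fun x => u x s - dgFun dx k (legCoef dx fun x => u x s) x) 2 volume :=
      hus'.sub (memLp_dgFun hdx (summable_coefSq_legCoef hdx hus' k))
    have md : MemLp (fun x => (u x T - dgFun dx k (legCoef dx fun x => u x T) x) -
      (u x s - dgFun dx k (legCoef dx fun x => u x s) x)) 2 volume := mT.sub ms
    have h1 := integral_sub_sq_le md ms.neg
    simp only [Pi.neg_apply, sub_neg_eq_add, sub_add_cancel, neg_sq] at h1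
    have h2 : (T - s) * (C1 * dx ^ (2 * k) * M1) ≤ τ * (C1 * dx ^ (2 * k) * M1) :=
      mul_le_mul_of_nonneg_right (by linarith [hs.1]) (by positivity)
    rw [hD]
    linarith
  have hconst : ∫ _ in Ioo (T - τ) T, S = τ * S := by
    rw [setIntegral_const, Real.volume_real_Ioo_of_le (by linarith), smul_eq_mul, sub_sub_cancel]
  have hconst' : ∫ _ in Ioo (T - τ) T, D = τ * D := by
    rw [setIntegral_const, Real.volume_real_Ioo_of_le (by linarith), smul_eq_mul, sub_sub_cancel]
  have hyi' := hyi.mono_measure hr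
  have h3 := integral_mono_ae (integrable_const S) (hyi'.add (integrable_const D)) hpt
  simp only [Pi.add_apply] at h3
  rw [integral_add hyi' (integrable_const D), hconst, hconst', integral_const_mul] at h3
  have h4 : ∫ s in Ioo (T - τ) T, ∫ x, y (k + 1) x s ^ 2 ≤ M0 :=
    setIntegral_mono_set (hy (k + 1) le_rfl).integrable_integral_sq
      (.of_forall fun t => integral_nonneg fun x => sq_nonneg _) hsub.eventuallyLE
  have h5 : τ * S ≤ τ * ((2 * C0 * M0 / T + 2 * T * C1 * M1) * dx ^ (2 * k + 1)) := by
    have h6 : τ * ((2 * C0 * M0 / T + 2 * T * C1 * M1) * dx ^ (2 * k + 1)) =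
        2 * C0 * dx ^ (2 * k + 2) * M0 + τ * D := by
      rw [hD, hτ]
      field_simp
      ring
    rw [h6]
    have := mul_le_mul_of_nonneg_left h4 (show 0 ≤ 2 * C0 * dx ^ (2 * k + 2) by positivity)
    linarith
  have h7 := le_of_mul_le_mul_left h5 hτ0
  have h8 : 0 ≤ dx ^ (2 * k + 1) := by positivity
  linarith

/-! ### Stability, and the error estimate -/

lemma hasWeakDerivL2_self {T : ℝ} {u : ℝ → ℝ → ℝ} (hu : MemL2Strip T u) :
    HasWeakDerivL2 T 0 0 u u :=
  ⟨hu, fun φ _ _ _ => by simp [partialDeriv]⟩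

lemma memL2Strip_zero (T : ℝ) : MemL2Strip T (fun _ _ => 0) := MemLp.zero'

lemma hasWeakDerivL2_zero (T : ℝ) (a b : ℕ) : HasWeakDerivL2 T a b (fun _ _ => 0) fun _ _ => 0 :=
  ⟨memL2Strip_zero T, fun φ _ _ _ => by simp⟩

lemma isContinuousL2_zero (T : ℝ) : IsContinuousL2 T fun _ _ => 0 :=
  fun _ _ => ⟨MemLp.zero', by simpa using tendsto_const_nhds⟩

lemma isFracLaplacian_zero (lam : ℝ) : IsFracLaplacian lam (fun _ => 0) fun _ => 0 := by
  have hz : MemLp (fun _ : ℝ => (0 : ℝ)) 2 volume := MemLp.zero'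
  refine ⟨hz, hz, ?_⟩
  filter_upwards [l2Fourier_const_mul hz 0] with ξ h
  have h' : l2Fourier (fun _ => (0 : ℝ)) ξ = 0 := by simpa using h
  rw [h', mul_zero]

lemma IsSemidiscreteSolution.init_eq {lam T dx : ℝ} {k : ℕ} {f : ℝ → ℝ} {F : ℝ → ℝ → ℝ}
    {u0 : ℝ → ℝ} {U : ℕ → ℤ → ℝ → ℝ} (h : IsSemidiscreteSolution lam T dx k f F u0 U) {q : ℕ}
    (hq : q ≤ k) (i : ℤ) : U q i 0 = legCoef dx u0 q i := by
  rw [h.init q hq i, legCoef, setIntegral_mul_legendreCell]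

/-- `L²` stability of the method: the energy estimate for the zero solution of the equation. -/
lemma IsSemidiscreteSolution.integral_sq_le {lam c T dx : ℝ} (h0 : 0 < lam) (h1 : lam < 1)
    (hT : 0 < T) (hdx : 0 < dx) {k : ℕ} {u0 : ℝ → ℝ} (hu0 : MemLp u0 2 volume)
    {U : ℕ → ℤ → ℝ → ℝ} (hU : IsC1FracSobolev lam T (dgFunction dx k U))
    (h : IsSemidiscreteSolution lam T dx k (fun a => c * a) (upwindFlux c) u0 U) :
    ∫ x, dgFunction dx k U x T ^ 2 ≤ ∫ x, u0 x ^ 2 := by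
  obtain ⟨K, -, hK⟩ := exists_energy_le h0 h1 c k
  have hE := hK T hT (fun _ _ => 0) (fun _ _ => 0) (fun _ _ _ => 0) (memL2Strip_zero T)
    (isContinuousL2_zero T) (hasWeakDerivL2_zero T 0 1) rfl (fun _ _ => memL2Strip_zero T)
    (fun j _ => (hasWeakDerivL2_zero T j 0).isWeakDerivX (hasWeakDerivL2_zero T (j + 1) 0))
    (.of_forall fun t => by simpa using isFracLaplacian_zero lam) dx hdx U hU h.evol
  have hz : ∀ q i, legCoef dx (fun _ => 0) q i = 0 := fun q i => by simp [legCoef]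
  simp only [hz, sub_zero] at hE
  have e0 : dgFun dx k (fun q i => U q i 0) = dgFun dx k (legCoef dx u0) :=
    dgFun_congr fun q hq i => h.init_eq hq i
  have hP := integral_sq_eq_add_projection hdx hu0 k
  have hn : 0 ≤ ∫ x, (u0 x - dgFun dx k (legCoef dx u0) x) ^ 2 :=
    integral_nonneg fun x => sq_nonneg _
  rw [e0] at hE
  refine (show ∫ x, dgFunction dx k U x T ^ 2 = _ from rfl).trans_le (hE.trans ?_)
  simp
  linarith

end FractalDG

end

theorem theorem25 (lam c T : ℝ) (hlam0 : 0 < lam) (hlam1 : lam < 1) (hT : 0 < T) (k : ℕ)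
    (u0 : ℝ → ℝ) (u : ℝ → ℝ → ℝ)
    (hreg : FractalDG.MemSobolevStrip T (k + 1) u)
    (hsol : FractalDG.IsLinearSolution lam c T u0 u) :
    ∃ C : ℝ, 0 < C ∧ ∀ dx : ℝ, 0 < dx → ∀ U : ℕ → ℤ → ℝ → ℝ,
      FractalDG.IsC1FracSobolev lam T (FractalDG.dgFunction dx k U) →
      FractalDG.IsSemidiscreteSolution lam T dx k (fun a => c * a) (FractalDG.upwindFlux c) u0 U →
      eLpNorm (fun x => u x T - FractalDG.dgFunction dx k U x T) 2 volume ≤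
        ENNReal.ofReal (C * dx ^ ((k : ℝ) + 1 / 2)) := by
  open FractalDG in
  obtain ⟨hus, hu, hinit, ut, ux, hut, hux, hfrac⟩ := hsol
  choose! D hD using hreg.2
  -- The derivatives `∂ₓ^j u` and `∂ₓ^j ∂ₜ u`. The first ones have to be `u`, `ux` and `ut`
  -- themselves, since these satisfy the equation.
  set y : ℕ → ℝ → ℝ → ℝ := fun j => if j = 0 then u else if j = 1 then ux else D j 0 with hy
  set z : ℕ → ℝ → ℝ → ℝ := fun j => if j = 0 then ut else D j 1 with hz
  have hyD : ∀ j ≤ k + 1, HasWeakDerivL2 T j 0 u (y j) := by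
    intro j hj
    rcases j with _ | _ | j
    · exact hasWeakDerivL2_self hus
    · exact hux
    · exact hD (j + 2) 0 (by omega)
  have hzD : ∀ j ≤ k, HasWeakDerivL2 T j 1 u (z j) := by
    intro j hj
    rcases j with _ | j
    · exact hut
    · exact hD (j + 1) 1 (by omega)
  have hyd : ∀ j < k + 1, IsWeakDerivX T (y j) (y (j + 1)) := fun j hj =>
    (hyD j hj.le).isWeakDerivX (hyD (j + 1) hj)
  have hzd : ∀ j < k, IsWeakDerivX T (z j) (z (j + 1)) := fun j hj =>
    (hzD j hj.le).isWeakDerivX (hzD (j + 1) hj)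
  have h0m : (0 : ℝ) ∈ Icc 0 T := ⟨le_rfl, hT.le⟩
  have hTm : T ∈ Icc 0 T := ⟨hT.le, le_rfl⟩
  have hinit' : (fun x => u x 0) =ᵐ[volume] u0 := hinit
  have hu0 : MemLp u0 2 volume := (memLp_congr_ae hinit').1 (hu 0 h0m).1
  obtain ⟨C1, hC1, hρ⟩ := exists_final_projection_error_le hT k hu hus hut (y := y) (z := z) rfl
    (fun j hj => (hyD j hj).1) hyd rfl (fun j hj => (hzD j hj).1) hzd
  obtain ⟨K, hK0, hK⟩ := exists_energy_le hlam0 hlam1 c k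
  set N := ∫ t in Ioo 0 T, ∫ x, y (k + 1) x t ^ 2 with hN
  have hN0 : 0 ≤ N := integral_nonneg fun t => integral_nonneg fun x => sq_nonneg _
  set B := 2 * (∫ x, u x T ^ 2) + 2 * ∫ x, u0 x ^ 2 with hB
  have hB0 : 0 ≤ B := by
    have i1 : 0 ≤ ∫ x, u x T ^ 2 := integral_nonneg fun x => sq_nonneg _
    have i2 : 0 ≤ ∫ x, u0 x ^ 2 := integral_nonneg fun x => sq_nonneg _
    linarith
  set A := 2 * C1 + 4 * K * N + B with hA
  have hA0 : 0 < A := by positivity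
  refine ⟨√A, Real.sqrt_pos.2 hA0, fun dx hdx U hU hS => ?_⟩
  have huT := (hu T hTm).1
  have hvT : MemLp (fun x => dgFunction dx k U x T) 2 volume := (hU.1 T hTm).memLp
  have heT : MemLp (fun x => u x T - dgFunction dx k U x T) 2 volume := huT.sub hvT
  have hsq : ∫ x, (u x T - dgFunction dx k U x T) ^ 2 ≤ A * dx ^ (2 * k + 1) := by
    rcases le_total dx 1 with hdx1 | hdx1
    -- For `dx ≤ 1` the initial discrete error vanishes.
    · have hE := hK T hT u ut y hus hu hut rfl (fun j hj => (hyD j hj).1) hyd hfrac dx hdx U hU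
        hS.evol
      have e0 : dgFun dx k (fun q i => U q i 0 - legCoef dx (fun x => u x 0) q i) =
          fun _ => 0 := by
        have : dgFun dx k (fun q i => U q i 0 - legCoef dx (fun x => u x 0) q i) =
            dgFun dx k (fun _ _ => 0) := by
          refine dgFun_congr fun q hq i => ?_
          rw [hS.init_eq hq i, legCoef_congr (ae_restrict_of_ae hinit'), sub_self]
        rw [this]
        funext x
        simp [dgFun]
      have hρT := hρ dx hdx hdx1
      have hPs := summable_coefSq_legCoef hdx huT k
      have mρ : MemLp (fun x => u x T - dgFun dx k (legCoef dx fun x => u x T) x) 2 volume :=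
        huT.sub (memLp_dgFun hdx hPs)
      have mθ : MemLp (dgFun dx k fun q i => U q i T - legCoef dx (fun x => u x T) q i) 2 volume :=
        memLp_dgFun hdx (summable_coefSq_sub (summable_coefSq_of_memLp hdx hvT) hPs)
      have hsplit := integral_sub_sq_le mρ mθ
      have e1 : ∀ x, (u x T - dgFun dx k (legCoef dx fun x => u x T) x) -
          dgFun dx k (fun q i => U q i T - legCoef dx (fun x => u x T) q i) x =
          u x T - dgFunction dx k U x T := by
        intro x
        rw [dgFun_sub hdx (fun q i => U q i T) (legCoef dx fun x => u x T)]
        simp only [dgFun, dgFunction]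
        ring
      simp_rw [e1] at hsplit
      rw [e0, ← hN] at hE
      have hpow : dx ^ (1 - lam) ≤ 1 := Real.rpow_le_one hdx.le hdx1 (by linarith)
      have hE' : K * ((1 + dx ^ (1 - lam)) * dx ^ (2 * k + 1)) * N ≤
          K * ((1 + 1) * dx ^ (2 * k + 1)) * N := by gcongr
      simp only [ne_eq, OfNat.ofNat_ne_zero, not_false_eq_true, zero_pow, integral_zero,
        zero_add] at hE
      have : 0 ≤ B * dx ^ (2 * k + 1) := by positivity
      rw [hA]
      linarith
    -- For `1 ≤ dx` stability is enough.
    · have hst := hS.integral_sq_le hlam0 hlam1 hT hdx hu0 hU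
      have h1 := integral_sub_sq_le huT hvT
      have h2 : (1 : ℝ) ≤ dx ^ (2 * k + 1) := one_le_pow₀ hdx1
      have h3 : A * 1 ≤ A * dx ^ (2 * k + 1) := by gcongr
      have h4 : 0 ≤ 2 * C1 + 4 * K * N := by positivity
      linarith
  have hrhs : 0 ≤ √A * dx ^ ((k : ℝ) + 1 / 2) := by positivity
  rw [← ENNReal.ofReal_toReal heT.2.ne]
  refine ENNReal.ofReal_le_ofReal (abs_le_of_sq_le_sq' ?_ hrhs).2
  rw [toReal_eLpNorm_two_sq heT, mul_pow, Real.sq_sqrt hA0.le, ← Real.rpow_natCast,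
    ← Real.rpow_mul hdx.le]
  refine hsq.trans_eq ?_
  rw [← Real.rpow_natCast]
  congr 2
  push_cast
  ring
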